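/- **Setting.** Let $f:[-1,1]\to\mathbb R$ be of class $C^3$ such that $f^{(4)}$ exists outside a finite set and is piecewise $C^2$ (it is $C^2$ outside a finite set, and its derivatives of order $0,1,2$ have one-sided limits everywhere in $[-1,1]$). Let $\tilde f(x)=f(2x-1)$ on $[0,1]$ and, on $[-1,0]$, $\tilde f(x)=g_f(x)=\sum_{m=1}^4\big(C_m\cos(m\pi x)+\tfrac1mS_m\sin(m\pi x)\big)$ with $(C_m)=\Phi\,(f(-1),\tfrac{4f''(-1)}{\pi^2},f(1),\tfrac{4f''(1)}{\pi^2})^T$, $(S_m)=\Phi\,(\tfrac{2f'(-1)}{\pi},\tfrac{8f'''(-1)}{\pi^3},\tfrac{2f'(1)}{\pi},\tfrac{8f'''(1)}{\pi^3})^T$, $$\Phi=\begin{pmatrix}9/16&1/16&-9/16&-1/16\\2/3&1/24&2/3&1/24\\-1/16&-1/16&1/16&1/16\\-1/6&-1/24&-1/6&-1/24\end{pmatrix}.$$ Let $\tilde c_k=\frac12\int_{-1}^1e^{-ik\pi x}\tilde f(x)\,dx=|\tilde c_k|e^{i\phi_k}$. Let $H$ be a Hamiltonian on $n\ge1$ qubits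 (space $\mathcal H$) with traceless part $H_0=H-2^{-n}\mathrm{tr}(H)I$, $\|H_0\|_{\rm op}\le1$, and let $t,\epsilon>0$. Put $N(\lambda,t,\epsilon)=\lceil\max(10\lambda^2t^2/\epsilon,\,5\lambda t/2)\rceil$. A *cutoff* is an integer $\grave K\ge1$ with $|\tilde f(x)-\sum_{|k|\le\grave K}\tilde c_ke^{ik\pi x}|<\epsilon/(6t)$ on $[-1,1]$. Circuits act on $\mathcal H$ and one control qubit; the gates are black-box calls $e^{-iH\tau}$ ($\tau\in\mathbb R$), single-qubit gates on the control qubit, and Pauli gates on one qubit of $\mathcal H$ controlled by the control qubit. The runtime of a circuit is its number of gates, so ${\tt ctrl}(\sigma_{\vec v})=|0\rangle\langle0|\otimes I+|1\rangle\langle1|\otimes\sigma_{v_1}\otimes\cdots\otimes\sigma_{v_n}$ costs $n$. For $\vec v_1,\dots,\vec v_M\in\{0,1,2,3\}^n$ write $U_{\tau}(\vec v_{1:M})=\prod_{m=1}^M{\tt ctrl}(\sigma_{\vec v_m})(I\otimes e^{-iH\tau}){\tt ctrl}(\sigma_{\vec v_m})$. **Pre-processing.** Compute $\grave K$ and $\tilde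 c_k$. Put $\epsilon'=\sqrt3\,\epsilon/(12\pi\sum_k|\tilde c_k||k|)$, $s=\epsilon'/(\sqrt2t)$, $G=\max(1,\lceil\log_2(3\pi/s)\rceil)$, $\delta=\frac1{4\sqrt2}+0.16$, $F=\left\lceil\log\frac{1-\sqrt8\delta}2\Big/\log\big(1-\tfrac12(1-\sqrt8\delta)^2\big)\right\rceil$. For each $l\in\{1,\dots,\grave K\}$, $\Phi\in\{0,\frac\pi2\}$, $j\in\{1,\dots,G\}$ put $\kappa=2^{j-1}$, $N'=N(1,\kappa\pi,\frac1{4\sqrt2})$, and perform $F(3(G-j)+1)$ times each of a $Z$-basis measurement (success: $|0\rangle$) and an $X$-basis measurement (success: $|+\rangle$) of the control qubit, each on a fresh copy of the state obtained from $|0\rangle\otimes|0\cdots0\rangle$ by $N'$ iterations of $\widetilde W(e^{-i\kappa\pi Y/N'}\otimes I)\widetilde W^\dagger$. Here $\widetilde W=(e^{-is'\Phi Z/2}\otimes I)\,U_{-s'\pi/(50l\kappa)}(\vec w_{1:25\kappa l^2})\,U_{s'\pi/(20l)}(\vec u_{1:10l^2})$ with fresh uniformly random $\vec u,\vec w$ and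 $s'\in\{\pm1\}$ in each iteration. With success frequencies $q_0,q_+$ let $\varphi_j=\arg\big((2q_0-1)+i(2q_+-1)\big)\in(-\pi,\pi]$; let $\hat v_1=\varphi_1$ and, for $j\ge2$, let $\hat v_j$ be the number in $(\hat v_{j-1}-\pi/2^{j-1},\hat v_{j-1}+\pi/2^{j-1}]$ congruent to $\varphi_j/2^{j-1}$ modulo $2\pi/2^{j-1}$. Let $\hat v_\Phi$ be the representative of $\hat v_G$ modulo $2\pi$ in $(\pi,3\pi]$ if $\Phi=0$ and in $(-\pi,\pi]$ if $\Phi=\pi/2$. Define $\hat A_l>\frac12$, $\hat\theta_l\in[0,2\pi)$ by $\hat A_le^{i\hat\theta_l}=\frac1{2\pi}(\hat v_0-i\hat v_{\pi/2})$; put $(\hat A_{-l},\hat\theta_{-l})=(\hat A_l,-\hat\theta_l)$, $(\hat A_0,\hat\theta_0)=(1,0)$, $\grave\beta=\sum_{|k|\le\grave K}|\tilde c_k|/\hat A_k$ and $\grave N=N(\grave\beta,t,\epsilon/3)$. **Main process.** Start with $|+\rangle$ on the control qubit and the input on $\mathcal H$. Repeat $\grave N$ times: choose $k\in\{-\grave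 K,\dots,\grave K\}$ with probability $|\tilde c_k|/(\hat A_k\grave\beta)$ and $\vec v_1,\dots,\vec v_{10k^2}\in\{0,1,2,3\}^n$ uniformly, and apply $\grave W^\dagger(e^{-i[\cos\phi_kX-\sin\phi_kY]\grave\beta t/\grave N}\otimes I)\grave W$, where $\grave W=U_{k\pi/(20k^2)}(\vec v_{1:10k^2})\,(e^{-ik\pi Z/4}e^{i\hat\theta_kZ/2}\otimes I)$ (for $k=0$ the factor $U$ is absent). Trace out the control qubit. Let $j$ denote the tuple of all random indices and outcomes, $p_j$ its probability and $\mathcal F_j$ the resulting operation on $\mathcal H$; let $\mathcal F(\rho)=e^{-if(H_0)t}\rho e^{if(H_0)t}$. **Theorem.** 1. For every cutoff $\grave K$, the $p_j$ form a probability distribution, and for every finite-dimensional $\mathcal H'$ and unit vector $|\psi\rangle\in\mathcal H\otimes\mathcal H'$, $$\Big\|(\mathcal F\otimes\mathcal I_{\mathcal H'})(|\psi\rangle\langle\psi|)-\sum_jp_j(\mathcal F_j\otimes\mathcal I_{\mathcal H'})(|\psi\rangle\langle\psi|)\Big\|_1\le\epsilon .$$ 2. Under the same conditions, $\sum_jp_j\big\|(\mathcal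 F\otimes\mathcal I_{\mathcal H'})(|\psi\rangle\langle\psi|)-(\mathcal F_j\otimes\mathcal I_{\mathcal H'})(|\psi\rangle\langle\psi|)\big\|_1^2\le2\epsilon$. 3. A least cutoff exists for all $t,\epsilon>0$; for $\epsilon\le t$ it is at most $B_f(t/\epsilon)^{1/3}$ with $B_f$ depending only on $f$. The series $\sum_k|\tilde c_k|k^2$ converges. If $f\not\equiv0$, then: (a) for every cutoff $\grave K$, all $n\ge 1$ and $\epsilon\le t$, the pre-processing takes time $\Theta(\grave K^3t^3n/\epsilon^3)+T$, with implied constants depending only on $f$, where $T$ is the time of the classical computation of $\grave K$, the $\tilde c_k$ and $\grave N$, and the remaining time counts the gates, one unit per measurement and one unit per generation $j$ for the update of the estimate; (b) $C_f:=\big(\sum_k|\tilde c_k|\big)\big(\sum_k|\tilde c_k|k^2\big)>0$, and for every cutoff and every outcome of the pre-processing the average runtime of the main process is $\Theta(C_f\,t^2n/\epsilon)$, with absolute implied constants, whenever $t/\epsilon$ and $t^2/\epsilon$ exceed a threshold depending only on $f$. -/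

import Mathlib

open scoped Matrix Kronecker Topology

noncomputable section

namespace UHET

/-! ### The function to be simulated -/

/-- `g` is piecewise of class `C^J` on `[-1, 1]` with exceptional points in the finite set `S`
(the values of `g` at exceptional points are irrelevant): `g` is `C^J` on `(-1, 1)` away from `S`
and all derivatives up to order `J` have one-sided limits at every point of `[-1, 1]`. -/
def PiecewiseC (J : ℕ) (g : ℝ → ℝ) (S : Finset ℝ) : Prop :=
  ContDiffOn ℝ J g (Set.Ioo (-1) 1 \ S) ∧
  ∀ m ≤ J,
    (∀ a ∈ Set.Ico (-1 : ℝ) 1, ∃ L : ℝ, Filter.Tendsto (iteratedDeriv m g) (𝓝[>] a) (𝓝 L)) ∧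
    (∀ a ∈ Set.Ioc (-1 : ℝ) 1, ∃ L : ℝ, Filter.Tendsto (iteratedDeriv m g) (𝓝[<] a) (𝓝 L))

/-- The `m`-th derivative of `f : [-1, 1] → ℝ` (one-sided at the end points). -/
def der (m : ℕ) (f : ℝ → ℝ) (x : ℝ) : ℝ := iteratedDerivWithin m f (Set.Icc (-1) 1) x

/-- `f` is of class `C^3` on `[-1, 1]`, and its fourth derivative (which exists outside a finite
set) is piecewise `C^2`. Only the values of `f` on `[-1, 1]` matter. -/
def Admissible (f : ℝ → ℝ) : Prop :=
  ContDiffOn ℝ 3 f (Set.Icc (-1) 1) ∧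
  ∃ (g : ℝ → ℝ) (S : Finset ℝ), PiecewiseC 2 g S ∧
    ∀ x ∈ Set.Ioo (-1 : ℝ) 1 \ S, HasDerivAt (der 3 f) (g x) x

/-- The coefficient matrix of the trigonometric continuation. -/
def coeffMatrix : Matrix (Fin 4) (Fin 4) ℝ :=
  !![9 / 16, 1 / 16, -9 / 16, -1 / 16;
     2 / 3, 1 / 24, 2 / 3, 1 / 24;
     -1 / 16, -1 / 16, 1 / 16, 1 / 16;
     -1 / 6, -1 / 24, -1 / 6, -1 / 24]

/-- `(C₁, C₂, C₃, C₄)`. -/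
def cosCoeff (f : ℝ → ℝ) : Fin 4 → ℝ :=
  coeffMatrix *ᵥ ![f (-1), 4 * der 2 f (-1) / Real.pi ^ 2, f 1, 4 * der 2 f 1 / Real.pi ^ 2]

/-- `(S₁, S₂, S₃, S₄)`. -/
def sinCoeff (f : ℝ → ℝ) : Fin 4 → ℝ :=
  coeffMatrix *ᵥ ![2 * der 1 f (-1) / Real.pi, 8 * der 3 f (-1) / Real.pi ^ 3,
    2 * der 1 f 1 / Real.pi, 8 * der 3 f 1 / Real.pi ^ 3]

/-- `g_f(x) = ∑_{m=1}^4 (C_m cos(mπx) + (S_m / m) sin(mπx))`. -/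
def gExt (f : ℝ → ℝ) (x : ℝ) : ℝ :=
  ∑ m : Fin 4, (cosCoeff f m * Real.cos (((m : ℕ) + 1 : ℝ) * Real.pi * x) +
    sinCoeff f m / ((m : ℕ) + 1 : ℝ) * Real.sin (((m : ℕ) + 1 : ℝ) * Real.pi * x))

/-- The periodically smooth modification `f̃` of `f` on `[-1, 1]`. -/
def fTilde (f : ℝ → ℝ) (x : ℝ) : ℝ := if x < 0 then gExt f x else f (2 * x - 1)

/-- The Fourier coefficients `c̃_k = (1/2) ∫_{-1}^1 e^{-ikπx} f̃(x) dx`. -/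
def coeff (f : ℝ → ℝ) (k : ℤ) : ℂ :=
  (1 / 2 : ℂ) * ∫ x in (-1 : ℝ)..1,
    Complex.exp (-(Complex.I * k * Real.pi * x)) * (fTilde f x : ℂ)

/-- `K` is an admissible cutoff number for time `t` and allowed error `ε`. -/
def IsCutoff (f : ℝ → ℝ) (t ε : ℝ) (K : ℕ) : Prop :=
  0 < K ∧ ∀ x ∈ Set.Icc (-1 : ℝ) 1,
    ‖(fTilde f x : ℂ) -
      ∑ k ∈ Finset.Icc (-(K : ℤ)) K, coeff f k * Complex.exp (Complex.I * k * Real.pi * x)‖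
      < ε / (6 * t)

/-- `C_f = (∑_k |c̃_k|) (∑_k |c̃_k| k²)`. -/
def runConst (f : ℝ → ℝ) : ℝ :=
  (∑' k : ℤ, ‖coeff f k‖) * ∑' k : ℤ, ‖coeff f k‖ * (k : ℝ) ^ 2

/-! ### Qubits, trace norm, channels -/

/-- Computational basis of `n` qubits. -/
abbrev Qubits (n : ℕ) : Type := Fin n → Fin 2

/-- Operators on `n` qubits. -/
abbrev Op (n : ℕ) : Type := Matrix (Qubits n) (Qubits n) ℂ

/-- Operators on the control qubit and `n` further qubits. -/
abbrev OpC (n : ℕ) : Type := Matrix (Fin 2 × Qubits n) (Fin 2 × Qubits n) ℂ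

/-- The Pauli matrices `σ₀ = I`, `σ₁ = X`, `σ₂ = Y`, `σ₃ = Z`. -/
def pauli : Fin 4 → Matrix (Fin 2) (Fin 2) ℂ :=
  ![1, !![0, 1; 1, 0], !![0, -Complex.I; Complex.I, 0], !![1, 0; 0, -1]]

/-- The Pauli matrix `σ_a` acting on qubit `i`. -/
def pauliAt {n : ℕ} (i : Fin n) (a : Fin 4) : Op n :=
  Matrix.of fun x y => if ∀ l, l ≠ i → x l = y l then pauli a (x i) (y i) else 0

/-- The traceless part `H₀ = H - (tr H / 2^n) I`. -/
def traceless {n : ℕ} (H : Op n) : Op n := H - (H.trace / 2 ^ n) • (1 : Op n)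

/-- `e^{-iAτ}`. -/
def evol {m : Type} [Fintype m] [DecidableEq m] (A : Matrix m m ℂ) (τ : ℝ) : Matrix m m ℂ :=
  NormedSpace.exp ((-(Complex.I * τ)) • A)

/-- The trace norm `‖A‖₁ = tr √(A† A)`: the sum of the square roots of the eigenvalues of
`A† A`. -/
def traceNorm {m : Type} [Fintype m] [DecidableEq m] (A : Matrix m m ℂ) : ℝ :=
  ∑ i, √((Matrix.isHermitian_conjTranspose_mul_self A).eigenvalues i)

/-- `(F ⊗ 𝓘)(A)`, where `𝓘` is the identity map on the operators of a `d`-dimensional system. -/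
def ampliate {n d : ℕ} (F : Op n → Op n) (A : Matrix (Qubits n × Fin d) (Qubits n × Fin d) ℂ) :
    Matrix (Qubits n × Fin d) (Qubits n × Fin d) ℂ :=
  Matrix.of fun p q => F (Matrix.of fun x y => A (x, p.2) (y, q.2)) p.1 q.1

/-- `|ψ⟩⟨ψ|`. -/
def pureState {m : Type} (ψ : m → ℂ) : Matrix m m ℂ := Matrix.vecMulVec ψ (star ψ)

/-- The ideal operation `ρ ↦ e^{-if(H₀)t} ρ e^{if(H₀)t}`; `f(H₀)` is the functional calculus. -/
def idealOp {n : ℕ} (f : ℝ → ℝ) (H : Op n) (t : ℝ) (ρ : Op n) : Op n :=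
  evol (cfc f (traceless H)) t * ρ * (evol (cfc f (traceless H)) t)ᴴ

/-- `|+⟩⟨+|` on the control qubit. -/
def plusState : Matrix (Fin 2) (Fin 2) ℂ := !![1 / 2, 1 / 2; 1 / 2, 1 / 2]

/-- The partial trace over the control qubit. -/
def traceControl {n : ℕ} (A : OpC n) : Op n :=
  Matrix.of fun x y => ∑ s : Fin 2, A (s, x) (s, y)

/-! ### Circuits with black-box access to the dynamics -/

/-- The available gates: a Pauli gate on one system qubit controlled by the control qubit, one
call to the black-box dynamics `e^{-iHτ}` (of either sign of `τ`), and the single-qubit gate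
`e^{-i(r₀ X + r₁ Y + r₂ Z)}` on the control qubit. -/
inductive Gate (n : ℕ) : Type
  | cpauli (i : Fin n) (a : Fin 4) : Gate n
  | query (τ : ℝ) : Gate n
  | rotation (r : Fin 3 → ℝ) : Gate n

/-- The unitary of a gate when the black box holds the Hamiltonian `H`. -/
def Gate.matrix {n : ℕ} (H : Op n) : Gate n → OpC n
  | .cpauli i a => Matrix.single 0 0 1 ⊗ₖ (1 : Op n) + Matrix.single 1 1 1 ⊗ₖ pauliAt i a
  | .query τ => (1 : Matrix (Fin 2) (Fin 2) ℂ) ⊗ₖ evol H τ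
  | .rotation r =>
      evol ((r 0 : ℂ) • pauli 1 + (r 1 : ℂ) • pauli 2 + (r 2 : ℂ) • pauli 3) 1 ⊗ₖ (1 : Op n)

/-- The inverse gate. -/
def Gate.inv {n : ℕ} : Gate n → Gate n
  | .cpauli i a => .cpauli i a
  | .query τ => .query (-τ)
  | .rotation r => .rotation (-r)

/-- A circuit, written like an operator product: the last gate of the list is applied first. -/
abbrev Circuit (n : ℕ) : Type := List (Gate n)

/-- The unitary of a circuit. -/
def Circuit.matrix {n : ℕ} (H : Op n) (c : Circuit n) : OpC n := (c.map (Gate.matrix H)).prod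

/-- The inverse circuit. -/
def Circuit.inv {n : ℕ} (c : Circuit n) : Circuit n := (c.map Gate.inv).reverse

/-- The runtime of a circuit is its number of gates. -/
def Circuit.runtime {n : ℕ} (c : Circuit n) : ℕ := c.length

/-- `ctrl(σ_v)` for `σ_v = σ_{v₁} ⊗ ⋯ ⊗ σ_{v_n}`. -/
def ctrlPauli {n : ℕ} (v : Fin n → Fin 4) : Circuit n := List.ofFn fun i => Gate.cpauli i (v i)

/-- `∏_{m=1}^{M} ctrl(σ_{v_m}) (I ⊗ e^{-iHτ}) ctrl(σ_{v_m})`. -/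
def controlization {n M : ℕ} (τ : ℝ) (v : Fin M → Fin n → Fin 4) : Circuit n :=
  (List.ofFn v).flatMap fun u => ctrlPauli u ++ [Gate.query τ] ++ ctrlPauli u

/-- The qDRIFT iteration number `N(λ, t, ε) = ⌈max(10 λ² t² / ε, 5 λ t / 2)⌉`. -/
def iterations (lam t ε : ℝ) : ℕ := ⌈max (10 * lam ^ 2 * t ^ 2 / ε) (5 * lam * t / 2)⌉₊

/-! ### Pre-processing: estimation of the compensation parameters -/

/-- The random choices `(j', j'', s)` of one iteration of the state generation. -/
abbrev PrepIndex (n l M : ℕ) : Type :=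
  (Fin (10 * l ^ 2) → Fin n → Fin 4) × (Fin (l ^ 2 * M) → Fin n → Fin 4) × Bool

/-- The unitary `W̃_{l,j,Φ}`, with `s = 1` for `true` and `s = -1` for `false`. -/
def prepW {n l M : ℕ} (Φ : ℝ) (j : PrepIndex n l M) : Circuit n :=
  let s : ℝ := if j.2.2 then 1 else -1
  [Gate.rotation ![0, 0, s * Φ / 2]] ++
    controlization (-(s * Real.pi / (2 * l * M))) j.2.1 ++
    controlization (s * Real.pi / (20 * l)) j.1

/-- One iteration `W̃ (e^{-iγY} ⊗ I) W̃†` of the state generation. -/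
def prepStep {n l M : ℕ} (γ Φ : ℝ) (j : PrepIndex n l M) : Circuit n :=
  prepW Φ j ++ [Gate.rotation ![0, γ, 0]] ++ Circuit.inv (prepW Φ j)

/-- The state-generation circuit with `N` iterations for given random choices. -/
def prepCircuit {n l M N : ℕ} (γ Φ : ℝ) (j : Fin N → PrepIndex n l M) : Circuit n :=
  ((List.ofFn j).reverse.map (prepStep γ Φ)).flatten

/-- The iteration number `N' = N(1, kπ, 1/(4√2))`. -/
def prepN (k : ℕ) : ℕ := iterations 1 (k * Real.pi) (1 / (4 * √2))

/-- Probability of success of a measurement of the control qubit of `U |0⟩|0…0⟩`: outcome `|+⟩`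
of the `X`-basis measurement if `b`, outcome `|0⟩` of the `Z`-basis measurement otherwise. -/
def bornProb {n : ℕ} (U : OpC n) (b : Bool) : ℝ :=
  ∑ y : Qubits n,
    if b then ‖(U (0, y) (0, 0) + U (1, y) (0, 0)) / (√2 : ℂ)‖ ^ 2 else ‖U (0, y) (0, 0)‖ ^ 2

/-- Success probability of the `k`-th measurement for the parameters with index `l`: the state is
generated with `N = N'`, `γ = kπ/N'`, `M = 25k` and uniformly random choices. -/
def successProb {n : ℕ} (H : Op n) (l k : ℕ) (Φ : ℝ) (b : Bool) : ℝ :=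
  (∑ j : Fin (prepN k) → PrepIndex n l (25 * k),
    bornProb (Circuit.matrix H (prepCircuit (k * Real.pi / prepN k) Φ j)) b) /
  Fintype.card (Fin (prepN k) → PrepIndex n l (25 * k))

/-- The runtime of one such measurement: the gates of the circuit and one measurement (the number
of gates is the same for all random choices). -/
def trialRuntime (n l k : ℕ) : ℕ :=
  Circuit.runtime (prepCircuit (n := n) (l := l) (M := 25 * k) (N := prepN k)
    (k * Real.pi / prepN k) 0 fun _ => (fun _ _ => 0, fun _ _ => 0, true)) + 1

/-- Upper bound `1/(4√2) + 0.16 < 1/√8` for the deviations of the success probabilities. -/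
def deltaSup : ℝ := 1 / (4 * √2) + 0.16

/-- The constant `F(δ_sup)` of robust phase estimation. -/
def rpeConst : ℕ :=
  ⌈Real.log ((1 - √8 * deltaSup) / 2) / Real.log (1 - (1 - √8 * deltaSup) ^ 2 / 2)⌉₊

/-- Number of generations of robust phase estimation for an allowed standard deviation `s`. -/
def generations (s : ℝ) : ℕ := max 1 ⌈Real.logb 2 (3 * Real.pi / s)⌉₊

/-- Number of repetitions `F (3 (G - j') + 1)` of both measurements in generation `j' = j + 1`,
out of `G` generations. -/
def reps (G : ℕ) (j : Fin G) : ℕ := rpeConst * (3 * (G - 1 - (j : ℕ)) + 1)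

/-- All measurements of the pre-processing: the index `l = i + 1`, the angle `Φ` (`π/2` for
`true`, `0` for `false`), the generation, the kind of measurement, the repetition. -/
abbrev Trial (K G : ℕ) : Type := Fin K × Bool × (Σ j : Fin G, Bool × Fin (reps G j))

/-- A complete record of outcomes (`true` is success). -/
abbrev Record (K G : ℕ) : Type := Trial K G → Bool

/-- The angle `Φ ∈ {0, π/2}`. -/
def angle (b : Bool) : ℝ := if b then Real.pi / 2 else 0

/-- The probability of a record; all measurements are independent, those of generation `j + 1`
are `(0, 2^j)`- and `(+, 2^j)`-measurements. -/
def recordProb {n K G : ℕ} (H : Op n) (ω : Record K G) : ℝ :=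
  ∏ τ : Trial K G,
    let p := successProb H ((τ.1 : ℕ) + 1) (2 ^ (τ.2.2.1 : ℕ)) (angle τ.2.1) τ.2.2.2.1
    if ω τ then p else 1 - p

/-- Observed success frequency. -/
def frequency {K G : ℕ} (ω : Record K G) (i : Fin K) (Φ : Bool) (j : Fin G) (b : Bool) : ℝ :=
  ((Finset.univ.filter fun r : Fin (reps G j) => ω (i, Φ, ⟨j, b, r⟩) = true).card : ℝ) / reps G j

/-- The estimate in `(-π, π]` of `2^j v` modulo `2π` from the frequencies of generation
`j + 1`. -/
def phaseOf {K G : ℕ} (ω : Record K G) (i : Fin K) (Φ : Bool) (j : ℕ) : ℝ :=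
  if h : j < G then
    Complex.arg (⟨2 * frequency ω i Φ ⟨j, h⟩ false - 1, 2 * frequency ω i Φ ⟨j, h⟩ true - 1⟩ : ℂ)
  else 0

/-- The successive estimates of robust phase estimation: the estimate of generation `j + 1` is
the unique number that is compatible with the phase `φ j` of that generation, i.e. equal to
`φ j / 2^j` modulo `2π / 2^j`, and lies in the half-open interval of radius `π / 2^j` around the
preceding estimate. -/
def refine (φ : ℕ → ℝ) : ℕ → ℝ
  | 0 => φ 0
  | j + 1 => toIocMod (p := 2 * Real.pi / 2 ^ (j + 1)) (by positivity)
      (refine φ j - Real.pi / 2 ^ (j + 1)) (φ (j + 1) / 2 ^ (j + 1))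

/-- The estimate `v̂_Φ` of `2π A cos(θ + Φ)`. Phase estimation determines it modulo `2π`; the
representative is taken in `(π, 3π]` for `Φ = 0` and in `(-π, π]` for `Φ = π/2`. -/
def vHat {K G : ℕ} (ω : Record K G) (i : Fin K) (Φ : Bool) : ℝ :=
  toIocMod Real.two_pi_pos (if Φ then -Real.pi else Real.pi) (refine (phaseOf ω i Φ) (G - 1))

/-- `Â e^{iθ̂}`: the real part `Â cos θ̂` is `v̂_0 / 2π`, and, as `cos(θ + π/2) = - sin θ`, the
imaginary part `Â sin θ̂` is `- v̂_{π/2} / 2π`. -/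
def zHat {K G : ℕ} (ω : Record K G) (i : Fin K) : ℂ :=
  ⟨vHat ω i false / (2 * Real.pi), -(vHat ω i true / (2 * Real.pi))⟩

/-- The acceptance test `Â > 1/2` of the estimation is always passed, so that the estimation never
has to be repeated. -/
theorem half_lt_norm_zHat {K G : ℕ} (ω : Record K G) (i : Fin K) : 1 / 2 < ‖zHat ω i‖ := by
  have hpi := Real.pi_pos
  have h : Real.pi < vHat ω i false := by
    have := (toIocMod_mem_Ioc Real.two_pi_pos Real.pi
      (refine (phaseOf ω i false) (G - 1))).1
    simpa [vHat] using this
  have h2 : 1 / 2 < (zHat ω i).re := by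
    simp only [zHat]
    rw [lt_div_iff₀ (by positivity)]
    linarith
  exact lt_of_lt_of_le h2 ((le_abs_self _).trans (Complex.abs_re_le_norm _))

/-- `Â_k`, with `Â_{-k} = Â_k` and `Â_0 = 1`. -/
def aHat {K G : ℕ} (ω : Record K G) (k : ℤ) : ℝ :=
  if h : 0 < k.natAbs ∧ k.natAbs ≤ K then ‖zHat ω ⟨k.natAbs - 1, by omega⟩‖ else 1

/-- `θ̂_k`, in `[0, 2π)` for `k > 0`, with `θ̂_{-k} = -θ̂_k` and `θ̂_0 = 0`. -/
def thetaHat {K G : ℕ} (ω : Record K G) (k : ℤ) : ℝ :=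
  if h : 0 < k.natAbs ∧ k.natAbs ≤ K then
    k.sign * toIcoMod Real.two_pi_pos 0 (Complex.arg (zHat ω ⟨k.natAbs - 1, by omega⟩))
  else 0

/-- The allowed error `√3 ε / (12π ∑_k |c̃_k| |k|)` of the parameter estimation. -/
def paramError (f : ℝ → ℝ) (ε : ℝ) : ℝ :=
  √3 * ε / (12 * Real.pi * ∑' k : ℤ, ‖coeff f k‖ * |(k : ℝ)|)

/-- The number of generations used; the allowed root mean square error of `v̂_Φ` is the allowed
error of the parameter estimation divided by `√2 t`. -/
def numGen (f : ℝ → ℝ) (t ε : ℝ) : ℕ := generations (paramError f ε / (√2 * t))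

/-- The runtime of the pre-processing: all measurements, one update of the estimate per
generation, and the time `T` of the classical computation of the Fourier coefficients, the
cutoff number and the iteration number. -/
def preRuntime (n : ℕ) (f : ℝ → ℝ) (t ε : ℝ) (K : ℕ) (T : ℝ) : ℝ :=
  T + ∑ i : Fin K, ∑ _Φ : Bool, ∑ j : Fin (numGen f t ε),
    ((∑ _b : Bool, (reps _ j : ℝ) * trialRuntime n ((i : ℕ) + 1) (2 ^ (j : ℕ))) + 1)

/-! ### The main part of the algorithm -/

section Main

variable {n K G : ℕ}

/-- `β̀ = ∑_{|k| ≤ K} |c̃_k| / Â_k`. -/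
def beta (f : ℝ → ℝ) (ω : Record K G) : ℝ :=
  ∑ k ∈ Finset.Icc (-(K : ℤ)) K, ‖coeff f k‖ / aHat ω k

/-- `Ǹ = N(β̀, t, ε/3)`. -/
def mainN (f : ℝ → ℝ) (t ε : ℝ) (ω : Record K G) : ℕ := iterations (beta f ω) t (ε / 3)

/-- The random choices `(k, j_k)` of one iteration. -/
abbrev StepIndex (n K : ℕ) : Type :=
  Σ k : Finset.Icc (-(K : ℤ)) K, Fin (10 * (k : ℤ).natAbs ^ 2) → Fin n → Fin 4

/-- The probability `p̀_k 4^{-10 n k²}` of `(k, j_k)`, with `p̀_k = |c̃_k| / (Â_k β̀)`. -/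
def stepProb (f : ℝ → ℝ) (ω : Record K G) (s : StepIndex n K) : ℝ :=
  ‖coeff f s.1‖ / (aHat ω s.1 * beta f ω) * (1 / 4) ^ (10 * n * (s.1 : ℤ).natAbs ^ 2)

/-- `W_{k,v}^{(M)} = [∏_l ctrl(σ_{v_l}) (I ⊗ e^{-ikπH/(2M)}) ctrl(σ_{v_l})] (e^{-ikπZ/4} ⊗ I)`. -/
def wCircuit {M : ℕ} (k : ℤ) (v : Fin M → Fin n → Fin 4) : Circuit n :=
  controlization (k * Real.pi / (2 * M)) v ++ [Gate.rotation ![0, 0, k * Real.pi / 4]]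

/-- `Ẁ_{k,j_k} = W_{k,j_k}^{(10k²)} (e^{iθ̂_k Z/2} ⊗ I)`. -/
def wHat (ω : Record K G) (s : StepIndex n K) : Circuit n :=
  wCircuit s.1 s.2 ++ [Gate.rotation ![0, 0, -(thetaHat ω s.1 / 2)]]

/-- One iteration `Ẁ† (e^{-i[cos φ_k X - sin φ_k Y] β̀ t / Ǹ} ⊗ I) Ẁ`, where `φ_k` is the argument
of `c̃_k`. -/
def mainStep (f : ℝ → ℝ) (t ε : ℝ) (ω : Record K G) (s : StepIndex n K) : Circuit n :=
  let τ : ℝ := beta f ω * t / mainN f t ε ω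
  let φ : ℝ := Complex.arg (coeff f s.1)
  Circuit.inv (wHat ω s) ++ [Gate.rotation ![Real.cos φ * τ, -(Real.sin φ * τ), 0]] ++ wHat ω s

/-- The random choices of all iterations. -/
abbrev MainIndex (n : ℕ) (f : ℝ → ℝ) (t ε : ℝ) (ω : Record K G) : Type :=
  Fin (mainN f t ε ω) → StepIndex n K

/-- Their probability (for given outcomes of the pre-processing). -/
def mainProb {f : ℝ → ℝ} {t ε : ℝ} {ω : Record K G} (s : MainIndex n f t ε ω) : ℝ :=
  ∏ m, stepProb f ω (s m)

/-- The circuit that is run for given random choices. -/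
def mainCircuit {f : ℝ → ℝ} {t ε : ℝ} {ω : Record K G} (s : MainIndex n f t ε ω) : Circuit n :=
  ((List.ofFn s).reverse.map (mainStep f t ε ω)).flatten

end Main

/-- Average runtime of the main part of the algorithm, for given outcomes `ω` of the
pre-processing. -/
def mainRuntime {K G : ℕ} (n : ℕ) (f : ℝ → ℝ) (t ε : ℝ) (ω : Record K G) : ℝ :=
  ∑ s : MainIndex n f t ε ω, mainProb s * Circuit.runtime (mainCircuit s)

/-- The set of all random indices of the whole algorithm with cutoff number `K`. -/
abbrev Index (n : ℕ) (f : ℝ → ℝ) (t ε : ℝ) (K : ℕ) : Type :=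
  Σ ω : Record K (numGen f t ε), MainIndex n f t ε ω

/-- The probability `p_j`. -/
def indexProb {n : ℕ} (H : Op n) {f : ℝ → ℝ} {t ε : ℝ} {K : ℕ} (j : Index n f t ε K) : ℝ :=
  recordProb H j.1 * mainProb j.2

/-- The operation `𝓕_j`: adjoin the control qubit in the state `|+⟩`, run the circuit, and trace
out the control qubit. -/
def runOp {n : ℕ} (H : Op n) {f : ℝ → ℝ} {t ε : ℝ} {K : ℕ} (j : Index n f t ε K) (ρ : Op n) :
    Op n :=
  traceControl (Circuit.matrix H (mainCircuit j.2) * (plusState ⊗ₖ ρ) *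
    (Circuit.matrix H (mainCircuit j.2))ᴴ)

end UHET

end

open UHET

noncomputable section

namespace UHET

/-! ### Random Hamiltonian simulation in a C⋆-algebra -/

section Drift

variable {A : Type*} [CStarAlgebra A]

/-! Why the output is right. The state |+⟩ is fixed by X, so evolution under X ⊗ f(H₀) = `od (cfc f
(traceless H))` induces exactly the ideal operation on the system (`idealOp_eq_control`). On [0, 1]
the periodic function f̃ is a rescaled f, so f(H₀) is close to the truncated Fourier sum of the
harmonics e^{ikπ(H₀+1)/2}. A controlled query sequence puts e^{-ikπH/2} into the |0⟩ branch. In the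
|1⟩ branch every query is conjugated by a random Pauli string and averages to its normalized trace
(`sum_pauliString_conj`, `sum_twirlProd`). Hence the random Hamiltonian of one iteration has mean
`od (meanBlock f H ω)` / β, where the k-th Fourier coefficient is distorted only by the factor
`zTrue` / `zEst` (`sum_stepProb_smul_stepHam`).

The error has three sources. Random products approximate the evolution under the mean Hamiltonian
with error 6τ² per iteration (`norm_drift_sub_le`), in total ε/5. Truncation of the Fourier series
costs ε/3. The estimated parameters cost at most ε/5 in the mean (`mean_param_error_le`). All bounds
are proved in the Heisenberg picture after an arbitrary ⋆-homomorphism into a C⋆-algebra, so a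
reference system is included by ampliation, and the trace norm follows by pairing with the sign of
the difference. For the squared error, the ideal output is a pure state P. Testing the mean error on
the reflection 2P - 1 bounds the mean infidelity by ε/2, and the squared trace distance of a pure
and a mixed state is at most 4 times the infidelity.

The parameters are estimated robustly. The mean Hamiltonian of the state generation is a real
multiple of Y (`mean_prepHam`), so the success probabilities are close to those of a rotation by 2^j
v modulo 2π, with v = `vTrue` (`successProb_near`). If the first J generations are good, the final
error is at most 8π/2^J (`vHat_near`). Chernoff bounds make early failures so rare that the mean
error is at most 10π/2^G (`mean_vHat_error_le`). As `zTrue` lies within π²/80 of 1, the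
representative modulo 2π is never ambiguous.

Cutoff and runtime. The coefficient matrix makes the derivatives of f̃ of order at most 3 match at 0
and at ±1, so four integrations by parts give coefficients O(k⁻⁴) and a truncation error O(K⁻³). A
measurement with multiplier κ for frequency l costs of order κ³l²n; the sum is governed by the last
generation, where κ is of order t/ε. In the main process an iteration costs of order n k² + 1, and
the estimates Â_k lie between 1/2 and 2 for every outcome. The constants are absolute because
∑|c̃_k| is at most an absolute multiple of ∑|c̃_k|k²: the continuation on [-1, 0] has no constant
term, which controls c̃₀ by the other coefficients (`exists_norm_coeff_zero_le`). -/

/-- `e^{-iht}` in a C⋆-algebra. -/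
def uexp (h : A) (t : ℝ) : A := NormedSpace.exp ((-(Complex.I * t)) • h)

theorem norm_one_le_one : ‖(1 : A)‖ ≤ 1 := by
  rcases subsingleton_or_nontrivial A with h | h
  · rw [Subsingleton.elim (1 : A) 0, norm_zero]; exact zero_le_one
  · exact CStarRing.norm_one.le

theorem norm_le_one_of_star_mul_self {u : A} (h : star u * u = 1) : ‖u‖ ≤ 1 := by
  have h1 : ‖u‖ * ‖u‖ ≤ 1 := by
    rw [← CStarRing.norm_star_mul_self, h]; exact norm_one_le_one
  nlinarith [norm_nonneg u]

theorem uexp_zero_right (h : A) : uexp h 0 = 1 := by simp [uexp]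

theorem uexp_zero_left (t : ℝ) : uexp (0 : A) t = 1 := by simp [uexp]

theorem uexp_add (h : A) (s t : ℝ) : uexp h (s + t) = uexp h s * uexp h t := by
  let _ : NormedAlgebra ℚ A := NormedAlgebra.restrictScalars ℚ ℂ A
  unfold uexp
  rw [← NormedSpace.exp_add_of_commute (((Commute.refl h).smul_left _).smul_right _),
    ← add_smul]
  congr 2; push_cast; ring

theorem star_uexp {h : A} (hh : IsSelfAdjoint h) (t : ℝ) : star (uexp h t) = uexp h (-t) := by
  unfold uexp
  rw [NormedSpace.star_exp, star_smul, hh.star_eq]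
  congr 2
  simp

theorem star_uexp_mul_self {h : A} (hh : IsSelfAdjoint h) (t : ℝ) :
    star (uexp h t) * uexp h t = 1 := by
  rw [star_uexp hh, ← uexp_add, neg_add_cancel, uexp_zero_right]

theorem norm_uexp_le {h : A} (hh : IsSelfAdjoint h) (t : ℝ) : ‖uexp h t‖ ≤ 1 :=
  norm_le_one_of_star_mul_self (star_uexp_mul_self hh t)

theorem uexp_pow (h : A) (t : ℝ) (N : ℕ) : uexp h t ^ N = uexp h (N * t) := by
  induction N with
  | zero => simp [uexp_zero_right]
  | succ N ih => rw [pow_succ, ih, ← uexp_add]; congr 1; push_cast; ring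

theorem uexp_smul_left (h : A) (c t : ℝ) : uexp ((c : ℂ) • h) t = uexp h (c * t) := by
  unfold uexp
  rw [smul_smul]; congr 2; push_cast; ring

theorem hasDerivAt_uexp (h : A) (t : ℝ) :
    HasDerivAt (uexp h) ((-Complex.I) • (h * uexp h t)) t := by
  have h1 := hasDerivAt_exp_smul_const' (𝕂 := ℝ) ((-Complex.I) • h) t
  have h2 : uexp h = fun u : ℝ => NormedSpace.exp (u • ((-Complex.I) • h)) := by
    funext u
    unfold uexp
    congr 1
    rw [← Complex.coe_smul, smul_smul]; congr 1; ring
  rw [h2]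
  simpa [smul_mul_assoc] using h1

/-- Duhamel's argument: s ↦ e^{ihs} e^{-iks} has derivative i e^{ihs} (h - k) e^{-iks}, of norm at
most ‖h - k‖, and its increment over [0, t] is the difference up to a unitary factor. -/
theorem norm_uexp_sub_uexp_le {h k : A} (hh : IsSelfAdjoint h) (hk : IsSelfAdjoint k) {t : ℝ}
    (ht : 0 ≤ t) : ‖uexp h t - uexp k t‖ ≤ t * ‖h - k‖ := by
  have hd : ∀ s : ℝ, HasDerivAt (fun s => uexp h (-s) * uexp k s)
      (Complex.I • (uexp h (-s) * (h - k) * uexp k s)) s := by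
    intro s
    have h1 := (hasDerivAt_uexp h (-s)).scomp s (hasDerivAt_neg s)
    have h2 := h1.mul (hasDerivAt_uexp k s)
    refine h2.congr_deriv ?_
    have hc : h * uexp h (-s) = uexp h (-s) * h := by
      unfold uexp
      exact (((Commute.refl h).smul_right _).exp_right).eq
    simp only [Function.comp_apply, neg_smul, one_smul, neg_neg, smul_mul_assoc, mul_smul_comm, hc,
      mul_neg, mul_assoc, sub_eq_add_neg, add_mul, mul_add, smul_add, neg_mul, smul_neg]
  have hb : ‖uexp h (-t) * uexp k t - uexp h (-0) * uexp k 0‖ ≤ ‖h - k‖ * ‖t - 0‖ := by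
    refine (convex_univ).norm_image_sub_le_of_norm_hasDerivWithin_le
      (f := fun s => uexp h (-s) * uexp k s)
      (fun s _ => (hd s).hasDerivWithinAt) ?_ (Set.mem_univ _) (Set.mem_univ _)
    intro s _
    rw [norm_smul, Complex.norm_I, one_mul]
    calc _ ≤ ‖uexp h (-s)‖ * ‖h - k‖ * ‖uexp k s‖ :=
          (norm_mul_le _ _).trans (mul_le_mul_of_nonneg_right (norm_mul_le _ _) (norm_nonneg _))
      _ ≤ 1 * ‖h - k‖ * 1 := by
          gcongr
          · exact norm_uexp_le hh _
          · exact norm_uexp_le hk _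
      _ = _ := by ring
  have he : uexp h t - uexp k t
      = -(uexp h t * (uexp h (-t) * uexp k t - uexp h (-0) * uexp k 0)) := by
    rw [neg_zero, uexp_zero_right, uexp_zero_right, mul_sub, ← mul_assoc, ← uexp_add,
      add_neg_cancel, uexp_zero_right]
    simp
  rw [he, norm_neg]
  calc _ ≤ ‖uexp h t‖ * _ := norm_mul_le _ _
    _ ≤ 1 * (‖h - k‖ * ‖t - 0‖) := by
        gcongr
        exact norm_uexp_le hh _
    _ = t * ‖h - k‖ := by rw [sub_zero, Real.norm_of_nonneg ht]; ring

theorem norm_uexp_sub_one_le {h : A} (hh : IsSelfAdjoint h) (h1 : ‖h‖ ≤ 1) {t : ℝ} (ht : 0 ≤ t) :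
    ‖uexp h t - 1‖ ≤ t := by
  have := norm_uexp_sub_uexp_le hh (IsSelfAdjoint.zero A) ht
  rw [uexp_zero_left, sub_zero] at this
  nlinarith

/-- The remainder vanishes at 0 and has derivative -ih(e^{-ihs} - 1), whose norm is at most s by the
first order bound. -/
theorem norm_uexp_sub_linear_le {h : A} (hh : IsSelfAdjoint h) (h1 : ‖h‖ ≤ 1) {t : ℝ}
    (ht : 0 ≤ t) : ‖uexp h t - 1 + (Complex.I * t) • h‖ ≤ t ^ 2 / 2 := by
  have hd : ∀ s : ℝ, HasDerivAt (fun s : ℝ => uexp h s - 1 + (Complex.I * s) • h)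
      ((-Complex.I) • (h * (uexp h s - 1))) s := by
    intro s
    have e1 : HasDerivAt (fun s : ℝ => (Complex.I * s)) Complex.I s := by
      simpa using (Complex.ofRealCLM.hasDerivAt (x := s)).const_mul Complex.I
    refine (((hasDerivAt_uexp h s).sub_const 1).add (e1.smul_const h)).congr_deriv ?_
    rw [mul_sub, mul_one, smul_sub]; simp
  refine image_norm_le_of_norm_deriv_right_le_deriv_boundary
    (f := fun s : ℝ => uexp h s - 1 + (Complex.I * s) • h) (a := 0) (b := t)
    (B := fun s => s ^ 2 / 2) (B' := fun s => s)
    (fun s _ => (hd s).continuousAt.continuousWithinAt)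
    (fun s _ => (hd s).hasDerivWithinAt) ?_ ?_ ?_ ⟨ht, le_rfl⟩
  · simp [uexp_zero_right]
  · intro s
    simpa using ((hasDerivAt_pow 2 s).div_const 2)
  · intro s hs
    rw [norm_smul, norm_neg, Complex.norm_I, one_mul]
    calc _ ≤ ‖h‖ * ‖uexp h s - 1‖ := norm_mul_le _ _
      _ ≤ 1 * s := by
          gcongr
          exact norm_uexp_sub_one_le hh h1 hs.1
      _ = s := one_mul s

theorem norm_conj_le {u : A} (hu : ‖u‖ ≤ 1) (B : A) : ‖star u * B * u‖ ≤ ‖B‖ := by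
  calc _ ≤ ‖star u‖ * ‖B‖ * ‖u‖ :=
        (norm_mul_le _ _).trans (mul_le_mul_of_nonneg_right (norm_mul_le _ _) (norm_nonneg _))
    _ ≤ 1 * ‖B‖ * 1 := by
        rw [norm_star]; gcongr
    _ = _ := by ring

theorem norm_conj_sub_conj_le {u v : A} (hu : ‖u‖ ≤ 1) (hv : ‖v‖ ≤ 1) (B : A) :
    ‖star u * B * u - star v * B * v‖ ≤ 2 * ‖u - v‖ * ‖B‖ := by
  have : star u * B * u - star v * B * v = star (u - v) * B * u + star v * B * (u - v) := by
    rw [star_sub]; noncomm_ring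
  rw [this]
  calc _ ≤ ‖star (u - v)‖ * ‖B‖ * ‖u‖ + ‖star v‖ * ‖B‖ * ‖u - v‖ :=
        (norm_add_le _ _).trans (add_le_add
          ((norm_mul_le _ _).trans (mul_le_mul_of_nonneg_right (norm_mul_le _ _) (norm_nonneg _)))
          ((norm_mul_le _ _).trans (mul_le_mul_of_nonneg_right (norm_mul_le _ _) (norm_nonneg _))))
    _ ≤ ‖u - v‖ * ‖B‖ * 1 + 1 * ‖B‖ * ‖u - v‖ := by
        rw [norm_star, norm_star]; gcongr
    _ = _ := by ring

/-- Second order estimate for the Heisenberg evolution of `B`. -/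
theorem norm_conj_uexp_sub_linear_le {h : A} (hh : IsSelfAdjoint h) (h1 : ‖h‖ ≤ 1) {t : ℝ}
    (ht : 0 ≤ t) (B : A) :
    ‖star (uexp h t) * B * uexp h t - (B + (Complex.I * t) • (h * B - B * h))‖
      ≤ 3 * t ^ 2 * ‖B‖ := by
  set u := uexp h t with hu
  set R := u - 1 + (Complex.I * t) • h with hR
  set X := (Complex.I * t) • h with hX
  have hRn : ‖R‖ ≤ t ^ 2 / 2 := norm_uexp_sub_linear_le hh h1 ht
  have hu1 : ‖u - 1‖ ≤ t := norm_uexp_sub_one_le hh h1 ht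
  have hXn : ‖X‖ ≤ t := by
    rw [hX, norm_smul, norm_mul, Complex.norm_I, one_mul, Complex.norm_real, Real.norm_of_nonneg ht]
    nlinarith
  have huu : star u * u = 1 := star_uexp_mul_self hh t
  have hsu : ‖star u‖ ≤ 1 := by rw [norm_star]; exact norm_uexp_le hh t
  have hsu1 : ‖star u - 1‖ ≤ t := by rw [← norm_star]; simpa using hu1
  have e1 : u = 1 - X + R := by rw [hR]; abel
  have e3 : B * u - u * B = X * B - B * X + (B * R - R * B) := by rw [e1]; noncomm_ring
  -- Unitarity gives u†Bu - B = u†(Bu - uB), and the linear part of this commutator is XB - BX. What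
  -- is left is (u† - 1) times a first order commutator plus a commutator with R, which gives t·2t +
  -- t² = 3t².
  have e2 : star u * B * u - (B + (Complex.I * t) • (h * B - B * h))
      = (star u - 1) * (X * B - B * X) + star u * (B * R - R * B) := by
    have : star u * B * u = B + star u * (B * u - u * B) := by
      rw [mul_sub, ← mul_assoc, ← mul_assoc, huu]; noncomm_ring
    rw [this, e3, smul_sub, ← smul_mul_assoc, ← mul_smul_comm]
    rw [← hX]; noncomm_ring
  have hcomm : ∀ Y : A, ‖Y * B - B * Y‖ ≤ 2 * ‖Y‖ * ‖B‖ := fun Y => by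
    calc _ ≤ ‖Y * B‖ + ‖B * Y‖ := norm_sub_le _ _
      _ ≤ ‖Y‖ * ‖B‖ + ‖B‖ * ‖Y‖ := add_le_add (norm_mul_le _ _) (norm_mul_le _ _)
      _ = _ := by ring
  have hB := norm_nonneg B
  rw [e2]
  calc _ ≤ ‖star u - 1‖ * ‖X * B - B * X‖ + ‖star u‖ * ‖B * R - R * B‖ :=
        (norm_add_le _ _).trans (add_le_add (norm_mul_le _ _) (norm_mul_le _ _))
    _ ≤ t * (2 * t * ‖B‖) + 1 * (2 * (t ^ 2 / 2) * ‖B‖) := by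
        gcongr
        · exact (hcomm X).trans (by gcongr)
        · rw [norm_sub_rev]; exact (hcomm R).trans (by gcongr)
    _ = _ := by ring

/-- The product `u_{s_{N-1}} ⋯ u_{s_0}`. -/
def revProd {ι M : Type*} [Monoid M] (u : ι → M) {N : ℕ} (s : Fin N → ι) : M :=
  ((List.ofFn s).reverse.map u).prod

theorem revProd_cons {ι M : Type*} [Monoid M] (u : ι → M) {N : ℕ} (a : ι) (s : Fin N → ι) :
    revProd u (Fin.cons a s : Fin (N + 1) → ι) = revProd u s * u a := by
  simp [revProd]

theorem sum_fin_succ_pi {ι M : Type*} [Fintype ι] [AddCommMonoid M] {N : ℕ}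
    (F : (Fin (N + 1) → ι) → M) :
    ∑ s, F s = ∑ a : ι, ∑ s : Fin N → ι, F (Fin.cons a s) := by
  rw [← (Fin.consEquiv fun _ : Fin (N + 1) => ι).sum_comp, Fintype.sum_prod_type]
  rfl

theorem sum_prod_weights {ι : Type*} [Fintype ι] (p : ι → ℝ) (hp : ∑ i, p i = 1) (N : ℕ) :
    ∑ s : Fin N → ι, ∏ m, p (s m) = 1 := by
  classical
  rw [← Fintype.piFinset_univ,
    ← Finset.prod_univ_sum (fun _ : Fin N => (Finset.univ : Finset ι)) (fun _ i => p i)]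
  simp [hp]

/-- Averages of conjugations by products of independent random unitaries, in the Heisenberg
picture, approximate the evolution under the mean Hamiltonian. -/
theorem norm_drift_sub_le {ι : Type*} [Fintype ι] (p : ι → ℝ) (hp0 : ∀ i, 0 ≤ p i)
    (hp : ∑ i, p i = 1) (h : ι → A) (hh : ∀ i, IsSelfAdjoint (h i)) (h1 : ∀ i, ‖h i‖ ≤ 1)
    {τ : ℝ} (hτ : 0 ≤ τ) {g : A} (hg : ∑ i, (p i : ℂ) • h i = g) (N : ℕ) (B : A) :
    ‖∑ s : Fin N → ι, ((∏ m, p (s m) : ℝ) : ℂ) •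
        (star (revProd (fun i => uexp (h i) τ) s) * B * revProd (fun i => uexp (h i) τ) s)
      - star (uexp g (N * τ)) * B * uexp g (N * τ)‖ ≤ N * (6 * τ ^ 2 * ‖B‖) := by
  have hgs : IsSelfAdjoint g := by
    rw [← hg]
    refine isSelfAdjoint_sum _ fun i _ => ?_
    exact IsSelfAdjoint.smul (by simp [IsSelfAdjoint]) (hh i)
  have hg1 : ‖g‖ ≤ 1 := by
    rw [← hg]
    calc _ ≤ ∑ i, ‖(p i : ℂ) • h i‖ := norm_sum_le _ _
      _ ≤ ∑ i, p i := Finset.sum_le_sum fun i _ => by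
          rw [norm_smul, Complex.norm_real, Real.norm_of_nonneg (hp0 i)]
          exact mul_le_of_le_one_right (hp0 i) (h1 i)
      _ = 1 := hp
  have havg : ∀ (c : ℝ) (F : ι → A), (∀ i, ‖F i‖ ≤ c) → ‖∑ i, (p i : ℂ) • F i‖ ≤ c := by
    intro c F hF
    calc _ ≤ ∑ i, ‖(p i : ℂ) • F i‖ := norm_sum_le _ _
      _ ≤ ∑ i, p i * c := Finset.sum_le_sum fun i _ => by
          rw [norm_smul, Complex.norm_real, Real.norm_of_nonneg (hp0 i)]
          exact mul_le_mul_of_nonneg_left (hF i) (hp0 i)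
      _ = c := by rw [← Finset.sum_mul, hp, one_mul]
  have hpc : ∑ i, (p i : ℂ) = 1 := by exact_mod_cast hp
  -- The first order term is linear in the Hamiltonian, so the average of the evolutions and the
  -- evolution under the average share it. Each deviates from it by at most 3τ²‖C‖.
  have hstep : ∀ C : A, ‖∑ i, (p i : ℂ) • (star (uexp (h i) τ) * C * uexp (h i) τ)
      - star (uexp g τ) * C * uexp g τ‖ ≤ 6 * τ ^ 2 * ‖C‖ := by
    intro C
    have e1 : ∑ i, (p i : ℂ) • (C + (Complex.I * τ) • (h i * C - C * h i))
        = C + (Complex.I * τ) • (g * C - C * g) := by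
      have hC : ∑ i, (p i : ℂ) • C = C := by rw [← Finset.sum_smul, hpc, one_smul]
      simp only [smul_add, Finset.sum_add_distrib, hC]
      rw [← hg, Finset.sum_mul, Finset.mul_sum, ← Finset.sum_sub_distrib, Finset.smul_sum]
      congr 1
      refine Finset.sum_congr rfl fun i _ => ?_
      rw [smul_mul_assoc, mul_smul_comm, ← smul_sub, smul_comm]
    have e2 := havg (3 * τ ^ 2 * ‖C‖) _
      (fun i => norm_conj_uexp_sub_linear_le (hh i) (h1 i) hτ C)
    simp only [smul_sub] at e2
    rw [Finset.sum_sub_distrib] at e2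
    simp only [← smul_sub] at e2
    rw [e1] at e2
    have e3 := norm_conj_uexp_sub_linear_le hgs hg1 hτ C
    rw [norm_sub_rev] at e3
    calc _ ≤ _ := norm_sub_le_norm_sub_add_norm_sub _ (C + (Complex.I * τ) • (g * C - C * g)) _
      _ ≤ 3 * τ ^ 2 * ‖C‖ + 3 * τ ^ 2 * ‖C‖ := add_le_add e2 e3
      _ = _ := by ring
  induction N with
  | zero => simp [revProd, uexp_zero_right]
  | succ N ih =>
    -- The index split off belongs to the factor applied first to a state. In the Heisenberg picture
    -- its conjugation is the outermost one, so the average over the other indices sits inside it.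
    rw [sum_fin_succ_pi]
    set D := ∑ s : Fin N → ι, ((∏ m, p (s m) : ℝ) : ℂ) •
        (star (revProd (fun i => uexp (h i) τ) s) * B * revProd (fun i => uexp (h i) τ) s) with hD
    set E := star (uexp g (N * τ)) * B * uexp g (N * τ) with hE
    have e1 : ∀ a : ι, ∑ s : Fin N → ι, ((∏ m, p ((Fin.cons a s : Fin (N + 1) → ι) m) : ℝ) : ℂ) •
        (star (revProd (fun i => uexp (h i) τ) (Fin.cons a s : Fin (N + 1) → ι)) * B *
          revProd (fun i => uexp (h i) τ) (Fin.cons a s : Fin (N + 1) → ι))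
        = (p a : ℂ) • (star (uexp (h a) τ) * D * uexp (h a) τ) := by
      intro a
      rw [hD, Finset.mul_sum, Finset.sum_mul, Finset.smul_sum]
      refine Finset.sum_congr rfl fun s _ => ?_
      rw [revProd_cons, Fin.prod_univ_succ]
      simp only [Fin.cons_zero, Fin.cons_succ, star_mul, mul_smul_comm, smul_mul_assoc, smul_smul,
        Complex.ofReal_mul, mul_assoc]
    have e2 : star (uexp g ((N + 1 : ℕ) * τ)) * B * uexp g ((N + 1 : ℕ) * τ)
        = star (uexp g τ) * E * uexp g τ := by
      have : ((N + 1 : ℕ) : ℝ) * τ = N * τ + τ := by push_cast; ring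
      rw [this, uexp_add, star_mul, hE]; noncomm_ring
    rw [Finset.sum_congr rfl fun a _ => e1 a, e2]
    -- An average of unitary conjugations is a contraction, so the inherited error does not grow;
    -- only the new one-step error is added.
    have e3 : ∑ a, (p a : ℂ) • (star (uexp (h a) τ) * D * uexp (h a) τ)
        - ∑ a, (p a : ℂ) • (star (uexp (h a) τ) * E * uexp (h a) τ)
        = ∑ a, (p a : ℂ) • (star (uexp (h a) τ) * (D - E) * uexp (h a) τ) := by
      rw [← Finset.sum_sub_distrib]
      refine Finset.sum_congr rfl fun a _ => ?_
      rw [← smul_sub, mul_sub, sub_mul]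
    have e4 := havg ‖D - E‖ _ (fun a => norm_conj_le (norm_uexp_le (hh a) τ) (D - E))
    rw [← e3] at e4
    have hEB : ‖E‖ ≤ ‖B‖ := norm_conj_le (norm_uexp_le hgs _) B
    calc _ ≤ _ := norm_sub_le_norm_sub_add_norm_sub _
          (∑ a, (p a : ℂ) • (star (uexp (h a) τ) * E * uexp (h a) τ)) _
      _ ≤ N * (6 * τ ^ 2 * ‖B‖) + 6 * τ ^ 2 * ‖B‖ :=
          add_le_add (e4.trans ih) ((hstep E).trans (by gcongr))
      _ = _ := by push_cast; ring

end Drift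
end UHET

end

noncomputable section

namespace UHET

/-! ### Operators on the control qubit and the system -/

section Operators

open scoped Matrix.Norms.L2Operator

theorem map_uexp {A B : Type*} [CStarAlgebra A] [CStarAlgebra B] (φ : A →⋆ₐ[ℂ] B) (h : A) (t : ℝ) :
    φ (uexp h t) = uexp (φ h) t := by
  let _ : NormedAlgebra ℚ A := NormedAlgebra.restrictScalars ℚ ℂ A
  let _ : NormedAlgebra ℚ B := NormedAlgebra.restrictScalars ℚ ℂ B
  have hc : Continuous φ := by
    refine (LipschitzWith.of_dist_le_mul (K := 1) fun x y => ?_).continuous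
    rw [dist_eq_norm, dist_eq_norm, ← map_sub]
    simpa using NonUnitalStarAlgHom.norm_apply_le φ (x - y)
  unfold uexp
  rw [NormedSpace.map_exp φ hc, map_smul]

/-- An intertwiner of the generators intertwines the evolutions. With q an eigenprojection this
evaluates rotations of the control qubit; with q the projection on |+⟩ it identifies the ideal
operation. -/
theorem uexp_mul_of_mul_eq {A : Type*} [CStarAlgebra A] {h q k : A} (e : h * q = q * k) (t : ℝ) :
    uexp h t * q = q * uexp k t := by
  let _ : NormedAlgebra ℚ A := NormedAlgebra.restrictScalars ℚ ℂ A
  have h1 : SemiconjBy q ((-(Complex.I * t)) • k) ((-(Complex.I * t)) • h) := by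
    unfold SemiconjBy
    rw [mul_smul_comm, smul_mul_assoc, e]
  exact (h1.exp_right).eq.symm

theorem uexp_smul_one {A : Type*} [CStarAlgebra A] (c t : ℝ) :
    uexp ((c : ℂ) • (1 : A)) t = Complex.exp (-(Complex.I * (c * t))) • (1 : A) := by
  let _ : NormedAlgebra ℚ A := NormedAlgebra.restrictScalars ℚ ℂ A
  have h1 := map_uexp (StarAlgHom.ofId ℂ A) (c : ℂ) t
  rw [StarAlgHom.ofId_apply, StarAlgHom.ofId_apply, Algebra.algebraMap_eq_smul_one,
    Algebra.algebraMap_eq_smul_one] at h1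
  rw [← h1]
  congr 1
  unfold uexp
  rw [← Complex.exp_eq_exp_ℂ, smul_eq_mul]; congr 1; ring

/-- `X ↦ X ⊗ I`. -/
def ampHom (m k : Type) [Fintype m] [DecidableEq m] [Fintype k] [DecidableEq k] :
    Matrix m m ℂ →⋆ₐ[ℂ] Matrix (m × k) (m × k) ℂ where
  toFun X := X ⊗ₖ 1
  map_one' := Matrix.one_kronecker_one
  map_mul' X Y := by rw [← Matrix.mul_kronecker_mul, mul_one]
  map_zero' := Matrix.zero_kronecker _
  map_add' X Y := Matrix.add_kronecker _ _ _
  commutes' r := by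
    rw [Algebra.algebraMap_eq_smul_one, Algebra.algebraMap_eq_smul_one, Matrix.smul_kronecker,
      Matrix.one_kronecker_one]
  map_star' X := by
    rw [Matrix.star_eq_conjTranspose, Matrix.star_eq_conjTranspose, Matrix.conjTranspose_kronecker,
      Matrix.conjTranspose_one]

/-- `X ↦ I ⊗ X`. -/
def sysHom (m k : Type) [Fintype m] [DecidableEq m] [Fintype k] [DecidableEq k] :
    Matrix k k ℂ →⋆ₐ[ℂ] Matrix (m × k) (m × k) ℂ where
  toFun X := 1 ⊗ₖ X
  map_one' := Matrix.one_kronecker_one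
  map_mul' X Y := by rw [← Matrix.mul_kronecker_mul, mul_one]
  map_zero' := Matrix.kronecker_zero _
  map_add' X Y := Matrix.kronecker_add _ _ _
  commutes' r := by
    rw [Algebra.algebraMap_eq_smul_one, Algebra.algebraMap_eq_smul_one, Matrix.kronecker_smul,
      Matrix.one_kronecker_one]
  map_star' X := by
    rw [Matrix.star_eq_conjTranspose, Matrix.star_eq_conjTranspose, Matrix.conjTranspose_kronecker,
      Matrix.conjTranspose_one]

variable {n : ℕ}

/-- `|0⟩⟨0| ⊗ P + |1⟩⟨1| ⊗ Q`. -/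
def bd (P Q : Op n) : OpC n := Matrix.single 0 0 1 ⊗ₖ P + Matrix.single 1 1 1 ⊗ₖ Q

/-- `|0⟩⟨1| ⊗ R + |1⟩⟨0| ⊗ R†`. -/
def od (R : Op n) : OpC n := Matrix.single 0 1 1 ⊗ₖ R + Matrix.single 1 0 1 ⊗ₖ Rᴴ

theorem bd_mul_bd (P Q P' Q' : Op n) : bd P Q * bd P' Q' = bd (P * P') (Q * Q') := by
  simp [bd, add_mul, mul_add, ← Matrix.mul_kronecker_mul]

theorem conjTranspose_bd (P Q : Op n) : (bd P Q)ᴴ = bd Pᴴ Qᴴ := by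
  simp [bd, Matrix.conjTranspose_kronecker, Matrix.conjTranspose_single]

theorem single_add_single_fin_two :
    (Matrix.single 0 0 1 + Matrix.single 1 1 1 : Matrix (Fin 2) (Fin 2) ℂ) = 1 := by
  ext i j; fin_cases i <;> fin_cases j <;> simp [Matrix.single]

theorem bd_self (P : Op n) : bd P P = (1 : Matrix (Fin 2) (Fin 2) ℂ) ⊗ₖ P := by
  rw [bd, ← Matrix.add_kronecker, single_add_single_fin_two]

theorem bd_one_one : bd (1 : Op n) 1 = 1 := by rw [bd_self, Matrix.one_kronecker_one]

theorem conjTranspose_od (R : Op n) : (od R)ᴴ = od R := by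
  simp [od, Matrix.conjTranspose_kronecker, Matrix.conjTranspose_single, add_comm]

theorem isSelfAdjoint_od (R : Op n) : IsSelfAdjoint (od R) := conjTranspose_od R

/-- This is how operators get encoded: conjugating a rotation generator of the control qubit by a
controlled unitary multiplies its off-diagonal block from both sides, so products of two branches
appear as Hamiltonians. -/
theorem bd_mul_od_mul_bd (P Q R : Op n) : bd P Q * od R * (bd P Q)ᴴ = od (P * R * Qᴴ) := by
  rw [conjTranspose_bd]
  simp [bd, od, add_mul, mul_add, ← Matrix.mul_kronecker_mul, mul_assoc, add_comm]

theorem od_add (R S : Op n) : od (R + S) = od R + od S := by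
  simp only [od, Matrix.conjTranspose_add, Matrix.kronecker_add]; abel

/-- Only real scalars pass through, because the lower block depends antilinearly on R. -/
theorem od_real_smul (c : ℝ) (R : Op n) : od ((c : ℂ) • R) = (c : ℂ) • od R := by
  simp only [od, Matrix.conjTranspose_smul, Matrix.kronecker_smul, smul_add]
  simp

theorem od_zero : od (0 : Op n) = 0 := by simp [od]

theorem od_sub (R S : Op n) : od (R - S) = od R - od S := by
  rw [eq_sub_iff_add_eq, ← od_add, sub_add_cancel]

theorem od_sum {ι : Type*} (s : Finset ι) (F : ι → Op n) : od (∑ i ∈ s, F i) = ∑ i ∈ s, od (F i) :=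
  map_sum (AddMonoidHom.mk' (od (n := n)) od_add) F s

/-- The diagonal embedding as a ⋆-homomorphism. -/
def bdHom (n : ℕ) : (Op n × Op n) →⋆ₐ[ℂ] OpC n where
  toFun X := bd X.1 X.2
  map_one' := bd_one_one
  map_mul' X Y := (bd_mul_bd _ _ _ _).symm
  map_zero' := by simp [bd]
  map_add' X Y := by simp only [bd, Prod.fst_add, Prod.snd_add, Matrix.kronecker_add]; abel
  commutes' r := by
    simp only [Algebra.algebraMap_eq_smul_one, Prod.smul_fst, Prod.smul_snd, Prod.fst_one,
      Prod.snd_one]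
    rw [bd_self, Matrix.kronecker_smul, Matrix.one_kronecker_one]
  map_star' X := (conjTranspose_bd _ _).symm

/-- The square of `od R` is block diagonal with blocks RR† and R†R. It is thus the image under a
⋆-homomorphism, which is contractive, of a pair of norm ‖R‖². -/
theorem norm_od_le (R : Op n) : ‖od R‖ ≤ ‖R‖ := by
  have h1 : star (od R) * od R = bdHom n (R * star R, star R * R) := by
    change (od R)ᴴ * od R = bd (R * Rᴴ) (Rᴴ * R)
    rw [conjTranspose_od]
    simp [bd, od, add_mul, mul_add, ← Matrix.mul_kronecker_mul, add_comm]
  have h2 : ‖od R‖ * ‖od R‖ ≤ ‖R‖ * ‖R‖ := by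
    rw [← CStarRing.norm_star_mul_self, h1]
    refine (NonUnitalStarAlgHom.norm_apply_le (bdHom n) _).trans ?_
    rw [Prod.norm_def, CStarRing.norm_star_mul_self, CStarRing.norm_self_mul_star, max_self]
  exact abs_le_of_sq_le_sq' (by nlinarith) (norm_nonneg _) |>.2

/-! ### Circuits -/

theorem Circuit.matrix_append (H : Op n) (c d : Circuit n) :
    Circuit.matrix H (c ++ d) = Circuit.matrix H c * Circuit.matrix H d := by
  simp [Circuit.matrix]

theorem Circuit.matrix_nil (H : Op n) : Circuit.matrix H ([] : Circuit n) = 1 := by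
  simp [Circuit.matrix]

theorem Circuit.matrix_cons (H : Op n) (g : Gate n) (c : Circuit n) :
    Circuit.matrix H (g :: c) = Gate.matrix H g * Circuit.matrix H c := by
  simp [Circuit.matrix]

theorem Circuit.matrix_singleton (H : Op n) (g : Gate n) :
    Circuit.matrix H [g] = Gate.matrix H g := by
  simp [Circuit.matrix]

theorem Circuit.matrix_flatten_map {ι : Type*} {N : ℕ} (H : Op n) (g : ι → Circuit n)
    (s : Fin N → ι) : Circuit.matrix H (((List.ofFn s).reverse.map g).flatten)
      = revProd (fun i => Circuit.matrix H (g i)) s := by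
  unfold revProd
  generalize (List.ofFn s).reverse = l
  induction l with
  | nil => simp [Circuit.matrix]
  | cons a l ih => simp [Circuit.matrix_append, ih]

theorem conjTranspose_pauli (a : Fin 4) : (pauli a)ᴴ = pauli a := by
  fin_cases a
  · simp [pauli]
  all_goals ext i j; fin_cases i <;> fin_cases j <;> simp [pauli, Matrix.conjTranspose_apply]

theorem star_pauli_apply (a : Fin 4) (i j : Fin 2) : star (pauli a i j) = pauli a j i := by
  rw [← Matrix.conjTranspose_apply, conjTranspose_pauli]

theorem conjTranspose_pauliAt (i : Fin n) (a : Fin 4) : (pauliAt i a)ᴴ = pauliAt i a := by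
  ext x y
  simp only [pauliAt, Matrix.conjTranspose_apply, Matrix.of_apply]
  by_cases h : ∀ l, l ≠ i → x l = y l
  · rw [if_pos h, if_pos fun l hl => (h l hl).symm, star_pauli_apply]
  · rw [if_neg h, if_neg fun h' => h fun l hl => (h' l hl).symm, star_zero]

theorem isHermitian_rotation (r : Fin 3 → ℝ) :
    IsSelfAdjoint ((r 0 : ℂ) • pauli 1 + (r 1 : ℂ) • pauli 2 + (r 2 : ℂ) • pauli 3) := by
  have h : ∀ a, IsSelfAdjoint (pauli a) := conjTranspose_pauli
  have hr : ∀ x : ℝ, IsSelfAdjoint (x : ℂ) := fun x => by simp [IsSelfAdjoint]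
  exact (((hr _).smul (h _)).add ((hr _).smul (h _))).add ((hr _).smul (h _))

theorem Gate.matrix_inv {H : Op n} (hH : H.IsHermitian) (g : Gate n) :
    Gate.matrix H g.inv = (Gate.matrix H g)ᴴ := by
  cases g with
  | cpauli i a =>
    simp [Gate.inv, Gate.matrix, Matrix.conjTranspose_kronecker, Matrix.conjTranspose_single,
      conjTranspose_pauliAt]
  | query τ =>
    simp only [Gate.inv, Gate.matrix, Matrix.conjTranspose_kronecker, Matrix.conjTranspose_one]
    congr 1
    exact (star_uexp hH.isSelfAdjoint τ).symm
  | rotation r =>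
    simp only [Gate.inv, Gate.matrix, Matrix.conjTranspose_kronecker, Matrix.conjTranspose_one]
    congr 1
    refine Eq.trans ?_ (star_uexp (isHermitian_rotation r) 1).symm
    simp only [evol, uexp, Pi.neg_apply, Complex.ofReal_neg]
    congr 1
    simp only [neg_smul, smul_neg, smul_add, mul_neg, Complex.ofReal_one, mul_one, neg_neg]

theorem Circuit.matrix_inv {H : Op n} (hH : H.IsHermitian) (c : Circuit n) :
    Circuit.matrix H (Circuit.inv c) = (Circuit.matrix H c)ᴴ := by
  induction c with
  | nil => simp [Circuit.inv, Circuit.matrix]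
  | cons g c ih =>
    have : Circuit.inv (g :: c) = Circuit.inv c ++ [g.inv] := by simp [Circuit.inv]
    rw [this, Circuit.matrix_append, ih, Circuit.matrix_singleton, Gate.matrix_inv hH,
      Circuit.matrix_cons, Matrix.conjTranspose_mul]

/-! ### Pauli strings, the Pauli twirl and controlization. -/

/-- The tensor product of Pauli matrices `σ_{v₁} ⊗ ⋯ ⊗ σ_{v_n}`. -/
def pauliString (v : Fin n → Fin 4) : Op n := Matrix.of fun x y => ∏ i, pauli (v i) (x i) (y i)

/-- Stated for any list of distinct qubits so that induction is possible; qubits outside the list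
must agree. -/
theorem list_prod_pauliAt_apply (v : Fin n → Fin 4) (l : List (Fin n)) (hl : l.Nodup)
    (x y : Qubits n) : (l.map fun i => pauliAt i (v i)).prod x y
      = if ∀ i, i ∉ l → x i = y i then ∏ i ∈ l.toFinset, pauli (v i) (x i) (y i) else 0 := by
  induction l generalizing x with
  | nil => simp [Matrix.one_apply, funext_iff]
  | cons i l ih =>
    rw [List.nodup_cons] at hl
    simp only [List.map_cons, List.prod_cons, Matrix.mul_apply, List.toFinset_cons]
    -- The gate on qubit i changes only that qubit, and the remaining gates leave it alone, so
    -- exactly one intermediate basis state contributes.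
    rw [Finset.sum_eq_single (Function.update x i (y i))]
    · rw [ih hl.2]
      have e1 : pauliAt i (v i) x (Function.update x i (y i)) = pauli (v i) (x i) (y i) := by
        rw [pauliAt, Matrix.of_apply, if_pos, Function.update_self]
        intro j hj
        rw [Function.update_of_ne hj]
      rw [e1, Finset.prod_insert (by simpa using hl.1)]
      have e2 : (∀ j, j ∉ l → Function.update x i (y i) j = y j) ↔
          ∀ j, j ∉ i :: l → x j = y j := by
        constructor
        · intro h j hj
          rw [List.mem_cons, not_or] at hj
          simpa [Function.update_of_ne hj.1] using h j hj.2
        · intro h j hj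
          by_cases hji : j = i
          · subst hji; simp
          · rw [Function.update_of_ne hji]
            exact h j (by simp [hji, hj])
      by_cases hc : ∀ j, j ∉ i :: l → x j = y j
      · rw [if_pos hc, if_pos (e2.2 hc)]
        congr 1
        refine Finset.prod_congr rfl fun j hj => ?_
        rw [Function.update_of_ne]
        rintro rfl
        exact hl.1 (by simpa using hj)
      · rw [if_neg hc, if_neg fun h => hc (e2.1 h), mul_zero]
    · intro z _ hz
      rw [ih hl.2]
      by_cases h1 : ∀ j, j ≠ i → x j = z j
      · have h2 : z i ≠ y i := by
          intro h
          apply hz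
          funext j
          by_cases hji : j = i
          · subst hji; simpa using h
          · rw [Function.update_of_ne hji]; exact (h1 j hji).symm
        rw [if_neg fun h => h2 (h i hl.1), mul_zero]
      · rw [pauliAt, Matrix.of_apply, if_neg h1, zero_mul]
    · intro h; exact absurd (Finset.mem_univ _) h

theorem prod_ofFn_pauliAt (v : Fin n → Fin 4) :
    (List.ofFn fun i => pauliAt i (v i)).prod = pauliString v := by
  rw [List.ofFn_eq_map]
  ext x y
  rw [list_prod_pauliAt_apply v _ (List.nodup_finRange n)]
  simp [pauliString]

theorem matrix_ctrlPauli (H : Op n) (v : Fin n → Fin 4) :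
    Circuit.matrix H (ctrlPauli v) = bd 1 (pauliString v) := by
  rw [← prod_ofFn_pauliAt, ctrlPauli, List.ofFn_eq_map, List.ofFn_eq_map]
  induction List.finRange n with
  | nil => simp [Circuit.matrix, bd_one_one]
  | cons i l ih =>
    rw [List.map_cons, Circuit.matrix_cons, ih]
    change bd 1 (pauliAt i (v i)) * _ = _
    rw [bd_mul_bd, List.map_cons, List.prod_cons, one_mul]

/-- Completeness of the Pauli basis: ∑ σ_a ⊗ σ_a is twice the swap operator. -/
theorem sum_pauli_mul_pauli (x z w y : Fin 2) :
    ∑ a, pauli a x z * pauli a w y = if x = y ∧ z = w then 2 else 0 := by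
  fin_cases x <;> fin_cases y <;> fin_cases z <;> fin_cases w <;>
    simp [Fin.sum_univ_four, pauli] <;> norm_num

/-- The Pauli twirl. -/
theorem sum_pauliString_conj (X : Op n) :
    ∑ v : Fin n → Fin 4, pauliString v * X * pauliString v = (2 ^ n * X.trace) • (1 : Op n) := by
  classical
  have key : ∀ x z w y : Qubits n, ∑ v, pauliString v x z * pauliString v w y
      = if x = y ∧ z = w then (2 : ℂ) ^ n else 0 := by
    intro x z w y
    simp only [pauliString, Matrix.of_apply, ← Finset.prod_mul_distrib]
    rw [← Fintype.piFinset_univ, ← Finset.prod_univ_sum (fun _ : Fin n => Finset.univ)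
      (fun i a => pauli a (x i) (z i) * pauli a (w i) (y i))]
    simp only [sum_pauli_mul_pauli]
    by_cases h : x = y ∧ z = w
    · rw [if_pos h, h.1, h.2]; simp
    · rw [if_neg h]
      have : ∃ i, ¬ (x i = y i ∧ z i = w i) := by
        by_contra hc
        push Not at hc
        exact h ⟨funext fun i => (hc i).1, funext fun i => (hc i).2⟩
      obtain ⟨i, hi⟩ := this
      exact Finset.prod_eq_zero (Finset.mem_univ i) (if_neg hi)
  ext x y
  rw [Matrix.sum_apply]
  simp only [Matrix.mul_apply, Finset.sum_mul]
  rw [Finset.sum_comm]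
  have : ∀ w : Qubits n, ∑ v, ∑ z, pauliString v x z * X z w * pauliString v w y
      = if x = y then 2 ^ n * X w w else 0 := by
    intro w
    rw [Finset.sum_comm]
    calc _ = ∑ z, X z w * (if x = y ∧ z = w then (2 : ℂ) ^ n else 0) := by
          refine Finset.sum_congr rfl fun z _ => ?_
          rw [← key, Finset.mul_sum]
          exact Finset.sum_congr rfl fun v _ => by ring
      _ = _ := by
          by_cases hxy : x = y <;> simp [hxy, mul_comm]
  rw [Finset.sum_congr rfl fun w _ => this w]
  by_cases hxy : x = y
  · simp [hxy, Matrix.trace, Finset.mul_sum]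
  · simp [hxy]

theorem pauliString_mul_self (v : Fin n → Fin 4) : pauliString v * pauliString v = 1 := by
  have h : ∀ (a : Fin 4) (x y : Fin 2), ∑ z, pauli a x z * pauli a z y = if x = y then 1 else 0 := by
    intro a x y
    fin_cases a <;> fin_cases x <;> fin_cases y <;> simp [pauli]
  ext x y
  simp only [Matrix.mul_apply, pauliString, Matrix.of_apply, ← Finset.prod_mul_distrib]
  rw [← Fintype.piFinset_univ, ← Finset.prod_univ_sum (fun _ : Fin n => Finset.univ)
      (fun i a => pauli (v i) (x i) a * pauli (v i) a (y i))]
  simp only [h, Matrix.one_apply, funext_iff]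
  by_cases hxy : ∀ i, x i = y i
  · simp [hxy]
  · rw [if_neg hxy]
    push Not at hxy
    obtain ⟨i, hi⟩ := hxy
    exact Finset.prod_eq_zero (Finset.mem_univ i) (if_neg hi)

/-- The block of `controlization` that acts when the control qubit is `|1⟩`. -/
def twirlProd {M : ℕ} (a : Op n) (v : Fin M → Fin n → Fin 4) : Op n :=
  (List.ofFn fun m => pauliString (v m) * a * pauliString (v m)).prod

/-- In the |0⟩ branch the controlled strings act trivially and the queries merge into one evolution;
in the |1⟩ branch each query is conjugated by its own string. -/
theorem matrix_controlization {M : ℕ} (H : Op n) (τ : ℝ) (v : Fin M → Fin n → Fin 4) :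
    Circuit.matrix H (controlization τ v) = bd (uexp H τ ^ M) (twirlProd (uexp H τ) v) := by
  have hq : Circuit.matrix H [Gate.query τ] = bd (uexp H τ) (uexp H τ) := by
    rw [Circuit.matrix_singleton, bd_self]; rfl
  induction M with
  | zero => simp [controlization, Circuit.matrix_nil, bd_one_one, twirlProd]
  | succ M ih =>
    have e1 : controlization τ v = (ctrlPauli (v 0) ++ [Gate.query τ] ++ ctrlPauli (v 0)) ++
        controlization τ (fun m => v m.succ) := by
      simp [controlization, List.ofFn_succ]
    rw [e1, Circuit.matrix_append, ih, Circuit.matrix_append, Circuit.matrix_append,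
      matrix_ctrlPauli, hq, bd_mul_bd, bd_mul_bd, bd_mul_bd, one_mul, mul_one, ← pow_succ']
    congr 1
    rw [twirlProd, twirlProd, List.ofFn_succ, List.prod_cons]

theorem sum_list_prod_ofFn {ι R : Type*} [Fintype ι] [Semiring R] (g : ι → R) (M : ℕ) :
    ∑ v : Fin M → ι, (List.ofFn fun m => g (v m)).prod = (∑ i, g i) ^ M := by
  induction M with
  | zero => simp
  | succ M ih =>
    rw [sum_fin_succ_pi, pow_succ', ← ih, Finset.sum_mul]
    refine Finset.sum_congr rfl fun a _ => ?_
    rw [Finset.mul_sum]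
    refine Finset.sum_congr rfl fun s _ => ?_
    rw [List.ofFn_succ, List.prod_cons]
    simp

/-- The normalized trace. -/
def ntr (X : Op n) : ℂ := X.trace / 2 ^ n

/-- The strings are independent, so the sum of the ordered products is a power of the single twirl,
which is the scalar 4ⁿ `ntr a`. -/
theorem sum_twirlProd (M : ℕ) (a : Op n) :
    ∑ v : Fin M → Fin n → Fin 4, twirlProd a v = (4 ^ (n * M) * ntr a ^ M) • (1 : Op n) := by
  unfold twirlProd
  rw [sum_list_prod_ofFn (fun u : Fin n → Fin 4 => pauliString u * a * pauliString u),
    sum_pauliString_conj, smul_pow, one_pow]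
  congr 1
  unfold ntr
  rw [pow_mul, ← mul_pow]
  congr 1
  have : (4 : ℂ) ^ n = 2 ^ n * 2 ^ n := by rw [← mul_pow]; norm_num
  rw [this]; field_simp

end Operators
end UHET

end

noncomputable section

namespace UHET

/-! ### The mean Hamiltonian of the main process -/

section MainProcess

open scoped Matrix.Norms.L2Operator

theorem uexp_conj {A : Type*} [CStarAlgebra A] {u : A} (h1 : star u * u = 1) (h2 : u * star u = 1)
    (h : A) (t : ℝ) : star u * uexp h t * u = uexp (star u * h * u) t := by
  have e : h * u = u * (star u * h * u) := by
    rw [← mul_assoc, ← mul_assoc, h2, one_mul]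
  rw [mul_assoc, uexp_mul_of_mul_eq e, ← mul_assoc, h1, one_mul]

theorem uexp_add_smul_one {A : Type*} [CStarAlgebra A] (h : A) (c t : ℝ) :
    uexp (h + (c : ℂ) • (1 : A)) t = Complex.exp (-(Complex.I * (c * t))) • uexp h t := by
  let _ : NormedAlgebra ℚ A := NormedAlgebra.restrictScalars ℚ ℂ A
  have e : uexp (h + (c : ℂ) • (1 : A)) t = uexp h t * uexp ((c : ℂ) • (1 : A)) t := by
    unfold uexp
    rw [smul_add, NormedSpace.exp_add_of_commute]
    rw [smul_smul]
    exact (Commute.one_right _).smul_right _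
  rw [e, uexp_smul_one, mul_smul_comm, mul_one]

/-! ### Functional calculus of a Hermitian matrix. -/

section Spectral

variable {m : Type} [Fintype m] [DecidableEq m]

theorem uexp_diagonal (v : m → ℝ) (s : ℝ) :
    uexp (Matrix.diagonal (fun i => (v i : ℂ))) s
      = Matrix.diagonal fun i => Complex.exp (-(Complex.I * s) * v i) := by
  unfold uexp
  rw [← Matrix.diagonal_smul, Matrix.exp_diagonal]
  congr 1
  funext i
  rw [Pi.coe_exp, Complex.exp_eq_exp_ℂ]; rfl

theorem abs_eigenvalues_le {A : Matrix m m ℂ} (hA : A.IsHermitian) (i : m) :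
    |hA.eigenvalues i| ≤ ‖A‖ := by
  set φ := Unitary.conjStarAlgAut ℂ (Matrix m m ℂ) hA.eigenvectorUnitary with hφ
  have h1 : Matrix.diagonal (RCLike.ofReal ∘ hA.eigenvalues : m → ℂ) = φ.symm A := by
    conv_rhs => rw [hA.spectral_theorem]
    exact (φ.symm_apply_apply _).symm
  have h2 : ‖Matrix.diagonal (RCLike.ofReal ∘ hA.eigenvalues : m → ℂ)‖ ≤ ‖A‖ := by
    rw [h1]; exact NonUnitalStarAlgHom.norm_apply_le φ.symm A
  rw [Matrix.l2_opNorm_diagonal] at h2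
  refine le_trans ?_ ((norm_le_pi_norm _ i).trans h2)
  simp

/-- Comparison of a trigonometric polynomial of a Hermitian matrix with `f` of this matrix. -/
theorem norm_sum_uexp_sub_cfc_le {A : Matrix m m ℂ} (hA : A.IsHermitian) (h1 : ‖A‖ ≤ 1)
    {ι : Type*} (S : Finset ι) (w : ι → ℂ) (s : ι → ℝ) (f : ℝ → ℝ) {c : ℝ} (hc : 0 ≤ c)
    (h : ∀ x ∈ Set.Icc (-1 : ℝ) 1,
      ‖∑ k ∈ S, w k * Complex.exp (-(Complex.I * s k) * x) - (f x : ℂ)‖ ≤ c) :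
    ‖∑ k ∈ S, w k • uexp A (s k) - cfc f A‖ ≤ c := by
  set φ := Unitary.conjStarAlgAut ℂ (Matrix m m ℂ) hA.eigenvectorUnitary with hφ
  have e1 : ∀ r : ℝ, uexp A r
      = φ (Matrix.diagonal fun i => Complex.exp (-(Complex.I * r) * hA.eigenvalues i)) := by
    intro r
    rw [← uexp_diagonal]
    conv_lhs => rw [hA.spectral_theorem]
    exact (map_uexp (φ : Matrix m m ℂ →⋆ₐ[ℂ] Matrix m m ℂ) _ r).symm
  -- The same unitary diagonalizes the evolutions and f(A), so the norm of the difference is a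
  -- maximum over eigenvalues, all of which lie in [-1, 1].
  have e2 : cfc f A = φ (Matrix.diagonal fun i => (f (hA.eigenvalues i) : ℂ)) := by
    rw [hA.cfc_eq]; rfl
  have e3 : ∑ k ∈ S, w k • uexp A (s k) - cfc f A = φ (Matrix.diagonal fun i =>
      ∑ k ∈ S, w k * Complex.exp (-(Complex.I * s k) * hA.eigenvalues i)
        - (f (hA.eigenvalues i) : ℂ)) := by
    simp only [e1, e2, ← map_smul, ← map_sum, ← map_sub]
    congr 1
    ext i j
    by_cases hij : i = j
    · subst hij; simp [Matrix.sum_apply]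
    · simp [Matrix.sum_apply, hij]
  rw [e3]
  refine (NonUnitalStarAlgHom.norm_apply_le φ _).trans ?_
  rw [Matrix.l2_opNorm_diagonal]
  refine (pi_norm_le_iff_of_nonneg hc).2 fun i => h _ ?_
  exact abs_le.1 ((abs_eigenvalues_le hA i).trans h1)

end Spectral

/-! ### The traceless part and the normalized trace. -/

variable {n : ℕ}

theorem trace_eq_ofReal {H : Op n} (hH : H.IsHermitian) :
    H.trace / 2 ^ n = ((H.trace.re / 2 ^ n : ℝ) : ℂ) := by
  have h1 : star H.trace = H.trace := by rw [← Matrix.trace_conjTranspose, hH.eq]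
  have h2 : ((H.trace.re : ℝ) : ℂ) = H.trace := Complex.conj_eq_iff_re.1 h1
  push_cast
  rw [h2]

theorem isHermitian_traceless {H : Op n} (hH : H.IsHermitian) : (traceless H).IsHermitian := by
  unfold traceless
  rw [trace_eq_ofReal hH]
  refine hH.sub ?_
  have : IsSelfAdjoint (((H.trace.re / 2 ^ n : ℝ) : ℂ) • (1 : Op n)) :=
    IsSelfAdjoint.smul (by simp [IsSelfAdjoint]) (IsSelfAdjoint.one _)
  exact this

theorem trace_traceless (H : Op n) : (traceless H).trace = 0 := by
  unfold traceless
  rw [Matrix.trace_sub, Matrix.trace_smul, Matrix.trace_one]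
  simp

theorem uexp_eq_smul_uexp_traceless {H : Op n} (hH : H.IsHermitian) (τ : ℝ) :
    uexp H τ = Complex.exp (-(Complex.I * ((H.trace.re / 2 ^ n : ℝ) * τ))) •
      uexp (traceless H) τ := by
  rw [← uexp_add_smul_one, ← trace_eq_ofReal hH]
  congr 1
  simp [traceless]

theorem norm_entry_le {m : Type} [Fintype m] [DecidableEq m] (X : Matrix m m ℂ) (i j : m) :
    ‖X i j‖ ≤ ‖X‖ := by
  have h := Matrix.l2_opNorm_mulVec X (EuclideanSpace.single j (1 : ℂ))
  rw [PiLp.norm_single, norm_one, mul_one] at h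
  refine le_trans ?_ h
  refine le_trans (le_of_eq ?_) (PiLp.norm_apply_le _ i)
  simp

theorem norm_ntr_le (X : Op n) : ‖ntr X‖ ≤ ‖X‖ := by
  unfold ntr
  rw [norm_div, norm_pow, Complex.norm_ofNat, div_le_iff₀ (by positivity)]
  calc ‖X.trace‖ ≤ ∑ i, ‖X i i‖ := norm_sum_le _ _
    _ ≤ ∑ _i : Qubits n, ‖X‖ := Finset.sum_le_sum fun i _ => norm_entry_le X i i
    _ = ‖X‖ * 2 ^ n := by simp [mul_comm]

theorem ntr_smul (c : ℂ) (X : Op n) : ntr (c • X) = c * ntr X := by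
  simp [ntr, mul_div_assoc]

theorem ntr_conjTranspose (X : Op n) : ntr Xᴴ = star (ntr X) := by
  simp [ntr, Matrix.trace_conjTranspose]

theorem norm_ntr_uexp_le {h : Op n} (hh : h.IsHermitian) (τ : ℝ) : ‖ntr (uexp h τ)‖ ≤ 1 :=
  (norm_ntr_le _).trans (norm_uexp_le hh.isSelfAdjoint τ)

theorem ntr_uexp_neg {h : Op n} (hh : h.IsHermitian) (τ : ℝ) :
    ntr (uexp h (-τ)) = star (ntr (uexp h τ)) := by
  rw [← star_uexp hh.isSelfAdjoint, Matrix.star_eq_conjTranspose, ntr_conjTranspose]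

/-- The trace annihilates the linear term of the expansion, so the deviation is quadratic in the
time. Negative times follow by complex conjugation. -/
theorem norm_ntr_uexp_sub_one_le {h : Op n} (hh : h.IsHermitian) (h1 : ‖h‖ ≤ 1)
    (htr : h.trace = 0) (τ : ℝ) : ‖ntr (uexp h τ) - 1‖ ≤ τ ^ 2 / 2 := by
  have key : ∀ τ : ℝ, 0 ≤ τ → ‖ntr (uexp h τ) - 1‖ ≤ τ ^ 2 / 2 := by
    intro τ hτ
    have e : ntr (uexp h τ) - 1 = ntr (uexp h τ - 1 + (Complex.I * τ) • h) := by
      simp only [ntr, Matrix.trace_add, Matrix.trace_sub, Matrix.trace_smul, htr, smul_zero,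
        add_zero, sub_div]
      congr 1
      simp
    rw [e]
    exact (norm_ntr_le _).trans (norm_uexp_sub_linear_le hh.isSelfAdjoint h1 hτ)
  rcases le_total 0 τ with hτ | hτ
  · exact key τ hτ
  · have := key (-τ) (by linarith)
    rw [ntr_uexp_neg hh, neg_sq] at this
    rwa [← norm_star, star_sub, star_one]

theorem norm_pow_sub_one_le {z : ℂ} (hz : ‖z‖ ≤ 1) (M : ℕ) : ‖z ^ M - 1‖ ≤ M * ‖z - 1‖ := by
  induction M with
  | zero => simp
  | succ M ih =>
    have : z ^ (M + 1) - 1 = z ^ M * (z - 1) + (z ^ M - 1) := by ring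
    rw [this]
    calc _ ≤ ‖z ^ M‖ * ‖z - 1‖ + M * ‖z - 1‖ :=
          (norm_add_le _ _).trans (add_le_add (norm_mul_le _ _) ih)
      _ ≤ 1 * ‖z - 1‖ + M * ‖z - 1‖ := by
          gcongr
          rw [norm_pow]; exact pow_le_one₀ (norm_nonneg _) hz
      _ = _ := by push_cast; ring

/-! #### Rotations of the control qubit -/

theorem rotation_matrix (H : Op n) (r : Fin 3 → ℝ) : Gate.matrix H (.rotation r)
    = uexp (((r 0 : ℂ) • pauli 1 + (r 1 : ℂ) • pauli 2 + (r 2 : ℂ) • pauli 3) ⊗ₖ (1 : Op n)) 1 :=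
  map_uexp (ampHom (Fin 2) (Qubits n)) _ 1

theorem rotation_z_matrix (H : Op n) (r : ℝ) : Gate.matrix H (.rotation ![0, 0, r])
    = bd (Complex.exp (-(Complex.I * r)) • 1) (Complex.exp (Complex.I * r) • 1) := by
  have h0 : ((r : ℂ) • pauli 3) * Matrix.single 0 0 1
      = Matrix.single 0 0 1 * ((r : ℂ) • (1 : Matrix (Fin 2) (Fin 2) ℂ)) := by
    ext i j; fin_cases i <;> fin_cases j <;> simp [pauli, Matrix.mul_apply, Matrix.single]
  have h1 : ((r : ℂ) • pauli 3) * Matrix.single 1 1 1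
      = Matrix.single 1 1 1 * (((-r : ℝ) : ℂ) • (1 : Matrix (Fin 2) (Fin 2) ℂ)) := by
    ext i j; fin_cases i <;> fin_cases j <;> simp [pauli, Matrix.mul_apply, Matrix.single]
  have e : uexp ((r : ℂ) • pauli 3) 1 = Complex.exp (-(Complex.I * r)) • Matrix.single 0 0 1
      + Complex.exp (Complex.I * r) • Matrix.single 1 1 1 := by
    rw [← mul_one (uexp _ _), ← single_add_single_fin_two, mul_add, uexp_mul_of_mul_eq h0,
      uexp_mul_of_mul_eq h1, uexp_smul_one, uexp_smul_one, mul_smul_comm, mul_smul_comm, mul_one,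
      mul_one]
    simp
  have e2 : Gate.matrix H (.rotation ![0, 0, r]) = uexp ((r : ℂ) • pauli 3) 1 ⊗ₖ (1 : Op n) := by
    simp [Gate.matrix, evol, uexp]
  rw [e2, e, bd, Matrix.add_kronecker, Matrix.smul_kronecker, Matrix.smul_kronecker,
    Matrix.kronecker_smul, Matrix.kronecker_smul]

theorem rotation_xy_matrix (H : Op n) (φ τ : ℝ) :
    Gate.matrix H (.rotation ![Real.cos φ * τ, -(Real.sin φ * τ), 0])
      = uexp (od (Complex.exp (Complex.I * φ) • (1 : Op n))) τ := by
  have e1 := uexp_smul_left (od (Complex.exp (Complex.I * φ) • (1 : Op n))) τ 1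
  rw [mul_one] at e1
  rw [rotation_matrix, ← e1]
  congr 1
  have e2 : Complex.exp (Complex.I * φ) = Real.cos φ + Real.sin φ * Complex.I := by
    rw [mul_comm, Complex.exp_mul_I, Complex.ofReal_cos, Complex.ofReal_sin]
  have e3 : star (Complex.exp (Complex.I * φ)) = Real.cos φ - Real.sin φ * Complex.I := by
    rw [e2]
    generalize Real.cos φ = a
    generalize Real.sin φ = b
    simp [sub_eq_add_neg]
  rw [od, Matrix.conjTranspose_smul, e3, e2, Matrix.conjTranspose_one, Matrix.kronecker_smul,
    Matrix.kronecker_smul, ← Matrix.smul_kronecker, ← Matrix.smul_kronecker, ← Matrix.add_kronecker,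
    ← Matrix.smul_kronecker]
  congr 1
  ext i j
  fin_cases i <;> fin_cases j <;> simp [pauli, Matrix.single] <;> ring

/-! #### Compensation parameters -/

/-- The number of Pauli conjugations and the duration of each query for frequency `k`. -/
def queryTime (k : ℤ) : ℝ := k * Real.pi / (2 * ((10 * k.natAbs ^ 2 : ℕ) : ℝ))

/-- The compensation parameter `A_k e^{iθ_k}` of the Hamiltonian `H`. -/
def zTrue (H : Op n) (k : ℤ) : ℂ :=
  ntr (uexp (traceless H) (queryTime k)) ^ (10 * k.natAbs ^ 2)

theorem queryTime_mul (k : ℤ) : ((10 * k.natAbs ^ 2 : ℕ) : ℝ) * queryTime k = k * Real.pi / 2 := by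
  rcases eq_or_ne k 0 with rfl | hk
  · simp [queryTime]
  · have : (k.natAbs : ℝ) ≠ 0 := by exact_mod_cast Int.natAbs_ne_zero.2 hk
    unfold queryTime
    push_cast
    field_simp

theorem zTrue_zero (H : Op n) : zTrue H 0 = 1 := by simp [zTrue]

theorem zTrue_neg {H : Op n} (hH : H.IsHermitian) (k : ℤ) : zTrue H (-k) = star (zTrue H k) := by
  have : queryTime (-k) = -queryTime k := by simp [queryTime, neg_div]
  rw [zTrue, zTrue, this, ntr_uexp_neg (isHermitian_traceless hH), Int.natAbs_neg, star_pow]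

/-- There are 10k² factors, each within (π/(20k))²/2 of 1. The number of conjugations grows like k²
exactly so that this total, π²/80, does not depend on k. -/
theorem norm_zTrue_sub_one_le {H : Op n} (hH : H.IsHermitian) (h1 : ‖traceless H‖ ≤ 1) (k : ℤ) :
    ‖zTrue H k - 1‖ ≤ Real.pi ^ 2 / 80 := by
  rcases eq_or_ne k 0 with rfl | hk
  · rw [zTrue_zero, sub_self, norm_zero]; positivity
  have h2 := norm_ntr_uexp_sub_one_le (isHermitian_traceless hH) h1 (trace_traceless H)
    (queryTime k)
  have hk' : (0 : ℝ) < k.natAbs := by exact_mod_cast Int.natAbs_pos.2 hk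
  have hk2 : (k : ℝ) ^ 2 = (k.natAbs : ℝ) ^ 2 := by
    rw [Nat.cast_natAbs, Int.cast_abs, sq_abs]
  calc _ ≤ ((10 * k.natAbs ^ 2 : ℕ) : ℝ) * (queryTime k ^ 2 / 2) :=
        (norm_pow_sub_one_le (norm_ntr_uexp_le (isHermitian_traceless hH) _) _).trans (by gcongr)
    _ = Real.pi ^ 2 / 80 := by
        unfold queryTime
        rw [div_pow, mul_pow, hk2]; push_cast; field_simp; norm_num

variable {K G : ℕ}

/-- The estimate `Â_k e^{iθ̂_k}`. -/
def zEst (ω : Record K G) (k : ℤ) : ℂ := aHat ω k * Complex.exp (Complex.I * thetaHat ω k)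

theorem aHat_pos (ω : Record K G) (k : ℤ) : 1 / 2 < aHat ω k := by
  unfold aHat
  split_ifs with h
  · exact half_lt_norm_zHat _ _
  · norm_num

theorem norm_zEst (ω : Record K G) (k : ℤ) : ‖zEst ω k‖ = aHat ω k := by
  have h := aHat_pos ω k
  rw [zEst, norm_mul, mul_comm Complex.I, Complex.norm_exp_ofReal_mul_I, mul_one, Complex.norm_real,
    Real.norm_of_nonneg (by linarith)]

theorem zEst_zero (ω : Record K G) : zEst ω 0 = 1 := by simp [zEst, aHat, thetaHat]

/-- Records are indexed from 0 and frequencies from 1. Reducing the argument to [0, 2π) is invisible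
after exponentiation. -/
theorem zEst_natCast_succ (ω : Record K G) (i : Fin K) : zEst ω ((i : ℕ) + 1 : ℕ) = zHat ω i := by
  have h : 0 < (((i : ℕ) + 1 : ℕ) : ℤ).natAbs ∧ (((i : ℕ) + 1 : ℕ) : ℤ).natAbs ≤ K := by
    rw [Int.natAbs_natCast]; exact ⟨by omega, i.2⟩
  have hi : (⟨(((i : ℕ) + 1 : ℕ) : ℤ).natAbs - 1, by omega⟩ : Fin K) = i := by
    ext; simp only [Int.natAbs_natCast]; omega
  rw [zEst, aHat, thetaHat, dif_pos h, dif_pos h, hi]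
  have hs : (((i : ℕ) + 1 : ℕ) : ℤ).sign = 1 := Int.sign_eq_one_of_pos (by omega)
  rw [hs, Int.cast_one, one_mul]
  have e : Complex.exp (Complex.I * (toIcoMod Real.two_pi_pos 0 (Complex.arg (zHat ω i)) : ℝ))
      = Complex.exp (Complex.arg (zHat ω i) * Complex.I) := by
    rw [toIcoMod, zsmul_eq_mul]
    refine Complex.exp_eq_exp_iff_exists_int.2
      ⟨-toIcoDiv Real.two_pi_pos 0 (Complex.arg (zHat ω i)), ?_⟩
    push_cast; ring
  rw [e, Complex.norm_mul_exp_arg_mul_I]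

theorem zEst_neg (ω : Record K G) (k : ℤ) : zEst ω (-k) = star (zEst ω k) := by
  have h1 : aHat ω (-k) = aHat ω k := by simp only [aHat, Int.natAbs_neg]
  have h2 : thetaHat ω (-k) = -thetaHat ω k := by
    unfold thetaHat
    simp only [Int.natAbs_neg, Int.sign_neg]
    split_ifs
    · push_cast; ring
    · ring
  rw [zEst, zEst, h1, h2, Complex.star_def, map_mul, Complex.conj_ofReal, ← Complex.exp_conj]
  congr 2
  simp

/-- The error of the estimates for frequency `k`. -/
theorem norm_zEst_sub_zTrue_neg {H : Op n} (hH : H.IsHermitian) (ω : Record K G) (k : ℤ) :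
    ‖zEst ω (-k) - zTrue H (-k)‖ = ‖zEst ω k - zTrue H k‖ := by
  rw [zEst_neg, zTrue_neg hH, ← star_sub, norm_star]

/-! #### The effective Hamiltonian -/

/-- `e^{ikπ(H₀+1)/2}`. -/
def harmonic (H : Op n) (k : ℤ) : Op n :=
  Complex.exp (Complex.I * (k * Real.pi / 2)) • uexp (traceless H) (-(k * Real.pi / 2))

/-- The Hamiltonian of one iteration of the main process. -/
def stepHam (f : ℝ → ℝ) (H : Op n) (ω : Record K G) (s : StepIndex n K) : OpC n :=
  (Circuit.matrix H (wHat ω s))ᴴ * od (Complex.exp (Complex.I * Complex.arg (coeff f s.1)) •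
    (1 : Op n)) * Circuit.matrix H (wHat ω s)

theorem exp_mul_exp_neg (x : ℂ) : Complex.exp x * Complex.exp (-x) = 1 := by
  rw [← Complex.exp_add, add_neg_cancel, Complex.exp_zero]

theorem matrix_wHat (H : Op n) (ω : Record K G) (s : StepIndex n K) :
    Circuit.matrix H (wHat ω s)
      = bd (Complex.exp (-(Complex.I * (s.1 * Real.pi / 4 - thetaHat ω s.1 / 2))) •
            uexp H (queryTime s.1) ^ (10 * (s.1 : ℤ).natAbs ^ 2))
          (Complex.exp (Complex.I * (s.1 * Real.pi / 4 - thetaHat ω s.1 / 2)) •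
            twirlProd (uexp H (queryTime s.1)) s.2) := by
  rw [wHat, wCircuit, Circuit.matrix_append, Circuit.matrix_append, Circuit.matrix_singleton,
    Circuit.matrix_singleton, rotation_z_matrix, rotation_z_matrix]
  change Circuit.matrix H (controlization (queryTime s.1) s.2) * _ * _ = _
  rw [matrix_controlization, bd_mul_bd, bd_mul_bd]
  simp only [mul_smul_comm, mul_one, smul_smul]
  rw [← Complex.exp_add, ← Complex.exp_add]
  congr 3 <;> · push_cast; ring

theorem pauliAt_eq_pauliString (i : Fin n) (a : Fin 4) :
    pauliAt i a = pauliString (Function.update (fun _ => 0) i a) := by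
  ext x y
  rw [pauliString, Matrix.of_apply, pauliAt, Matrix.of_apply,
    ← Finset.mul_prod_erase _ _ (Finset.mem_univ i), Function.update_self]
  split_ifs with h
  · rw [Finset.prod_eq_one, mul_one]
    intro j hj
    rw [Function.update_of_ne (Finset.ne_of_mem_erase hj)]
    simp [pauli, h j (Finset.ne_of_mem_erase hj)]
  · push Not at h
    obtain ⟨j, hj, hxy⟩ := h
    rw [Finset.prod_eq_zero (i := j) (by simp [hj]), mul_zero]
    rw [Function.update_of_ne hj]
    simp [pauli, hxy]

theorem unitary_gate {H : Op n} (hH : H.IsHermitian) (g : Gate n) :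
    (Gate.matrix H g)ᴴ * Gate.matrix H g = 1 := by
  cases g with
  | cpauli i a =>
    change (bd 1 (pauliAt i a))ᴴ * bd 1 (pauliAt i a) = 1
    rw [conjTranspose_bd, bd_mul_bd, conjTranspose_pauliAt, Matrix.conjTranspose_one,
      pauliAt_eq_pauliString, pauliString_mul_self, mul_one, bd_one_one]
  | query τ =>
    have e : Gate.matrix H (.query τ) = uexp (sysHom (Fin 2) (Qubits n) H) τ :=
      map_uexp (sysHom (Fin 2) (Qubits n)) H τ
    rw [e]
    exact star_uexp_mul_self (hH.isSelfAdjoint.map (sysHom (Fin 2) (Qubits n))) τ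
  | rotation r =>
    rw [rotation_matrix]
    exact star_uexp_mul_self ((isHermitian_rotation r).map (ampHom (Fin 2) (Qubits n))) 1

theorem unitary_circuit {H : Op n} (hH : H.IsHermitian) (c : Circuit n) :
    (Circuit.matrix H c)ᴴ * Circuit.matrix H c = 1 := by
  induction c with
  | nil => simp [Circuit.matrix_nil]
  | cons g c ih =>
    rw [Circuit.matrix_cons, Matrix.conjTranspose_mul, mul_assoc, ← mul_assoc _ _ (Circuit.matrix H c),
      unitary_gate hH, one_mul, ih]

/-- Conjugation passes into the exponent. An iteration is therefore an evolution under a random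
Hamiltonian, which is self-adjoint of norm at most 1, as the drift estimate requires. -/
theorem matrix_mainStep {f : ℝ → ℝ} {t ε : ℝ} {H : Op n} (hH : H.IsHermitian) (ω : Record K G)
    (s : StepIndex n K) : Circuit.matrix H (mainStep f t ε ω s)
      = uexp (stepHam f H ω s) (beta f ω * t / mainN f t ε ω) := by
  have h1 := unitary_circuit hH (wHat ω s)
  have h2 := mul_eq_one_comm.1 h1
  unfold mainStep
  rw [Circuit.matrix_append, Circuit.matrix_append, Circuit.matrix_inv hH,
    Circuit.matrix_singleton, rotation_xy_matrix]
  exact uexp_conj h1 h2 _ _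

theorem norm_stepHam_le {f : ℝ → ℝ} {H : Op n} (hH : H.IsHermitian) (ω : Record K G)
    (s : StepIndex n K) : ‖stepHam f H ω s‖ ≤ 1 := by
  have h1 := unitary_circuit hH (wHat ω s)
  refine (norm_conj_le (norm_le_one_of_star_mul_self h1) _).trans ((norm_od_le _).trans ?_)
  rw [norm_smul, mul_comm Complex.I, Complex.norm_exp_ofReal_mul_I, one_mul]
  exact norm_one_le_one

theorem isSelfAdjoint_stepHam (f : ℝ → ℝ) (H : Op n) (ω : Record K G) (s : StepIndex n K) :
    IsSelfAdjoint (stepHam f H ω s) := by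
  unfold stepHam
  exact (isSelfAdjoint_od _).conjugate' _

/-- The effective Hamiltonian before averaging over the Pauli matrices. -/
theorem stepHam_eq_od (f : ℝ → ℝ) (H : Op n) (ω : Record K G) (s : StepIndex n K) :
    stepHam f H ω s = od ((Complex.exp (Complex.I * (s.1 * Real.pi / 2 - thetaHat ω s.1)) *
      Complex.exp (Complex.I * Complex.arg (coeff f s.1))) •
      ((uexp H (queryTime s.1) ^ (10 * (s.1 : ℤ).natAbs ^ 2))ᴴ *
        twirlProd (uexp H (queryTime s.1)) s.2)) := by
  have e : ∀ x y : ℝ, Complex.exp (Complex.I * (x - y))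
      = star (Complex.exp (-(Complex.I * (x / 2 - y / 2)))) *
        Complex.exp (Complex.I * (x / 2 - y / 2)) := by
    intro x y
    rw [Complex.star_def, ← Complex.exp_conj, ← Complex.exp_add]
    congr 1
    simp [Complex.conj_ofNat]
    ring
  rw [stepHam, matrix_wHat]
  have h := bd_mul_od_mul_bd (n := n)
  have h' : ∀ P Q R : Op n, (bd P Q)ᴴ * od R * bd P Q = od (Pᴴ * R * Q) := by
    intro P Q R
    have := h Pᴴ Qᴴ R
    rwa [← conjTranspose_bd, Matrix.conjTranspose_conjTranspose,
      Matrix.conjTranspose_conjTranspose] at this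
  rw [h']
  congr 1
  have e' := e (s.1 * Real.pi / 2) (thetaHat ω s.1)
  have e1 : ((((s.1 : ℤ) : ℝ) * Real.pi / 2 : ℝ) : ℂ) = ((s.1 : ℤ) : ℂ) * Real.pi / 2 := by
    push_cast; ring
  rw [e1] at e'
  have e2 : ((s.1 : ℤ) : ℂ) * Real.pi / 2 / 2 = ((s.1 : ℤ) : ℂ) * Real.pi / 4 := by ring
  rw [e2] at e'
  rw [e', Matrix.conjTranspose_smul]
  simp only [smul_mul_assoc, mul_smul_comm, mul_one, smul_smul]
  congr 1
  ring

/-- The trace of H contributes only a phase to each query. The two branches carry conjugate copies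
of it, so it cancels and only H₀ remains. -/
theorem conjTranspose_pow_mul_ntr_pow {H : Op n} (hH : H.IsHermitian) (τ : ℝ) (M : ℕ) :
    ntr (uexp H τ) ^ M • (uexp H τ ^ M)ᴴ
      = ntr (uexp (traceless H) τ) ^ M • uexp (traceless H) (-(M * τ)) := by
  rw [uexp_eq_smul_uexp_traceless hH, ntr_smul, smul_pow, mul_pow, Matrix.conjTranspose_smul,
    smul_smul, uexp_pow]
  have e : (uexp (traceless H) (M * τ))ᴴ = uexp (traceless H) (-(M * τ)) :=
    star_uexp (isHermitian_traceless hH).isSelfAdjoint _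
  rw [e]
  congr 1
  have hx : ‖Complex.exp (-(Complex.I * ((H.trace.re / 2 ^ n : ℝ) * τ)))‖ = 1 := by
    rw [← Complex.ofReal_mul, mul_comm, ← neg_mul, ← Complex.ofReal_neg,
      Complex.norm_exp_ofReal_mul_I]
  rw [mul_right_comm, star_pow, ← mul_pow, Complex.star_def, Complex.mul_conj, Complex.normSq_eq_norm_sq,
    hx]
  simp

theorem sum_stepIndex {M : Type*} [AddCommMonoid M] (F : StepIndex n K → M) :
    ∑ s, F s = ∑ k : Finset.Icc (-(K : ℤ)) K,
      ∑ v : Fin (10 * (k : ℤ).natAbs ^ 2) → Fin n → Fin 4, F ⟨k, v⟩ :=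
  Fintype.sum_sigma _

/-- For fixed k there are 4^{10nk²} tuples of strings, each with the reciprocal weight, so averaging
a function of k alone involves only the distribution of k. -/
theorem sum_stepProb_mul (f : ℝ → ℝ) (ω : Record K G) (g : ℤ → ℝ) :
    ∑ s : StepIndex n K, stepProb f ω s * g s.1
      = (∑ k ∈ Finset.Icc (-(K : ℤ)) K, ‖coeff f k‖ / aHat ω k * g k) / beta f ω := by
  rw [sum_stepIndex]
  simp only [stepProb, Finset.sum_const, Finset.card_univ, Fintype.card_fun, Fintype.card_fin,
    nsmul_eq_mul]
  rw [Finset.sum_div, ← Finset.sum_coe_sort (Finset.Icc (-(K : ℤ)) K)]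
  refine Finset.sum_congr rfl fun k _ => ?_
  have h4 : (((4 ^ n) ^ (10 * (k : ℤ).natAbs ^ 2) : ℕ) : ℝ) * (1 / 4) ^ (10 * n * (k : ℤ).natAbs ^ 2)
      = 1 := by
    rw [← pow_mul, show n * (10 * (k : ℤ).natAbs ^ 2) = 10 * n * (k : ℤ).natAbs ^ 2 by ring]
    push_cast
    rw [← mul_pow]
    norm_num
  calc _ = ((((4 ^ n) ^ (10 * (k : ℤ).natAbs ^ 2) : ℕ) : ℝ) *
        (1 / 4) ^ (10 * n * (k : ℤ).natAbs ^ 2)) *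
        (‖coeff f k‖ / (aHat ω k * beta f ω) * g k) := by ring
    _ = _ := by rw [h4, one_mul, ← div_div]; ring

theorem sum_stepProb (f : ℝ → ℝ) (ω : Record K G) (hβ : beta f ω ≠ 0) :
    ∑ s : StepIndex n K, stepProb f ω s = 1 := by
  have h := sum_stepProb_mul (n := n) f ω fun _ => 1
  simp only [mul_one] at h
  rw [h]
  exact div_self hβ

theorem beta_nonneg (f : ℝ → ℝ) (ω : Record K G) : 0 ≤ beta f ω :=
  Finset.sum_nonneg fun k _ => div_nonneg (norm_nonneg _) (by linarith [aHat_pos ω k])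

theorem stepProb_nonneg (f : ℝ → ℝ) (ω : Record K G) (s : StepIndex n K) : 0 ≤ stepProb f ω s :=
  mul_nonneg (div_nonneg (norm_nonneg _)
    (mul_nonneg (by linarith [aHat_pos ω s.1]) (beta_nonneg f ω))) (by positivity)

/-- The upper right block of `β` times the mean Hamiltonian. -/
def meanBlock (f : ℝ → ℝ) (H : Op n) (ω : Record K G) : Op n :=
  ∑ k ∈ Finset.Icc (-(K : ℤ)) K, (coeff f k * (zTrue H k / zEst ω k)) • harmonic H k

/-- The twirl multiplies the k-th harmonic by `zTrue`. The sampling weight 1/Â_k and the rotation by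
-θ̂_k divide it by the estimate, and the phase of the coefficient comes from the axis of the XY
rotation. -/
theorem sum_stepProb_smul_stepHam (f : ℝ → ℝ) {H : Op n} (hH : H.IsHermitian) (ω : Record K G)
    (hβ : beta f ω ≠ 0) :
    (beta f ω : ℂ) • ∑ s : StepIndex n K, (stepProb f ω s : ℂ) • stepHam f H ω s
      = od (meanBlock f H ω) := by
  simp only [stepHam_eq_od, ← od_real_smul]
  rw [← od_sum, ← od_real_smul]
  congr 1
  rw [sum_stepIndex, meanBlock, ← Finset.sum_coe_sort (Finset.Icc (-(K : ℤ)) K), Finset.smul_sum]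
  refine Finset.sum_congr rfl fun k _ => ?_
  have hA := aHat_pos ω k
  have hA' : (aHat ω k : ℂ) ≠ 0 := by exact_mod_cast (by linarith : aHat ω k ≠ 0)
  have hβ' : (beta f ω : ℂ) ≠ 0 := by exact_mod_cast hβ
  set M := 10 * (k : ℤ).natAbs ^ 2 with hM
  have e1 : uexp (traceless H) (-((M : ℕ) * queryTime k))
      = uexp (traceless H) (-((k : ℤ) * Real.pi / 2)) := by rw [hM, queryTime_mul]
  have e2 := conjTranspose_pow_mul_ntr_pow hH (queryTime k) M
  have e3 : ntr (uexp (traceless H) (queryTime k)) ^ M = zTrue H k := rfl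
  rw [e1, e3] at e2
  have e4 : coeff f k = ‖coeff f k‖ * Complex.exp (Complex.I * Complex.arg (coeff f k)) := by
    rw [mul_comm Complex.I, Complex.norm_mul_exp_arg_mul_I]
  have e5 : (4 : ℂ) ^ (n * M) * (1 / 4) ^ (10 * n * (k : ℤ).natAbs ^ 2) = 1 := by
    rw [hM, show n * (10 * (k : ℤ).natAbs ^ 2) = 10 * n * (k : ℤ).natAbs ^ 2 by ring, ← mul_pow]
    norm_num
  have e6 : Complex.exp (Complex.I * ((k : ℤ) * Real.pi / 2 - thetaHat ω k))
      = Complex.exp (Complex.I * ((k : ℤ) * Real.pi / 2)) /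
        Complex.exp (Complex.I * thetaHat ω k) := by
    rw [mul_sub, Complex.exp_sub]
  simp only [stepProb, smul_smul]
  rw [← Finset.smul_sum, ← Finset.mul_sum, sum_twirlProd, mul_smul_comm, mul_one, smul_smul,
    smul_smul, ← mul_assoc, ← smul_smul (_ * 4 ^ (n * M) : ℂ), e2, harmonic, smul_smul, smul_smul]
  congr 1
  rw [e6, zEst]
  push_cast
  have h7 : Complex.exp (Complex.I * thetaHat ω k) ≠ 0 := Complex.exp_ne_zero _
  conv_rhs => rw [e4]
  generalize Complex.exp (Complex.I * thetaHat ω k) = E at *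
  generalize Complex.exp (Complex.I * ((k : ℤ) * Real.pi / 2)) = E1 at *
  generalize Complex.exp (Complex.I * Complex.arg (coeff f k)) = E2 at *
  generalize ((‖coeff f k‖ : ℝ) : ℂ) = c at *
  field_simp
  linear_combination (c * E1 * E2 * zTrue H k) * e5

theorem norm_meanBlock_sub_le {f : ℝ → ℝ} {t ε : ℝ} {H : Op n} (hH : H.IsHermitian)
    (h1 : ‖traceless H‖ ≤ 1) (hK : IsCutoff f t ε K) (ω : Record K G) :
    ‖meanBlock f H ω - cfc f (traceless H)‖ ≤ ε / (6 * t) +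
      2 * ∑ k ∈ Finset.Icc (-(K : ℤ)) K, ‖coeff f k‖ * ‖zEst ω k - zTrue H k‖ := by
  have hε : 0 ≤ ε / (6 * t) := (norm_nonneg _).trans (hK.2 0 (by norm_num)).le
  set Q := ∑ k ∈ Finset.Icc (-(K : ℤ)) K, coeff f k • harmonic H k with hQ
  have e1 : ‖Q - cfc f (traceless H)‖ ≤ ε / (6 * t) := by
    have := norm_sum_uexp_sub_cfc_le (isHermitian_traceless hH) h1 (Finset.Icc (-(K : ℤ)) K)
      (fun k => coeff f k * Complex.exp (Complex.I * (k * Real.pi / 2)))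
      (fun k => -(k * Real.pi / 2)) f hε ?_
    · simpa only [hQ, harmonic, smul_smul] using this
    · intro x hx
      -- The map x ↦ (x + 1)/2 takes the spectral interval [-1, 1] to [0, 1], the half on which f̃
      -- is a rescaled copy of f.
      have h2 := (hK.2 ((x + 1) / 2) ⟨by linarith [hx.1], by linarith [hx.2]⟩).le
      rw [norm_sub_rev, fTilde, if_neg (by linarith [hx.1]),
        show 2 * ((x + 1) / 2) - 1 = x by ring] at h2
      refine le_trans (le_of_eq ?_) h2
      congr 2
      refine Finset.sum_congr rfl fun k _ => ?_
      rw [mul_assoc, ← Complex.exp_add]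
      congr 2
      push_cast; ring
  have e2 : ‖meanBlock f H ω - Q‖ ≤
      2 * ∑ k ∈ Finset.Icc (-(K : ℤ)) K, ‖coeff f k‖ * ‖zEst ω k - zTrue H k‖ := by
    rw [meanBlock, hQ, ← Finset.sum_sub_distrib, Finset.mul_sum]
    refine (norm_sum_le _ _).trans (Finset.sum_le_sum fun k _ => ?_)
    have hA := aHat_pos ω k
    have hz : zEst ω k ≠ 0 := by rw [← norm_pos_iff, norm_zEst]; linarith
    have hh : ‖harmonic H k‖ ≤ 1 := by
      rw [harmonic, norm_smul]
      have : Complex.I * ((k : ℂ) * Real.pi / 2) = ((k * Real.pi / 2 : ℝ) : ℂ) * Complex.I := by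
        push_cast; ring
      rw [this, Complex.norm_exp_ofReal_mul_I, one_mul]
      exact norm_uexp_le (isHermitian_traceless hH).isSelfAdjoint _
    rw [← sub_smul, norm_smul]
    have e3 : coeff f k * (zTrue H k / zEst ω k) - coeff f k
        = coeff f k * -(zEst ω k - zTrue H k) / zEst ω k := by field_simp; ring
    rw [e3, norm_div, norm_mul, norm_neg, norm_zEst]
    calc _ ≤ ‖coeff f k‖ * ‖zEst ω k - zTrue H k‖ / aHat ω k * 1 := by gcongr
      -- The guaranteed bound Â_k > 1/2 turns relative errors into absolute ones and gives the
      -- factor 2.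
      _ ≤ ‖coeff f k‖ * ‖zEst ω k - zTrue H k‖ / (1 / 2) := by rw [mul_one]; gcongr
      _ = _ := by ring
  calc _ ≤ _ := norm_sub_le_norm_sub_add_norm_sub _ Q _
    _ ≤ _ := by linarith

theorem matrix_mainCircuit {f : ℝ → ℝ} {t ε : ℝ} {H : Op n} (hH : H.IsHermitian) (ω : Record K G)
    (s : MainIndex n f t ε ω) : Circuit.matrix H (mainCircuit s)
      = revProd (fun i => uexp (stepHam f H ω i) (beta f ω * t / mainN f t ε ω)) s := by
  unfold mainCircuit
  rw [Circuit.matrix_flatten_map]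
  congr 1
  funext i
  exact matrix_mainStep hH ω i

theorem map_revProd {ι M N : Type*} [Monoid M] [Monoid N] (φ : M →* N) (u : ι → M) {L : ℕ}
    (s : Fin L → ι) : φ (revProd u s) = revProd (fun i => φ (u i)) s := by
  simp [revProd, map_list_prod, Function.comp_def]

/-- The error of the main process for given outcomes of the pre-processing, in the Heisenberg
picture. -/
theorem norm_main_sub_le {A : Type*} [CStarAlgebra A] (ι : OpC n →⋆ₐ[ℂ] A) {f : ℝ → ℝ} {t ε : ℝ}
    (ht : 0 < t) (hε : 0 < ε) {H : Op n} (hH : H.IsHermitian)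
    (h1 : ‖traceless H‖ ≤ 1) (hK : IsCutoff f t ε K) (ω : Record K G) (B : A) :
    ‖∑ s : MainIndex n f t ε ω, (mainProb s : ℂ) •
        (star (ι (Circuit.matrix H (mainCircuit s))) * B * ι (Circuit.matrix H (mainCircuit s)))
      - star (ι (uexp (od (cfc f (traceless H))) t)) * B *
        ι (uexp (od (cfc f (traceless H))) t)‖
    ≤ (ε / 5 + 2 * t * (ε / (6 * t) + 2 * ∑ k ∈ Finset.Icc (-(K : ℤ)) K,
        ‖coeff f k‖ * ‖zEst ω k - zTrue H k‖)) * ‖B‖ := by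
  set D := od (meanBlock f H ω) with hD
  set F := od (cfc f (traceless H)) with hF
  have hDF : ‖D - F‖ ≤ ε / (6 * t) + 2 * ∑ k ∈ Finset.Icc (-(K : ℤ)) K,
        ‖coeff f k‖ * ‖zEst ω k - zTrue H k‖ := by
    rw [hD, hF, ← od_sub]
    exact (norm_od_le _).trans (norm_meanBlock_sub_le hH h1 hK ω)
  have hDs : IsSelfAdjoint D := isSelfAdjoint_od _
  have hFs : IsSelfAdjoint F := isSelfAdjoint_od _
  have e1 : ‖star (ι (uexp D t)) * B * ι (uexp D t) - star (ι (uexp F t)) * B * ι (uexp F t)‖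
      ≤ 2 * (t * ‖D - F‖) * ‖B‖ := by
    refine (norm_conj_sub_conj_le ?_ ?_ B).trans ?_
    · rw [map_uexp]; exact norm_uexp_le (hDs.map ι) t
    · rw [map_uexp]; exact norm_uexp_le (hFs.map ι) t
    · gcongr
      rw [← map_sub]
      exact (NonUnitalStarAlgHom.norm_apply_le ι _).trans (norm_uexp_sub_uexp_le hDs hFs ht.le)
  have e2 : ‖∑ s : MainIndex n f t ε ω, (mainProb s : ℂ) •
        (star (ι (Circuit.matrix H (mainCircuit s))) * B * ι (Circuit.matrix H (mainCircuit s)))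
      - star (ι (uexp D t)) * B * ι (uexp D t)‖ ≤ ε / 5 * ‖B‖ := by
    -- If β = 0, all coefficients up to the cutoff vanish, the iteration number is 0 and the mean
    -- block is zero, so both sides are the identity evolution. The sampling weights are meaningless
    -- in this case and have to be bypassed.
    rcases eq_or_ne (beta f ω) 0 with hβ | hβ
    · have hN : mainN f t ε ω = 0 := by simp [mainN, iterations, hβ]
      have hD0 : D = 0 := by
        have : ∀ k ∈ Finset.Icc (-(K : ℤ)) K, ‖coeff f k‖ / aHat ω k = 0 :=
          (Finset.sum_eq_zero_iff_of_nonneg fun k _ =>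
            div_nonneg (norm_nonneg _) (by linarith [aHat_pos ω k])).1 hβ
        rw [hD, meanBlock, Finset.sum_eq_zero, od_zero]
        intro k hk
        have h2 := this k hk
        rw [div_eq_zero_iff, or_iff_left (by linarith [aHat_pos ω k]), norm_eq_zero] at h2
        rw [h2, zero_mul, zero_smul]
      have : ∀ N : ℕ, N = 0 → ∀ φ : (Fin N → StepIndex n K) → A, ∀ p : StepIndex n K → ℝ,
          (∀ s, φ s = B) → ∑ s, ((∏ m, p (s m) : ℝ) : ℂ) • φ s = B := by
        rintro N rfl φ p h
        simp [h]
      rw [hD0, uexp_zero_left, map_one, star_one, one_mul, mul_one]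
      have h3 := this _ hN (fun s : MainIndex n f t ε ω =>
        star (ι (Circuit.matrix H (mainCircuit s))) * B * ι (Circuit.matrix H (mainCircuit s)))
        (stepProb f ω) fun s => by
          have h0 : ∀ N : ℕ, N = 0 → ∀ (u : StepIndex n K → OpC n) (s : Fin N → StepIndex n K),
              revProd u s = 1 := by
            rintro N rfl u s; simp [revProd]
          simp [matrix_mainCircuit hH, h0 _ hN]
      change ‖∑ s : MainIndex n f t ε ω, ((∏ m, stepProb f ω (s m) : ℝ) : ℂ) •
        (star (ι (Circuit.matrix H (mainCircuit s))) * B * ι (Circuit.matrix H (mainCircuit s)))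
        - B‖ ≤ _
      rw [h3, sub_self, norm_zero]
      positivity
    · have hβp : 0 < beta f ω := lt_of_le_of_ne (beta_nonneg f ω) hβ.symm
      set N := mainN f t ε ω with hN
      -- This reads N ≥ 30β²t²/ε, so the total drift error N·6τ² = 6β²t²/N is at most ε/5.
      have hNle : 10 * beta f ω ^ 2 * t ^ 2 / (ε / 3) ≤ N :=
        (le_max_left _ _).trans (Nat.le_ceil _)
      have hNpos : (0 : ℝ) < N := lt_of_lt_of_le (by positivity) hNle
      set τ := beta f ω * t / N with hτ
      have hτ0 : 0 ≤ τ := by positivity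
      have hβc : (beta f ω : ℂ) ≠ 0 := by exact_mod_cast hβ
      set g := ∑ s : StepIndex n K, (stepProb f ω s : ℂ) • stepHam f H ω s with hg
      have hgD : (beta f ω : ℂ) • g = D := sum_stepProb_smul_stepHam f hH ω hβ
      have e3 := norm_drift_sub_le (stepProb f ω) (stepProb_nonneg f ω) (sum_stepProb f ω hβ)
        (fun s => ι (stepHam f H ω s)) (fun s => (isSelfAdjoint_stepHam f H ω s).map ι)
        (fun s => (NonUnitalStarAlgHom.norm_apply_le ι _).trans (norm_stepHam_le hH ω s))
        hτ0 (g := ι g) (by simp only [hg, map_sum, map_smul]) N B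
      have e4 : uexp (ι g) (N * τ) = ι (uexp D t) := by
        rw [← map_uexp, ← hgD, uexp_smul_left, hτ, mul_div_cancel₀ _ hNpos.ne']
      have e5 : ∀ s : MainIndex n f t ε ω, ι (Circuit.matrix H (mainCircuit s))
          = revProd (fun i => uexp (ι (stepHam f H ω i)) τ) s := by
        intro s
        rw [matrix_mainCircuit hH]
        refine (map_revProd (ι : OpC n →* A) _ s).trans ?_
        congr 1
        funext i
        exact map_uexp ι _ _
      rw [e4] at e3
      simp only [e5]
      refine e3.trans ?_
      have e6 : N * (6 * τ ^ 2 * ‖B‖) = 6 * (beta f ω ^ 2 * t ^ 2 / N) * ‖B‖ := by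
        rw [hτ]; field_simp
      rw [e6]
      gcongr
      rw [div_le_iff₀ (by positivity)] at hNle
      have : beta f ω ^ 2 * t ^ 2 / N ≤ ε / 30 := by
        rw [div_le_iff₀ hNpos]; nlinarith
      linarith
  calc _ ≤ _ := norm_sub_le_norm_sub_add_norm_sub _ (star (ι (uexp D t)) * B * ι (uexp D t)) _
    _ ≤ ε / 5 * ‖B‖ + 2 * (t * ‖D - F‖) * ‖B‖ := add_le_add e2 e1
    _ ≤ _ := by
        rw [← add_mul, mul_assoc 2 t]
        gcongr

end MainProcess
end UHET

end

noncomputable section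

namespace UHET

/-! ### Success probabilities of the measurements of the pre-processing -/

section Measurement

open scoped Matrix.Norms.L2Operator

theorem pi_sq_le_ten : Real.pi ^ 2 ≤ 10 := by
  nlinarith [Real.pi_lt_d2, Real.pi_pos]

theorem uexp_pauli_two_apply (α : ℝ) :
    uexp (pauli 2) α 0 0 = Real.cos α ∧ uexp (pauli 2) α 1 0 = Real.sin α := by
  set P : Matrix (Fin 2) (Fin 2) ℂ := (1 / 2 : ℂ) • (1 + pauli 2) with hP
  set Q : Matrix (Fin 2) (Fin 2) ℂ := (1 / 2 : ℂ) • (1 - pauli 2) with hQ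
  have hY : pauli 2 * pauli 2 = 1 := by
    ext i j; fin_cases i <;> fin_cases j <;> simp [pauli]
  have h0 : pauli 2 * P = P * (((1 : ℝ) : ℂ) • (1 : Matrix (Fin 2) (Fin 2) ℂ)) := by
    rw [hP, mul_smul_comm, mul_add, hY]; simp [add_comm]
  have h1 : pauli 2 * Q = Q * (((-1 : ℝ) : ℂ) • (1 : Matrix (Fin 2) (Fin 2) ℂ)) := by
    rw [hQ, mul_smul_comm, mul_sub, hY]; simp [← smul_neg]
  have hPQ : P + Q = 1 := by
    rw [hP, hQ, ← smul_add]
    have : (1 + pauli 2 + (1 - pauli 2) : Matrix (Fin 2) (Fin 2) ℂ) = (2 : ℂ) • 1 := by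
      rw [two_smul]; abel
    rw [this, smul_smul]; norm_num
  have e : uexp (pauli 2) α = Complex.exp (-(α * Complex.I)) • P +
      Complex.exp (α * Complex.I) • Q := by
    rw [← mul_one (uexp _ _), ← hPQ, mul_add, uexp_mul_of_mul_eq h0,
      uexp_mul_of_mul_eq h1, uexp_smul_one, uexp_smul_one, mul_smul_comm, mul_smul_comm, mul_one,
      mul_one]
    congr 3 <;> · push_cast; ring
  rw [e, Complex.ofReal_cos, Complex.ofReal_sin, Complex.cos, Complex.sin]
  constructor
  · simp [hP, hQ, pauli, neg_mul]; ring
  · simp [hP, hQ, pauli, neg_mul]; ring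

variable {n : ℕ}

/-- The measured projection on the control qubit. -/
def measured (b : Bool) : Matrix (Fin 2) (Fin 2) ℂ := if b then plusState else Matrix.single 0 0 1

theorem measured_isHermitian (b : Bool) : (measured b)ᴴ = measured b := by
  cases b
  · simp [measured, Matrix.conjTranspose_single]
  · ext i j; fin_cases i <;> fin_cases j <;> simp [measured, plusState]

theorem measured_mul_self (b : Bool) : measured b * measured b = measured b := by
  cases b
  · simp [measured]
  · ext i j; fin_cases i <;> fin_cases j <;> simp [measured, plusState, Matrix.mul_apply] <;>
      norm_num

theorem norm_measured_kronecker_le (b : Bool) : ‖measured b ⊗ₖ (1 : Op n)‖ ≤ 1 := by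
  have h : star (measured b ⊗ₖ (1 : Op n)) * (measured b ⊗ₖ (1 : Op n))
      = measured b ⊗ₖ (1 : Op n) := by
    rw [Matrix.star_eq_conjTranspose, Matrix.conjTranspose_kronecker, measured_isHermitian,
      Matrix.conjTranspose_one, ← Matrix.mul_kronecker_mul, measured_mul_self, mul_one]
  have h2 := CStarRing.norm_star_mul_self (x := measured b ⊗ₖ (1 : Op n))
  rw [h] at h2
  by_contra hc
  nlinarith

/-- A success probability is a diagonal entry of a Heisenberg-evolved projection, so the drift
estimate applies to it directly. -/
theorem ofReal_bornProb (U : OpC n) (b : Bool) :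
    (bornProb U b : ℂ) = (star U * (measured b ⊗ₖ (1 : Op n)) * U) (0, 0) (0, 0) := by
  have h2 : ((√2 : ℝ) : ℂ) * ((√2 : ℝ) : ℂ) = 2 := by
    rw [← Complex.ofReal_mul, Real.mul_self_sqrt (by norm_num)]; norm_num
  rw [mul_assoc]
  simp only [Matrix.mul_apply, Fintype.sum_prod_type, Matrix.kronecker_apply, Matrix.one_apply,
    Matrix.star_apply, Fin.sum_univ_two, mul_ite, mul_one, mul_zero, ite_mul, zero_mul,
    Finset.sum_ite_eq, Finset.mem_univ, if_true]
  unfold bornProb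
  push_cast
  rw [← Finset.sum_add_distrib]
  refine Finset.sum_congr rfl fun y _ => ?_
  have hn : ∀ z : ℂ, ((‖z‖ : ℝ) : ℂ) ^ 2 = star z * z := fun z => by
    rw [Complex.star_def, mul_comm, Complex.mul_conj, Complex.normSq_eq_norm_sq]; push_cast; rfl
  cases b
  · simp [measured, hn]
  · simp only [if_true, measured, plusState, Matrix.of_apply, Matrix.cons_val', Matrix.cons_val_zero,
      Matrix.cons_val_one, Matrix.cons_val_fin_one]
    push_cast
    rw [hn, star_div₀, star_add]
    have : star ((√2 : ℝ) : ℂ) = ((√2 : ℝ) : ℂ) := by simp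
    rw [this, div_mul_div_comm, h2]
    ring

theorem bornProb_nonneg (U : OpC n) (b : Bool) : 0 ≤ bornProb U b := by
  refine Finset.sum_nonneg fun y _ => ?_
  split_ifs <;> positivity

theorem bornProb_le_one {U : OpC n} (hU : Uᴴ * U = 1) (b : Bool) : bornProb U b ≤ 1 := by
  have h1 := ofReal_bornProb U b
  have h2 : ‖(bornProb U b : ℂ)‖ ≤ 1 := by
    rw [h1]
    exact (norm_entry_le _ _ _).trans ((norm_conj_le (norm_le_one_of_star_mul_self hU) _).trans
      (norm_measured_kronecker_le b))
  rw [Complex.norm_real] at h2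
  exact (le_abs_self _).trans h2

theorem successProb_mem {H : Op n} (hH : H.IsHermitian) (l k : ℕ) (Φ : ℝ) (b : Bool) :
    0 ≤ successProb H l k Φ b ∧ successProb H l k Φ b ≤ 1 := by
  unfold successProb
  constructor
  · exact div_nonneg (Finset.sum_nonneg fun j _ => bornProb_nonneg _ _) (by positivity)
  · refine div_le_one_of_le₀ ?_ (by positivity)
    calc _ ≤ ∑ _j : Fin (prepN k) → PrepIndex n l (25 * k), (1 : ℝ) :=
          Finset.sum_le_sum fun j _ => bornProb_le_one (unitary_circuit hH _) b
      _ = _ := by simp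

theorem bornProb_uexp (α : ℝ) (b : Bool) :
    bornProb (uexp (od ((-Complex.I) • (1 : Op n))) α) b
      = (1 + if b then Real.sin (2 * α) else Real.cos (2 * α)) / 2 := by
  have e : od ((-Complex.I) • (1 : Op n)) = ampHom (Fin 2) (Qubits n) (pauli 2) := by
    change _ = pauli 2 ⊗ₖ (1 : Op n)
    rw [od, Matrix.conjTranspose_smul, Matrix.conjTranspose_one, Matrix.kronecker_smul,
      Matrix.kronecker_smul, ← Matrix.smul_kronecker, ← Matrix.smul_kronecker,
      ← Matrix.add_kronecker]
    congr 1
    ext i j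
    fin_cases i <;> fin_cases j <;> simp [pauli, Matrix.single]
  rw [e, ← map_uexp]
  obtain ⟨h0, h1⟩ := uexp_pauli_two_apply α
  have h2 : ∀ (s : Fin 2) (y : Qubits n), (ampHom (Fin 2) (Qubits n) (uexp (pauli 2) α)) (s, y) (0, 0)
      = if y = 0 then uexp (pauli 2) α s 0 else 0 := by
    intro s y
    change (uexp (pauli 2) α ⊗ₖ (1 : Op n)) (s, y) (0, 0) = _
    simp [Matrix.one_apply]
  unfold bornProb
  rw [Finset.sum_eq_single 0]
  · rw [h2, h2, if_pos rfl, if_pos rfl, h0, h1]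
    have hs := Real.sin_sq_add_cos_sq α
    cases b
    · simp only [Bool.false_eq_true, if_false, Complex.norm_real, Real.norm_eq_abs, sq_abs,
        Real.cos_two_mul]
      ring
    · simp only [if_true]
      rw [← Complex.ofReal_add, ← Complex.ofReal_div, Complex.norm_real, Real.norm_eq_abs, sq_abs,
        div_pow, Real.sq_sqrt (by norm_num), Real.sin_two_mul]
      congr 1
      linarith [hs, add_sq (Real.cos α) (Real.sin α)]
  · intro y _ hy
    rw [h2, h2, if_neg hy, if_neg hy]
    simp
  · intro h; exact absurd (Finset.mem_univ _) h

/-! #### The mean Hamiltonian of the state generation -/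

/-- The sign `s`. -/
def boolSign (b : Bool) : ℝ := if b then 1 else -1

/-- The Hamiltonian of one iteration of the state generation. -/
def prepHam {l M : ℕ} (H : Op n) (Φ : ℝ) (j : PrepIndex n l M) : OpC n :=
  Circuit.matrix H (prepW Φ j) * od ((-Complex.I) • (1 : Op n)) * (Circuit.matrix H (prepW Φ j))ᴴ

theorem rotation_y_matrix (H : Op n) (γ : ℝ) : Gate.matrix H (.rotation ![0, γ, 0])
    = uexp (od ((-Complex.I) • (1 : Op n))) γ := by
  have h := rotation_xy_matrix H (-(Real.pi / 2)) γ
  have e : Complex.exp (Complex.I * ((-(Real.pi / 2) : ℝ) : ℂ)) = -Complex.I := by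
    rw [mul_comm, Complex.exp_mul_I, ← Complex.ofReal_cos, ← Complex.ofReal_sin, Real.cos_neg,
      Real.sin_neg, Real.cos_pi_div_two, Real.sin_pi_div_two]
    simp
  rw [e] at h
  rw [← h]
  simp

theorem matrix_prepStep {l M : ℕ} {H : Op n} (hH : H.IsHermitian) (γ Φ : ℝ) (j : PrepIndex n l M) :
    Circuit.matrix H (prepStep γ Φ j) = uexp (prepHam H Φ j) γ := by
  have h1 := unitary_circuit hH (prepW Φ j)
  have h2 := mul_eq_one_comm.1 h1
  unfold prepStep
  rw [Circuit.matrix_append, Circuit.matrix_append, Circuit.matrix_inv hH,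
    Circuit.matrix_singleton, rotation_y_matrix]
  have := uexp_conj (u := (Circuit.matrix H (prepW Φ j))ᴴ)
    (by rw [Matrix.star_eq_conjTranspose, Matrix.conjTranspose_conjTranspose]; exact h2)
    (by rw [Matrix.star_eq_conjTranspose, Matrix.conjTranspose_conjTranspose]; exact h1)
    (od ((-Complex.I) • (1 : Op n))) γ
  rwa [Matrix.star_eq_conjTranspose, Matrix.conjTranspose_conjTranspose] at this

theorem norm_prepHam_le {l M : ℕ} {H : Op n} (hH : H.IsHermitian) (Φ : ℝ) (j : PrepIndex n l M) :
    ‖prepHam H Φ j‖ ≤ 1 := by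
  have h1 := unitary_circuit hH (prepW Φ j)
  have h := norm_conj_le (u := (Circuit.matrix H (prepW Φ j))ᴴ)
    (by rw [← Matrix.star_eq_conjTranspose, norm_star]; exact norm_le_one_of_star_mul_self h1)
    (od ((-Complex.I) • (1 : Op n)))
  rw [Matrix.star_eq_conjTranspose, Matrix.conjTranspose_conjTranspose] at h
  refine h.trans ((norm_od_le _).trans ?_)
  rw [norm_smul, norm_neg, Complex.norm_I, one_mul]
  exact norm_one_le_one

theorem isSelfAdjoint_prepHam {l M : ℕ} (H : Op n) (Φ : ℝ) (j : PrepIndex n l M) :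
    IsSelfAdjoint (prepHam H Φ j) :=
  (isSelfAdjoint_od _).conjugate _

theorem prepHam_eq_od {l M : ℕ} (hl : 0 < l) (hM : 0 < M) (H : Op n) (Φ : ℝ)
    (j : PrepIndex n l M) : prepHam H Φ j = od ((-Complex.I *
      Complex.exp (-(Complex.I * (boolSign j.2.2 * Φ)))) •
      (twirlProd (uexp H (-(boolSign j.2.2 * Real.pi / (2 * l * M)))) j.2.1 *
        twirlProd (uexp H (boolSign j.2.2 * Real.pi / (20 * l))) j.1)ᴴ) := by
  have hl' : (l : ℝ) ≠ 0 := by positivity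
  have hM' : (M : ℝ) ≠ 0 := by positivity
  have e1 : Circuit.matrix H (prepW Φ j)
      = bd (Complex.exp (-(Complex.I * (boolSign j.2.2 * Φ / 2))) • 1)
        (Complex.exp (Complex.I * (boolSign j.2.2 * Φ / 2)) •
          (twirlProd (uexp H (-(boolSign j.2.2 * Real.pi / (2 * l * M)))) j.2.1 *
            twirlProd (uexp H (boolSign j.2.2 * Real.pi / (20 * l))) j.1)) := by
    unfold prepW
    change Circuit.matrix H ([Gate.rotation ![0, 0, boolSign j.2.2 * Φ / 2]] ++
      controlization (-(boolSign j.2.2 * Real.pi / (2 * l * M))) j.2.1 ++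
      controlization (boolSign j.2.2 * Real.pi / (20 * l)) j.1) = _
    rw [Circuit.matrix_append, Circuit.matrix_append, Circuit.matrix_singleton, rotation_z_matrix,
      matrix_controlization, matrix_controlization, bd_mul_bd, bd_mul_bd, uexp_pow, uexp_pow,
      mul_assoc (_ • (1 : Op n)) (uexp _ _), ← uexp_add]
    -- The two controlizations run for opposite total times sπl/2, so no evolution is left in the
    -- |0⟩ branch and only scalars survive the average.
    have : ((l ^ 2 * M : ℕ) : ℝ) * -(boolSign j.2.2 * Real.pi / (2 * l * M)) +
        ((10 * l ^ 2 : ℕ) : ℝ) * (boolSign j.2.2 * Real.pi / (20 * l)) = 0 := by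
      push_cast; field_simp; ring
    rw [this, uexp_zero_right, mul_one, smul_mul_assoc, smul_mul_assoc, one_mul]
    push_cast
    rfl
  rw [prepHam, e1, bd_mul_od_mul_bd]
  congr 1
  rw [Matrix.conjTranspose_smul, smul_mul_assoc, one_mul, smul_smul, smul_mul_assoc, mul_smul_comm,
    one_mul, smul_smul]
  congr 1
  have e2 : star (Complex.exp (Complex.I * (boolSign j.2.2 * Φ / 2)))
      = Complex.exp (-(Complex.I * (boolSign j.2.2 * Φ / 2))) := by
    rw [Complex.star_def, ← Complex.exp_conj]
    congr 1
    simp [Complex.conj_ofNat]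
  rw [e2, mul_right_comm, ← Complex.exp_add, mul_comm]
  congr 2
  ring

/-- The parameter that is estimated with the compensating factor of the second controlization. -/
def zPrep (H : Op n) (l M : ℕ) (s : ℝ) : ℂ :=
  ntr (uexp (traceless H) (-(s * Real.pi / (2 * l * M)))) ^ (l ^ 2 * M) *
    ntr (uexp (traceless H) (s * Real.pi / (20 * l))) ^ (10 * l ^ 2)

theorem ntr_pow_mul_ntr_pow {l M : ℕ} (hl : 0 < l) (hM : 0 < M) {H : Op n} (hH : H.IsHermitian)
    (s : ℝ) : ntr (uexp H (-(s * Real.pi / (2 * l * M)))) ^ (l ^ 2 * M) *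
      ntr (uexp H (s * Real.pi / (20 * l))) ^ (10 * l ^ 2) = zPrep H l M s := by
  have hl' : (l : ℂ) ≠ 0 := by exact_mod_cast hl.ne'
  have hM' : (M : ℂ) ≠ 0 := by exact_mod_cast hM.ne'
  rw [uexp_eq_smul_uexp_traceless hH, uexp_eq_smul_uexp_traceless hH, ntr_smul, ntr_smul, mul_pow,
    mul_pow, mul_mul_mul_comm, ← Complex.exp_nat_mul, ← Complex.exp_nat_mul, ← Complex.exp_add]
  refine Eq.trans ?_ (one_mul _)
  congr 1
  rw [← Complex.exp_zero]
  congr 1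
  push_cast
  field_simp
  ring

theorem zPrep_neg {H : Op n} (hH : H.IsHermitian) (l M : ℕ) (s : ℝ) :
    zPrep H l M (-s) = star (zPrep H l M s) := by
  unfold zPrep
  rw [star_mul', star_pow, star_pow, ← ntr_uexp_neg (isHermitian_traceless hH),
    ← ntr_uexp_neg (isHermitian_traceless hH)]
  congr 5 <;> ring

theorem zPrep_one (H : Op n) {l : ℕ} (hl : 0 < l) (M : ℕ) : zPrep H l M 1 =
    ntr (uexp (traceless H) (-(Real.pi / (2 * l * M)))) ^ (l ^ 2 * M) * zTrue H l := by
  have hl' : (l : ℝ) ≠ 0 := by positivity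
  have e : queryTime l = 1 * Real.pi / (20 * l) := by
    unfold queryTime
    rw [Int.natAbs_natCast]
    push_cast
    field_simp
    norm_num
  rw [zPrep, zTrue, e, Int.natAbs_natCast, one_mul]

/-- Flipping s conjugates the averaged scalar e^{iΦ}z. The two signs together leave its real part,
so the mean Hamiltonian is a real multiple of Y on the control qubit. -/
theorem mean_prepHam {l M : ℕ} (hl : 0 < l) (hM : 0 < M) {H : Op n} (hH : H.IsHermitian) (Φ : ℝ) :
    ∑ j : PrepIndex n l M, (((Fintype.card (PrepIndex n l M) : ℝ)⁻¹ : ℝ) : ℂ) • prepHam H Φ j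
      = (((Complex.exp (Complex.I * Φ) * zPrep H l M 1).re : ℝ) : ℂ) •
        od ((-Complex.I) • (1 : Op n)) := by
  have hcard : (Fintype.card (PrepIndex n l M) : ℝ)
      = 2 * (4 ^ (n * (10 * l ^ 2)) * 4 ^ (n * (l ^ 2 * M))) := by
    simp only [Fintype.card_prod, Fintype.card_fun, Fintype.card_fin, Fintype.card_bool]
    push_cast
    rw [← pow_mul, ← pow_mul]
    ring
  simp only [prepHam_eq_od hl hM, ← od_real_smul]
  rw [← od_sum]
  congr 1
  rw [Fintype.sum_prod_type, Finset.sum_comm, Fintype.sum_prod_type]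
  have key : ∀ s : ℝ, ∑ w : Fin (l ^ 2 * M) → Fin n → Fin 4, ∑ u : Fin (10 * l ^ 2) → Fin n → Fin 4,
      (twirlProd (uexp H (-(s * Real.pi / (2 * l * M)))) w *
        twirlProd (uexp H (s * Real.pi / (20 * l))) u)ᴴ
      = (4 ^ (n * (10 * l ^ 2)) * 4 ^ (n * (l ^ 2 * M)) * star (zPrep H l M s) : ℂ) • (1 : Op n) := by
    intro s
    rw [← ntr_pow_mul_ntr_pow hl hM hH]
    simp only [← Matrix.conjTranspose_sum, ← Finset.mul_sum, sum_twirlProd]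
    rw [← Finset.sum_mul, sum_twirlProd, smul_mul_assoc, one_mul, smul_smul,
      Matrix.conjTranspose_smul, Matrix.conjTranspose_one]
    congr 1
    simp only [star_mul', star_pow, Complex.star_def, Complex.conj_ofNat]
    ring
  have e1 : ∀ (s : ℝ) , ∑ w : Fin (l ^ 2 * M) → Fin n → Fin 4,
      ∑ u : Fin (10 * l ^ 2) → Fin n → Fin 4,
      (((Fintype.card (PrepIndex n l M) : ℝ)⁻¹ : ℝ) : ℂ) • ((-Complex.I *
      Complex.exp (-(Complex.I * (s * Φ)))) •
      (twirlProd (uexp H (-(s * Real.pi / (2 * l * M)))) w *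
        twirlProd (uexp H (s * Real.pi / (20 * l))) u)ᴴ)
      = ((-Complex.I) * (star (Complex.exp (Complex.I * (s * Φ)) * zPrep H l M s) / 2)) •
        (1 : Op n) := by
    intro s
    simp only [smul_smul, ← Finset.smul_sum]
    rw [key, smul_smul, hcard]
    congr 1
    have : star (Complex.exp (Complex.I * (s * Φ))) = Complex.exp (-(Complex.I * (s * Φ))) := by
      rw [Complex.star_def, ← Complex.exp_conj]; congr 1; simp
    rw [star_mul', this]
    push_cast
    field_simp
  have e2 : ∀ F : Bool → Op n, ∑ s : Bool, F s = F true + F false := fun F => by simp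
  have e3 : ∀ F : (Fin (l ^ 2 * M) → Fin n → Fin 4) → Bool → (Fin (10 * l ^ 2) → Fin n → Fin 4) →
      Op n, ∑ w, ∑ s, ∑ u, F w s u = ∑ w, ∑ u, F w true u + ∑ w, ∑ u, F w false u := by
    intro F
    rw [← Finset.sum_add_distrib]
    exact Finset.sum_congr rfl fun w _ => e2 _
  rw [e3]
  have t1 : boolSign true = 1 := rfl
  have t2 : boolSign false = -1 := rfl
  simp only [t1, t2]
  rw [e1, e1, ← add_smul, smul_smul, zPrep_neg hH]
  congr 1
  have h4 : Complex.exp (Complex.I * (((-1 : ℝ) : ℂ) * Φ))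
      = star (Complex.exp (Complex.I * Φ)) := by
    rw [Complex.star_def, ← Complex.exp_conj]; congr 1; simp
  rw [h4, ← star_mul', star_star, Complex.ofReal_one, one_mul, Complex.re_eq_add_conj,
    Complex.star_def]
  ring

/-- The number `2πA cos(θ + Φ)` that is determined by phase estimation. -/
def vTrue (H : Op n) (l : ℕ) (Φ : ℝ) : ℝ :=
  2 * Real.pi * (Complex.exp (Complex.I * Φ) * zTrue H l).re

/-- The mean evolution is a Y rotation whose Bloch angle α differs from k v only through the second
controlization. Its M = 25k steps per l² make its deviation O(1/k), which survives multiplication by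
k as a constant. The sampling error of the random product is the other deviation. -/
theorem successProb_near {l k : ℕ} (hl : 0 < l) (hk : 0 < k) {H : Op n} (hH : H.IsHermitian)
    (h1 : ‖traceless H‖ ≤ 1) (Φ : ℝ) : ∃ α : ℝ, |α - k * vTrue H l Φ| ≤ Real.pi ^ 3 / 100 ∧
      ∀ b, |successProb H l k Φ b - (1 + if b then Real.sin α else Real.cos α) / 2| ≤ 0.107 := by
  have hk' : (0 : ℝ) < k := by exact_mod_cast hk
  have hl' : (0 : ℝ) < l := by exact_mod_cast hl
  have hpi := Real.pi_pos
  have hM : 0 < 25 * k := by omega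
  set r := (Complex.exp (Complex.I * Φ) * zPrep H l (25 * k) 1).re with hr
  refine ⟨2 * (k * Real.pi * r), ?_, ?_⟩
  · set w := ntr (uexp (traceless H) (-(Real.pi / (2 * l * ((25 * k : ℕ) : ℝ))))) ^ (l ^ 2 * (25 * k))
      with hw
    have hw1 : ‖w - 1‖ ≤ Real.pi ^ 2 / (200 * k) := by
      calc _ ≤ ((l ^ 2 * (25 * k) : ℕ) : ℝ) * ((-(Real.pi / (2 * l * ((25 * k : ℕ) : ℝ)))) ^ 2 / 2) :=
            (norm_pow_sub_one_le (norm_ntr_uexp_le (isHermitian_traceless hH) _) _).trans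
              (mul_le_mul_of_nonneg_left (norm_ntr_uexp_sub_one_le (isHermitian_traceless hH) h1
                (trace_traceless H) _) (by positivity))
        _ = _ := by push_cast; field_simp; norm_num
    have hz : ‖zTrue H l‖ ≤ 1 := by
      unfold zTrue
      rw [norm_pow]
      exact pow_le_one₀ (norm_nonneg _) (norm_ntr_uexp_le (isHermitian_traceless hH) _)
    have e : 2 * (k * Real.pi * r) - k * vTrue H l Φ
        = 2 * k * Real.pi * (Complex.exp (Complex.I * Φ) * (w - 1) * zTrue H l).re := by
      rw [vTrue, hr, zPrep_one H hl, ← hw]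
      have : Complex.exp (Complex.I * Φ) * (w - 1) * zTrue H l
        = Complex.exp (Complex.I * Φ) * (w * zTrue H l) - Complex.exp (Complex.I * Φ) * zTrue H l := by
        ring
      rw [this, Complex.sub_re]; ring
    rw [e, abs_mul, abs_of_nonneg (by positivity)]
    calc _ ≤ 2 * k * Real.pi * (Real.pi ^ 2 / (200 * k)) := by
          gcongr
          refine (Complex.abs_re_le_norm _).trans ?_
          rw [norm_mul, norm_mul, mul_comm Complex.I, Complex.norm_exp_ofReal_mul_I, one_mul]
          calc _ ≤ Real.pi ^ 2 / (200 * k) * 1 := by gcongr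
            _ = _ := mul_one _
      _ = _ := by field_simp; norm_num
  · intro b
    set N := prepN k with hN
    have hNle : 10 * 1 ^ 2 * (k * Real.pi) ^ 2 / (1 / (4 * √2)) ≤ N :=
      (le_max_left _ _).trans (Nat.le_ceil _)
    have hNpos : (0 : ℝ) < N := lt_of_lt_of_le (by positivity) hNle
    set τ := k * Real.pi / N with hτ
    have hτ0 : 0 ≤ τ := by positivity
    set B : OpC n := measured b ⊗ₖ (1 : Op n) with hB
    have hcard : (0 : ℝ) < Fintype.card (PrepIndex n l (25 * k)) := by
      have : Nonempty (PrepIndex n l (25 * k)) := ⟨(fun _ _ => 0, fun _ _ => 0, true)⟩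
      exact_mod_cast Fintype.card_pos
    have e1 := norm_drift_sub_le (fun _ : PrepIndex n l (25 * k) =>
      (Fintype.card (PrepIndex n l (25 * k)) : ℝ)⁻¹) (fun _ => by positivity)
      (by rw [Finset.sum_const, Finset.card_univ, nsmul_eq_mul, mul_inv_cancel₀ hcard.ne'])
      (prepHam H Φ) (isSelfAdjoint_prepHam H Φ) (norm_prepHam_le hH Φ) hτ0
      (mean_prepHam hl hM hH Φ) N B
    rw [uexp_smul_left] at e1
    have e2 : r * (N * τ) = k * Real.pi * r := by
      rw [hτ, mul_div_cancel₀ _ hNpos.ne', mul_comm]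
    rw [← hr, e2] at e1
    have e3 := (norm_entry_le _ (0, 0) (0, 0)).trans e1
    rw [Matrix.sub_apply, ← ofReal_bornProb, bornProb_uexp, Matrix.sum_apply] at e3
    have e4 : ∑ s : Fin N → PrepIndex n l (25 * k), (((∏ _m : Fin N,
        (Fintype.card (PrepIndex n l (25 * k)) : ℝ)⁻¹ : ℝ) : ℂ) •
        (star (revProd (fun i => uexp (prepHam H Φ i) τ) s) * B *
          revProd (fun i => uexp (prepHam H Φ i) τ) s)) (0, 0) (0, 0)
        = (successProb H l k Φ b : ℂ) := by
      unfold successProb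
      push_cast
      rw [Finset.sum_div]
      refine Finset.sum_congr rfl fun s _ => ?_
      rw [Matrix.smul_apply, ← ofReal_bornProb, prepCircuit, Circuit.matrix_flatten_map]
      have : (fun i => uexp (prepHam H Φ i) τ) = fun i : PrepIndex n l (25 * k) =>
          Circuit.matrix H (prepStep (k * Real.pi / prepN k) Φ i) := by
        funext i; rw [matrix_prepStep hH]
      rw [this, smul_eq_mul, Finset.prod_const, Finset.card_univ, Fintype.card_fin, Fintype.card_fun,
        Fintype.card_fin]
      refine Eq.trans ?_ (div_eq_inv_mul _ _).symm
      push_cast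
      rw [inv_pow]
    rw [e4, ← Complex.ofReal_sub, Complex.norm_real] at e3
    refine e3.trans ?_
    have hB1 : ‖B‖ ≤ 1 := norm_measured_kronecker_le b
    have e5 : N * (6 * τ ^ 2 * ‖B‖) = 6 * ((k * Real.pi) ^ 2 / N) * ‖B‖ := by
      rw [hτ]; field_simp
    have h2 : (1.41421 : ℝ) ≤ √2 := Real.le_sqrt_of_sq_le (by norm_num)
    -- The drift error is thus at most 6/(40√2) < 0.107.
    have e6 : (k * Real.pi) ^ 2 / N ≤ 1 / (40 * √2) := by
      rw [div_le_iff₀ hNpos]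
      rw [div_le_iff₀ (by positivity)] at hNle
      have h3 : (k * Real.pi) ^ 2 = 10 * 1 ^ 2 * (k * Real.pi) ^ 2 / 10 := by ring
      rw [h3]
      calc _ ≤ N * (1 / (4 * √2)) / 10 := by gcongr
        _ = _ := by field_simp; norm_num
    have e7 : 1 / (40 * √2) ≤ 1 / (40 * 1.41421) := by gcongr
    rw [e5]
    have e8 : 6 * ((k * Real.pi) ^ 2 / N) ≤ 6 * (1 / (40 * 1.41421)) :=
      mul_le_mul_of_nonneg_left (e6.trans e7) (by norm_num)
    have e9 := mul_le_mul e8 hB1 (norm_nonneg _) (by norm_num)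
    refine e9.trans ?_
    norm_num

end Measurement
end UHET

end

noncomputable section

namespace UHET

/-! ### Robust phase estimation -/

section PhaseEstimation

open scoped Matrix.Norms.L2Operator

/-- The true value is about 3300; 2000 repetitions are all that the Chernoff bound below needs,
since 0.0025 · 2000 = 5. -/
theorem two_thousand_le_rpeConst : 2000 ≤ rpeConst := by
  have h1 : (1.4142 : ℝ) ≤ √2 := Real.le_sqrt_of_sq_le (by norm_num)
  have h2 : √2 ≤ 1.41422 := Real.sqrt_le_iff.2 ⟨by norm_num, by norm_num⟩
  have h3 : √8 * deltaSup = 1 / 2 + 0.32 * √2 := by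
    have : √8 = 2 * √2 := by
      rw [show (8 : ℝ) = 2 ^ 2 * 2 by norm_num, Real.sqrt_mul (by norm_num),
        Real.sqrt_sq (by norm_num)]
    rw [this, deltaSup]
    field_simp
    norm_num
    ring
  set x := 1 - √8 * deltaSup with hx
  have hx1 : 0.047 ≤ x := by rw [hx, h3]; linarith
  have hx2 : x ≤ 0.0475 := by rw [hx, h3]; linarith
  have hy : x ^ 2 / 2 ≤ 0.00113 := by nlinarith
  have hy0 : 0 < x ^ 2 / 2 := by positivity
  have ha : Real.log (x / 2) ≤ -3 := by
    rw [Real.log_le_iff_le_exp (by linarith)]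
    have e3 : Real.exp 3 ≤ 21 := by
      have := Real.exp_one_lt_d9
      have e : Real.exp 3 = Real.exp 1 ^ 3 := by rw [← Real.exp_nat_mul]; norm_num
      rw [e]
      calc _ ≤ (2.7182818286 : ℝ) ^ 3 := by gcongr
        _ ≤ 21 := by norm_num
    rw [Real.exp_neg]
    calc x / 2 ≤ (21 : ℝ)⁻¹ := by norm_num; linarith
      _ ≤ _ := by gcongr
  have hb : -0.00114 ≤ Real.log (1 - x ^ 2 / 2) := by
    refine le_trans ?_ (Real.one_sub_inv_le_log_of_pos (by linarith))
    have : (1 - x ^ 2 / 2)⁻¹ ≤ (1 - 0.00113)⁻¹ := by gcongr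
    refine le_trans ?_ (sub_le_sub_left this 1)
    norm_num
  have hb0 : Real.log (1 - x ^ 2 / 2) < 0 := Real.log_neg (by linarith) (by linarith)
  have : (2000 : ℝ) ≤ Real.log (x / 2) / Real.log (1 - x ^ 2 / 2) := by
    rw [le_div_iff_of_neg hb0]; linarith
  have h4 : ((2000 : ℕ) : ℝ) ≤ rpeConst := by
    push_cast
    exact this.trans (Nat.le_ceil _)
  exact_mod_cast h4

theorem abs_refine_succ_sub_le (φ : ℕ → ℝ) (j : ℕ) :
    |refine φ (j + 1) - refine φ j| ≤ Real.pi / 2 ^ (j + 1) := by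
  have h := toIocMod_mem_Ioc (p := 2 * Real.pi / 2 ^ (j + 1)) (by positivity)
      (refine φ j - Real.pi / 2 ^ (j + 1)) (φ (j + 1) / 2 ^ (j + 1))
  have e : 2 * Real.pi / 2 ^ (j + 1) = 2 * (Real.pi / 2 ^ (j + 1)) := by ring
  rw [abs_le]
  constructor
  · have := h.1; rw [refine]; linarith
  · have := h.2; rw [refine]; linarith

/-- Each refinement moves the estimate by at most half the previous allowance, whatever the data, so
later corrections sum to a geometric tail. -/
theorem abs_refine_sub_le (φ : ℕ → ℝ) (j d : ℕ) :
    |refine φ (j + d) - refine φ j| ≤ Real.pi / 2 ^ j - Real.pi / 2 ^ (j + d) := by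
  induction d with
  | zero => simp
  | succ d ih =>
    have h := abs_refine_succ_sub_le φ (j + d)
    have e : Real.pi / 2 ^ (j + d) = 2 * (Real.pi / 2 ^ (j + d + 1)) := by
      rw [pow_succ]; field_simp
    calc _ ≤ |refine φ (j + d + 1) - refine φ (j + d)| + |refine φ (j + d) - refine φ j| := by
          rw [← add_assoc]; exact abs_sub_le _ _ _
      _ ≤ _ := by rw [← add_assoc]; linarith

/-- The phase of generation `j + 1` is accurate enough. -/
def GoodPhase (φ : ℕ → ℝ) (v : ℝ) (j : ℕ) : Prop :=
  ∃ m : ℤ, |φ j - 2 ^ j * v - 2 * Real.pi * m| < Real.pi / 3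

/-- With P = 2^{j+1}, the old estimate is off by less than 2π/(3P) and the new candidate by less
than π/(3P). They differ by less than π/P, so the window of radius π/P selects this candidate. This
is where the tolerance π/3 comes from. -/
theorem refine_near {φ : ℕ → ℝ} {v : ℝ} {j : ℕ} (h : ∀ i ≤ j, GoodPhase φ v i) :
    ∃ m : ℤ, |refine φ j - v - 2 * Real.pi * m| < Real.pi / (3 * 2 ^ j) := by
  have hpi := Real.pi_pos
  induction j with
  | zero => simpa [refine, GoodPhase] using h 0 le_rfl
  | succ j ih =>
    obtain ⟨m, hm⟩ := ih fun i hi => h i (by omega)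
    obtain ⟨m', hm'⟩ := h (j + 1) le_rfl
    set P : ℝ := 2 ^ (j + 1) with hP
    have hP0 : 0 < P := by positivity
    set e := (φ (j + 1) - P * v - 2 * Real.pi * m') / P with he
    have heb : |e| < Real.pi / (3 * P) := by
      rw [he, abs_div, abs_of_pos hP0, div_lt_iff₀ hP0]
      refine hm'.trans_eq ?_
      field_simp
    have hmb : |refine φ j - v - 2 * Real.pi * m| < 2 * (Real.pi / (3 * P)) := by
      refine hm.trans_eq ?_
      rw [hP, pow_succ]; field_simp
    have hthird : Real.pi / P = 3 * (Real.pi / (3 * P)) := by field_simp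
    have heq : refine φ (j + 1) = v + 2 * Real.pi * m + e := by
      rw [refine, toIocMod_eq_iff]
      rw [abs_lt] at heb hmb
      have h2 : 2 * Real.pi / 2 ^ (j + 1) = 2 * (Real.pi / P) := by ring
      refine ⟨⟨?_, ?_⟩, m' - (2 ^ (j + 1) : ℤ) * m, ?_⟩
      · rw [← hP]; linarith [heb.1, hmb.2]
      · rw [h2, ← hP]; linarith [heb.2, hmb.1]
      · rw [zsmul_eq_mul, he]
        push_cast
        rw [← hP]
        field_simp
        ring
    refine ⟨m, ?_⟩
    rw [heq, show v + 2 * Real.pi * m + e - v - 2 * Real.pi * m = e by ring]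
    exact heb

/-- If D is below the margin 2.3, the shifted x stays in the chosen period and nothing is lost.
Otherwise 3D exceeds the length of a period. -/
theorem abs_toIocMod_sub_le {a v x D : ℝ} (h1 : a + 2.3 ≤ v) (h2 : v ≤ a + 2 * Real.pi - 2.3)
    {m : ℤ} (hx : |x - v - 2 * Real.pi * m| ≤ D) :
    |toIocMod Real.two_pi_pos a x - v| ≤ 3 * D := by
  have hD : 0 ≤ D := (abs_nonneg _).trans hx
  by_cases hd : D < 2.3
  · have : toIocMod Real.two_pi_pos a x = x - 2 * Real.pi * m := by
      rw [toIocMod_eq_iff]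
      rw [abs_le] at hx
      refine ⟨⟨by linarith, by linarith⟩, m, ?_⟩
      rw [zsmul_eq_mul]; ring
    rw [this, show x - 2 * Real.pi * m - v = x - v - 2 * Real.pi * m by ring]
    linarith
  · have h := toIocMod_mem_Ioc Real.two_pi_pos a x
    have := Real.pi_lt_d2
    rw [abs_le]
    constructor <;> linarith [h.1, h.2]

/-! ### From good phases to the final estimate. -/

variable {K G : ℕ}

/-- After the good generations the error is below π/(3·2^{J-1}), and all later generations move the
estimate by less than π/2^{J-1}. The sum is (8π/3)/2^J, and reduction modulo 2π costs the factor 3.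
-/
theorem vHat_near (ω : Record K G) (i : Fin K) (Φ : Bool) {v : ℝ}
    (h1 : (if Φ then -Real.pi else Real.pi) + 2.3 ≤ v)
    (h2 : v ≤ (if Φ then -Real.pi else Real.pi) + 2 * Real.pi - 2.3) {J : ℕ} (hJ : J ≤ G)
    (h : ∀ j < J, GoodPhase (phaseOf ω i Φ) v j) :
    |vHat ω i Φ - v| ≤ 8 * Real.pi / 2 ^ J := by
  have hpi := Real.pi_pos
  rcases Nat.eq_zero_or_pos J with rfl | hJ0
  · have h := toIocMod_mem_Ioc Real.two_pi_pos (if Φ then -Real.pi else Real.pi)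
      (refine (phaseOf ω i Φ) (G - 1))
    rw [vHat, pow_zero, div_one, abs_le]
    constructor <;> linarith [h.1, h.2]
  · obtain ⟨m, hm⟩ := refine_near (φ := phaseOf ω i Φ) (v := v) (j := J - 1)
      fun i hi => h i (by omega)
    have h3 := abs_refine_sub_le (phaseOf ω i Φ) (J - 1) (G - J)
    rw [show J - 1 + (G - J) = G - 1 by omega] at h3
    have hJe : (2 : ℝ) ^ J = 2 * 2 ^ (J - 1) := by rw [← pow_succ']; congr 1; omega
    have h4 : |refine (phaseOf ω i Φ) (G - 1) - v - 2 * Real.pi * m| ≤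
        (8 * Real.pi / 3) / 2 ^ J := by
      have e : (8 * Real.pi / 3) / 2 ^ J = Real.pi / (3 * 2 ^ (J - 1)) + Real.pi / 2 ^ (J - 1) := by
        rw [hJe]; field_simp; ring
      have e2 : refine (phaseOf ω i Φ) (G - 1) - v - 2 * Real.pi * m
          = (refine (phaseOf ω i Φ) (J - 1) - v - 2 * Real.pi * m) +
            (refine (phaseOf ω i Φ) (G - 1) - refine (phaseOf ω i Φ) (J - 1)) := by ring
      rw [e, e2]
      have h5 : 0 < Real.pi / 2 ^ (G - 1) := by positivity
      exact (abs_add_le _ _).trans (by linarith)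
    have := abs_toIocMod_sub_le h1 h2 h4
    rw [vHat]
    refine this.trans_eq ?_
    ring

-- If some generation fails, the first failure J alone determines the bound 8π/2^J, and its term in
-- the sum covers it. Bounding by a sum of indicators makes the expectation computable term by term.
open Classical in
theorem vHat_error_le (ω : Record K G) (i : Fin K) (Φ : Bool) {v : ℝ}
    (h1 : (if Φ then -Real.pi else Real.pi) + 2.3 ≤ v)
    (h2 : v ≤ (if Φ then -Real.pi else Real.pi) + 2 * Real.pi - 2.3) :
    |vHat ω i Φ - v| ≤ 8 * Real.pi * (1 / 2 ^ G + ∑ j ∈ Finset.range G,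
      (1 / 2 ^ j) * if GoodPhase (phaseOf ω i Φ) v j then 0 else 1) := by
  have hpi := Real.pi_pos
  have hnn : ∀ j ∈ Finset.range G, 0 ≤ (1 / 2 ^ j : ℝ) *
      if GoodPhase (phaseOf ω i Φ) v j then 0 else 1 := fun j _ => by positivity
  by_cases h : ∀ j < G, GoodPhase (phaseOf ω i Φ) v j
  · refine (vHat_near ω i Φ h1 h2 le_rfl h).trans ?_
    have := Finset.sum_nonneg hnn
    rw [div_eq_mul_one_div]
    gcongr
    linarith
  · have hex : ∃ j, ¬ (j < G → GoodPhase (phaseOf ω i Φ) v j) := by push Not at h ⊢; exact h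
    set J := Nat.find hex with hJ
    have hs := Nat.find_spec hex
    rw [← hJ] at hs
    push Not at hs
    refine (vHat_near ω i Φ h1 h2 hs.1.le fun j hj => ?_).trans ?_
    · have := Nat.find_min hex hj
      push Not at this
      exact this (hj.trans hs.1)
    · have h3 := Finset.single_le_sum hnn (Finset.mem_range.2 hs.1)
      rw [if_neg hs.2, mul_one] at h3
      rw [div_eq_mul_one_div]
      have : (0 : ℝ) ≤ 1 / 2 ^ G := by positivity
      gcongr
      linarith

/-- Rotate ψ to 0. Seen from the origin, the disc of radius 0.8 around 1 has half-angle arcsin 0.8 <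
π/3. -/
theorem exists_int_abs_arg_sub_lt {w : ℂ} {ψ : ℝ}
    (h : ‖w - Complex.exp (ψ * Complex.I)‖ ≤ 0.8) :
    ∃ m : ℤ, |Complex.arg w - ψ - 2 * Real.pi * m| < Real.pi / 3 := by
  set u := w * Complex.exp (-(ψ * Complex.I)) with hu
  have hn : ‖Complex.exp (-(ψ * Complex.I))‖ = 1 := by
    rw [← neg_mul, ← Complex.ofReal_neg, Complex.norm_exp_ofReal_mul_I]
  have hu1 : ‖u - 1‖ ≤ 0.8 := by
    have : u - 1 = (w - Complex.exp (ψ * Complex.I)) * Complex.exp (-(ψ * Complex.I)) := by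
      rw [sub_mul, exp_mul_exp_neg]
    rw [this, norm_mul, hn, mul_one]; exact h
  have hre : 0.2 ≤ u.re := by
    have := (Complex.abs_re_le_norm (u - 1)).trans hu1
    rw [Complex.sub_re, Complex.one_re, abs_le] at this
    linarith [this.1]
  have hu0 : u ≠ 0 := fun h0 => by rw [h0] at hre; norm_num at hre
  have hun : 0 < ‖u‖ := norm_pos_iff.2 hu0
  have hsq : ‖u - 1‖ ^ 2 = ‖u‖ ^ 2 - 2 * u.re + 1 := by
    rw [← Complex.normSq_eq_norm_sq, ← Complex.normSq_eq_norm_sq, Complex.normSq_apply,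
      Complex.normSq_apply]
    simp; ring
  have hcos : 1 / 2 < Real.cos (Complex.arg u) := by
    rw [Complex.cos_arg hu0, lt_div_iff₀ hun]
    nlinarith [norm_nonneg (u - 1), sq_nonneg (‖u‖ - 0.6)]
  have harg : |Complex.arg u| < Real.pi / 3 := by
    by_contra hc
    push Not at hc
    have h3 := Real.cos_le_cos_of_nonneg_of_le_pi (by positivity) (Complex.abs_arg_le_pi u) hc
    rw [Real.cos_abs, Real.cos_pi_div_three] at h3
    linarith
  have hwu : ‖w‖ = ‖u‖ := by rw [hu, norm_mul, hn, mul_one]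
  have e1 : Complex.exp (Complex.arg w * Complex.I) = Complex.exp ((ψ + Complex.arg u) * Complex.I) := by
    have h1 := Complex.norm_mul_exp_arg_mul_I w
    have h2 := Complex.norm_mul_exp_arg_mul_I u
    have hw : w = u * Complex.exp (ψ * Complex.I) := by
      rw [hu, mul_assoc, mul_comm (Complex.exp _), exp_mul_exp_neg, mul_one]
    rw [add_mul, Complex.exp_add]
    have hne : (‖u‖ : ℂ) ≠ 0 := by exact_mod_cast hun.ne'
    apply mul_left_cancel₀ hne
    rw [← hwu, h1, hwu, mul_left_comm, h2, hw]
    ring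
  obtain ⟨m, hm⟩ := Complex.exp_eq_exp_iff_exists_int.1 e1
  refine ⟨m, ?_⟩
  have h5 : (Complex.arg w : ℂ) = ψ + Complex.arg u + m * (2 * Real.pi) := by
    apply mul_right_cancel₀ Complex.I_ne_zero
    rw [hm]; ring
  have h6 : Complex.arg w = ψ + Complex.arg u + m * (2 * Real.pi) := by exact_mod_cast h5
  rw [h6, show ψ + Complex.arg u + m * (2 * Real.pi) - ψ - 2 * Real.pi * m = Complex.arg u by ring]
  exact harg

theorem norm_mk_sub_exp_le {x y ψ α η : ℝ} (hη : 0 ≤ η) (h1 : |x - Real.cos α| ≤ η)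
    (h2 : |y - Real.sin α| ≤ η) :
    ‖(⟨x, y⟩ : ℂ) - Complex.exp (ψ * Complex.I)‖ ≤ 1.415 * η + |α - ψ| := by
  have e1 : ‖(⟨x, y⟩ : ℂ) - Complex.exp (α * Complex.I)‖ ≤ 1.415 * η := by
    have : (⟨x, y⟩ : ℂ) - Complex.exp (α * Complex.I) = ⟨x - Real.cos α, y - Real.sin α⟩ := by
      apply Complex.ext
      · simp [Complex.exp_ofReal_mul_I_re]
      · simp [Complex.exp_ofReal_mul_I_im]
    rw [this]
    apply abs_le_of_sq_le_sq' _ (by positivity) |>.2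
    rw [← Complex.normSq_eq_norm_sq, Complex.normSq_mk]
    have a1 := sq_le_sq' (abs_le.1 h1).1 (abs_le.1 h1).2
    have a2 := sq_le_sq' (abs_le.1 h2).1 (abs_le.1 h2).2
    nlinarith
  have e2 : ‖Complex.exp (α * Complex.I) - Complex.exp (ψ * Complex.I)‖ ≤ |α - ψ| := by
    have : Complex.exp (α * Complex.I) - Complex.exp (ψ * Complex.I)
        = Complex.exp (ψ * Complex.I) * (Complex.exp (Complex.I * (α - ψ : ℝ)) - 1) := by
      rw [mul_sub, ← Complex.exp_add, mul_one]
      congr 2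
      push_cast; ring
    rw [this, norm_mul, Complex.norm_exp_ofReal_mul_I, one_mul]
    exact Real.norm_exp_I_mul_ofReal_sub_one_le
  exact (norm_sub_le_norm_sub_add_norm_sub _ _ _).trans (add_le_add e1 e2)

variable {n : ℕ}

/-- If the observed frequencies are close to the success probabilities, the phase is good. -/
theorem goodPhase_of_frequency {H : Op n} (hH : H.IsHermitian) (h1 : ‖traceless H‖ ≤ 1)
    (ω : Record K G) (i : Fin K) (Φ : Bool) {j : ℕ} (hj : j < G)
    (h : ∀ b, |frequency ω i Φ ⟨j, hj⟩ b - successProb H ((i : ℕ) + 1) (2 ^ j) (angle Φ) b| ≤ 0.05) :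
    GoodPhase (phaseOf ω i Φ) (vTrue H ((i : ℕ) + 1) (angle Φ)) j := by
  obtain ⟨α, hα, hb⟩ := successProb_near (l := (i : ℕ) + 1) (k := 2 ^ j) (by omega) (by positivity)
    hH h1 (angle Φ)
  have hpi3 : Real.pi ^ 3 ≤ 31.01 := by
    have h2 := Real.pi_lt_d4
    have h3 := Real.pi_pos
    calc Real.pi ^ 3 ≤ (3.1416 : ℝ) ^ 3 := by gcongr
      _ ≤ 31.01 := by norm_num
  -- 0.32 exceeds 2 · (0.107 + 0.05): sampling error of the random circuit plus statistical error.
  have c1 : |2 * frequency ω i Φ ⟨j, hj⟩ false - 1 - Real.cos α| ≤ 0.32 := by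
    have a := h false
    have b := hb false
    simp only [Bool.false_eq_true, if_false] at b
    rw [abs_le] at a b ⊢
    constructor <;> linarith [a.1, a.2, b.1, b.2]
  have c2 : |2 * frequency ω i Φ ⟨j, hj⟩ true - 1 - Real.sin α| ≤ 0.32 := by
    have a := h true
    have b := hb true
    simp only [if_true] at b
    rw [abs_le] at a b ⊢
    constructor <;> linarith [a.1, a.2, b.1, b.2]
  have c3 := norm_mk_sub_exp_le (ψ := (2 ^ j : ℕ) * vTrue H ((i : ℕ) + 1) (angle Φ)) (by norm_num) c1 c2
  -- 1.415 · 0.32 + π³/100 stays below 0.8.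
  have c4 := exists_int_abs_arg_sub_lt (c3.trans (by norm_num at hα ⊢; linarith))
  unfold GoodPhase phaseOf
  rw [dif_pos hj]
  push_cast at c4
  exact c4

end PhaseEstimation
end UHET

end

noncomputable section

namespace UHET

/-! ### Mean error of the pre-processing -/

section Expectation

open scoped Matrix.Norms.L2Operator

variable {n K G : ℕ}

/-- Expectation of a product of functions of distinct independent bits. -/
theorem sum_prod_bits {T : Type*} [Fintype T] [DecidableEq T] (w : T → Bool → ℝ)
    (hw : ∀ τ, w τ true + w τ false = 1) {M : ℕ} {e : Fin M → T} (he : Function.Injective e)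
    (g : Bool → ℝ) {c : ℝ} (hc : ∀ r, w (e r) true * g true + w (e r) false * g false = c) :
    ∑ ω : T → Bool, (∏ τ, w τ (ω τ)) * ∏ r, g (ω (e r)) = c ^ M := by
  have e1 : ∀ ω : T → Bool, (∏ τ, w τ (ω τ)) * ∏ r, g (ω (e r))
      = ∏ τ, w τ (ω τ) * if τ ∈ Finset.univ.image e then g (ω τ) else 1 := by
    intro ω
    rw [Finset.prod_mul_distrib, Finset.prod_ite_mem, Finset.univ_inter,
      Finset.prod_image fun a _ b _ h => he h]
  simp only [e1]
  rw [← Fintype.piFinset_univ, ← Finset.prod_univ_sum (fun _ : T => (Finset.univ : Finset Bool))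
    (fun τ x => w τ x * if τ ∈ Finset.univ.image e then g x else 1)]
  have e2 : ∀ τ : T, ∑ x : Bool, w τ x * (if τ ∈ Finset.univ.image e then g x else 1)
      = if τ ∈ Finset.univ.image e then c else 1 := by
    intro τ
    rw [Fintype.sum_bool]
    split_ifs with h
    · obtain ⟨r, -, rfl⟩ := Finset.mem_image.1 h
      exact hc r
    · simpa using hw τ
  rw [Finset.prod_congr rfl fun τ _ => e2 τ, Finset.prod_ite_mem, Finset.univ_inter,
    Finset.prod_const, Finset.card_image_of_injective _ he, Finset.card_univ, Fintype.card_fin]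

/-- The probability of the outcome `x` of one measurement. -/
def trialProb (H : Op n) (τ : Trial K G) (x : Bool) : ℝ :=
  if x then successProb H ((τ.1 : ℕ) + 1) (2 ^ (τ.2.2.1 : ℕ)) (angle τ.2.1) τ.2.2.2.1
  else 1 - successProb H ((τ.1 : ℕ) + 1) (2 ^ (τ.2.2.1 : ℕ)) (angle τ.2.1) τ.2.2.2.1

theorem recordProb_eq (H : Op n) (ω : Record K G) :
    recordProb H ω = ∏ τ, trialProb H τ (ω τ) := rfl

theorem trialProb_add (H : Op n) (τ : Trial K G) :
    trialProb H τ true + trialProb H τ false = 1 := by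
  simp [trialProb]

theorem recordProb_nonneg {H : Op n} (hH : H.IsHermitian) (ω : Record K G) :
    0 ≤ recordProb H ω := by
  rw [recordProb_eq]
  refine Finset.prod_nonneg fun τ _ => ?_
  unfold trialProb
  have := successProb_mem hH ((τ.1 : ℕ) + 1) (2 ^ (τ.2.2.1 : ℕ)) (angle τ.2.1) τ.2.2.2.1
  split_ifs <;> linarith [this.1, this.2]

theorem sum_recordProb (H : Op n) : ∑ ω : Record K G, recordProb H ω = 1 := by
  have := sum_prod_bits (trialProb (K := K) (G := G) H) (trialProb_add H) (M := 0)
    (e := Fin.elim0) (fun a => a.elim0) (fun _ => 1) (c := 1) (fun a => a.elim0)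
  simpa [recordProb_eq] using this

/-! ### Chernoff bounds for the observed frequencies. -/

/-- Exponential moment of a centred bit. -/
theorem bit_mgf_le {p : ℝ} (h0 : 0 ≤ p) (h1 : p ≤ 1) {s : ℝ} (hs : s ^ 2 = 1) :
    p * Real.exp (0.1 * (s * (1 - p) - 0.05)) + (1 - p) * Real.exp (0.1 * (s * (0 - p) - 0.05))
      ≤ Real.exp (-0.0025) := by
  have hs1 : |s| ≤ 1 := by rw [← sq_le_one_iff_abs_le_one, hs]
  -- In the mean over the bit the linear term cancels and the quadratic one becomes the variance, at
  -- most 1/4. This gives 1.0025 ≤ e^{0.0025}, against the gain e^{-0.005} from the deviation.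
  have key : ∀ y : ℝ, |y| ≤ 1 → Real.exp (0.1 * (s * y)) ≤ 1 + 0.1 * (s * y) + 0.01 * y ^ 2 := by
    intro y hy
    have hsy : |0.1 * (s * y)| ≤ 1 := by
      rw [abs_mul, abs_mul]
      have : |s| * |y| ≤ 1 * 1 := mul_le_mul hs1 hy (abs_nonneg _) zero_le_one
      rw [abs_of_pos (by norm_num : (0.1 : ℝ) > 0)]
      linarith
    have := (abs_le.1 (Real.abs_exp_sub_one_sub_id_le hsy)).2
    have e : (0.1 * (s * y)) ^ 2 = 0.01 * y ^ 2 := by rw [mul_pow, mul_pow, hs]; ring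
    linarith
  have a1 := key (1 - p) (by rw [abs_le]; constructor <;> linarith)
  have a2 := key (0 - p) (by rw [abs_le]; constructor <;> linarith)
  have e1 : ∀ y : ℝ, Real.exp (0.1 * (s * y - 0.05))
      = Real.exp (0.1 * (s * y)) * Real.exp (-0.005) := by
    intro y; rw [← Real.exp_add]; congr 1; ring
  have hE := Real.exp_pos (-0.005)
  have a3 := Real.add_one_le_exp 0.0025
  have e2 : Real.exp (-0.0025) = Real.exp 0.0025 * Real.exp (-0.005) := by
    rw [← Real.exp_add]; norm_num
  rw [e1, e1, e2, ← mul_assoc p, ← mul_assoc (1 - p), ← add_mul]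
  refine mul_le_mul_of_nonneg_right ?_ hE.le
  calc _ ≤ p * (1 + 0.1 * (s * (1 - p)) + 0.01 * (1 - p) ^ 2) +
        (1 - p) * (1 + 0.1 * (s * (0 - p)) + 0.01 * (0 - p) ^ 2) :=
        add_le_add (mul_le_mul_of_nonneg_left a1 h0)
          (mul_le_mul_of_nonneg_left a2 (by linarith))
    _ = 1 + 0.01 * (p * (1 - p)) := by ring
    _ ≤ 0.0025 + 1 := by nlinarith [sq_nonneg (p - 1 / 2)]
    _ ≤ _ := a3

/-- The exponential bound for a large deviation of an observed frequency. -/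
def tailBound (H : Op n) (ω : Record K G) (i : Fin K) (Φ : Bool) (j : Fin G) (b : Bool) (s : ℝ) : ℝ :=
  ∏ r : Fin (reps G j), Real.exp (0.1 * (s * ((if ω (i, Φ, ⟨j, b, r⟩) then 1 else 0) -
    successProb H ((i : ℕ) + 1) (2 ^ (j : ℕ)) (angle Φ) b) - 0.05))

theorem reps_pos (j : Fin G) : 0 < reps G j :=
  Nat.mul_pos (by have := two_thousand_le_rpeConst; omega) (by omega)

theorem one_le_tailBound (H : Op n) (ω : Record K G) (i : Fin K) (Φ : Bool) (j : Fin G) (b : Bool)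
    {s : ℝ} (h : 0.05 ≤ s * (frequency ω i Φ j b -
      successProb H ((i : ℕ) + 1) (2 ^ (j : ℕ)) (angle Φ) b)) :
    1 ≤ tailBound H ω i Φ j b s := by
  unfold tailBound
  rw [← Real.exp_sum]
  apply Real.one_le_exp
  have hM : (0 : ℝ) < reps G j := by exact_mod_cast reps_pos j
  have e : ∑ r : Fin (reps G j), (if ω (i, Φ, ⟨j, b, r⟩) = true then (1 : ℝ) else 0)
      = reps G j * frequency ω i Φ j b := by
    rw [frequency, mul_div_cancel₀ _ hM.ne', Finset.sum_boole]
  rw [← Finset.mul_sum, Finset.sum_sub_distrib, ← Finset.mul_sum, Finset.sum_sub_distrib, e]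
  simp only [Finset.sum_const, Finset.card_univ, Fintype.card_fin, nsmul_eq_mul]
  nlinarith

theorem tailBound_nonneg (H : Op n) (ω : Record K G) (i : Fin K) (Φ : Bool) (j : Fin G) (b : Bool)
    (s : ℝ) : 0 ≤ tailBound H ω i Φ j b s :=
  Finset.prod_nonneg fun _ _ => (Real.exp_pos _).le

/-- F repetitions already give e^{-5} < 1/64, and each additional 3F give at least another factor
1/4. Generations before the last are thus exponentially more reliable. -/
theorem exp_pow_reps_le (j : Fin G) :
    Real.exp (-0.0025) ^ reps G j ≤ 1 / 64 * (1 / 4) ^ (G - 1 - (j : ℕ)) := by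
  have h1 : Real.exp (-0.0025) ^ rpeConst ≤ 1 / 64 := by
    have h := two_thousand_le_rpeConst
    calc _ ≤ Real.exp (-0.0025) ^ 2000 :=
          pow_le_pow_of_le_one (Real.exp_pos _).le (Real.exp_le_one_iff.2 (by norm_num)) h
      _ = (Real.exp 5)⁻¹ := by rw [← Real.exp_nat_mul, ← Real.exp_neg]; norm_num
      _ ≤ (64 : ℝ)⁻¹ := by
          gcongr
          have e : Real.exp 5 = Real.exp 1 ^ 5 := by rw [← Real.exp_nat_mul]; norm_num
          rw [e]
          calc (64 : ℝ) ≤ 2.7 ^ 5 := by norm_num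
            _ ≤ _ := by gcongr; linarith [Real.exp_one_gt_d9]
      _ = 1 / 64 := by norm_num
  have h0 : 0 ≤ Real.exp (-0.0025) ^ rpeConst := by positivity
  rw [reps, pow_mul, pow_succ', pow_mul]
  have h2 : (Real.exp (-0.0025) ^ rpeConst) ^ 3 ≤ 1 / 4 :=
    (pow_le_pow_left₀ h0 h1 3).trans (by norm_num)
  gcongr

theorem mean_tailBound_le {H : Op n} (hH : H.IsHermitian) (i : Fin K) (Φ : Bool) (j : Fin G)
    (b : Bool) {s : ℝ} (hs : s ^ 2 = 1) :
    ∑ ω : Record K G, recordProb H ω * tailBound H ω i Φ j b s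
      ≤ 1 / 64 * (1 / 4) ^ (G - 1 - (j : ℕ)) := by
  set p := successProb H ((i : ℕ) + 1) (2 ^ (j : ℕ)) (angle Φ) b with hp
  have hmem := successProb_mem hH ((i : ℕ) + 1) (2 ^ (j : ℕ)) (angle Φ) b
  have he : Function.Injective fun r : Fin (reps G j) => ((i, Φ, ⟨j, b, r⟩) : Trial K G) := by
    intro r r' h
    simpa using h
  have e := sum_prod_bits (trialProb (K := K) (G := G) H) (trialProb_add H) he
    (fun x => Real.exp (0.1 * (s * ((if x then 1 else 0) - p) - 0.05)))
    (c := p * Real.exp (0.1 * (s * (1 - p) - 0.05)) +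
      (1 - p) * Real.exp (0.1 * (s * (0 - p) - 0.05))) (fun r => by simp [trialProb, hp])
  have e2 : ∑ ω : Record K G, recordProb H ω * tailBound H ω i Φ j b s
      = (p * Real.exp (0.1 * (s * (1 - p) - 0.05)) +
      (1 - p) * Real.exp (0.1 * (s * (0 - p) - 0.05))) ^ reps G j := e
  rw [e2]
  have h2 := bit_mgf_le hmem.1 hmem.2 hs
  refine le_trans (pow_le_pow_left₀ ?_ h2 _) (exp_pow_reps_le j)
  have := hmem.1
  have := hmem.2
  have h3 : 0 ≤ 1 - p := by linarith
  positivity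

/-- A bad phase forces one of the two frequencies to deviate by more than 0.05 in one of the two
directions; the four exponential bounds cover these cases. -/
theorem indicator_le_tailBound {H : Op n} (hH : H.IsHermitian) (h1 : ‖traceless H‖ ≤ 1)
    (ω : Record K G) (i : Fin K) (Φ : Bool) (j : Fin G)
    (h : ¬ GoodPhase (phaseOf ω i Φ) (vTrue H ((i : ℕ) + 1) (angle Φ)) j) :
    1 ≤ ∑ b : Bool, (tailBound H ω i Φ j b 1 + tailBound H ω i Φ j b (-1)) := by
  have hex : ∃ b, ¬ |frequency ω i Φ j b -
      successProb H ((i : ℕ) + 1) (2 ^ (j : ℕ)) (angle Φ) b| ≤ 0.05 := by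
    by_contra hc
    push Not at hc
    exact h (goodPhase_of_frequency hH h1 ω i Φ j.2 hc)
  obtain ⟨b, hb⟩ := hex
  have hnn := tailBound_nonneg H ω i Φ j
  refine le_trans ?_ (Finset.single_le_sum
    (f := fun b => tailBound H ω i Φ j b 1 + tailBound H ω i Φ j b (-1))
    (fun b _ => add_nonneg (hnn b 1) (hnn b (-1))) (Finset.mem_univ b))
  rw [not_le, lt_abs] at hb
  rcases hb with hb | hb
  · have := one_le_tailBound H ω i Φ j b (s := 1) (by linarith)
    linarith [hnn b (-1)]
  · have := one_le_tailBound H ω i Φ j b (s := -1) (by linarith)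
    linarith [hnn b 1]

/-- The failure probability 4^{-(G-1-j)} outweighs the damage 2^{-j} of an early failure, so the sum
is of the order of the final resolution 2^{-G}. -/
theorem geometric_sum_le (G : ℕ) :
    ∑ j ∈ Finset.range G, (1 / 2 ^ j : ℝ) * (1 / 4) ^ (G - 1 - j) ≤ 4 / 2 ^ G := by
  induction G with
  | zero => simp
  | succ G ih =>
    rw [Finset.sum_range_succ]
    have e : ∑ j ∈ Finset.range G, (1 / 2 ^ j : ℝ) * (1 / 4) ^ (G + 1 - 1 - j)
        = (∑ j ∈ Finset.range G, (1 / 2 ^ j : ℝ) * (1 / 4) ^ (G - 1 - j)) * (1 / 4) := by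
      rw [Finset.sum_mul]
      refine Finset.sum_congr rfl fun j hj => ?_
      have := Finset.mem_range.1 hj
      rw [mul_assoc, ← pow_succ]
      congr 2; omega
    rw [e, show G + 1 - 1 - G = 0 by omega, pow_zero, mul_one]
    have e2 : (4 : ℝ) / 2 ^ (G + 1) = 4 / 2 ^ G * (1 / 4) + 1 / 2 ^ G := by
      rw [pow_succ]; field_simp; norm_num
    rw [e2]
    gcongr

/-- The parameter is within 0.125 of 1, so v is within π/4 of the centre of its period (2π for Φ =
0, 0 for Φ = π/2), and π - π/4 > 2.3. -/
theorem vTrue_margin {H : Op n} (hH : H.IsHermitian) (h1 : ‖traceless H‖ ≤ 1) (l : ℕ) (Φ : Bool) :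
    (if Φ then -Real.pi else Real.pi) + 2.3 ≤ vTrue H l (angle Φ) ∧
      vTrue H l (angle Φ) ≤ (if Φ then -Real.pi else Real.pi) + 2 * Real.pi - 2.3 := by
  have h := norm_zTrue_sub_one_le hH h1 (l : ℤ)
  have hp1 := Real.pi_lt_d2
  have hp2 := Real.pi_gt_d2
  have hz : ‖zTrue H l - 1‖ ≤ 0.125 := h.trans (by nlinarith)
  have hre := abs_le.1 ((Complex.abs_re_le_norm _).trans hz)
  have him := abs_le.1 ((Complex.abs_im_le_norm _).trans hz)
  simp only [Complex.sub_re, Complex.sub_im, Complex.one_re, Complex.one_im, sub_zero] at hre him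
  cases Φ
  · simp only [angle, Bool.false_eq_true, if_false, vTrue, Complex.ofReal_zero, mul_zero,
      Complex.exp_zero, one_mul]
    constructor <;> nlinarith [hre.1, hre.2]
  · have e : Complex.exp (Complex.I * ((Real.pi / 2 : ℝ) : ℂ)) = Complex.I := by
      push_cast; rw [mul_comm, Complex.exp_pi_div_two_mul_I]
    simp only [angle, if_true, vTrue, e, Complex.I_mul_re]
    constructor <;> nlinarith [him.1, him.2]

theorem mean_vHat_error_le {H : Op n} (hH : H.IsHermitian) (h1 : ‖traceless H‖ ≤ 1)
    (i : Fin K) (Φ : Bool) : ∑ ω : Record K G, recordProb H ω *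
      |vHat ω i Φ - vTrue H ((i : ℕ) + 1) (angle Φ)| ≤ 10 * Real.pi / 2 ^ G := by
  classical
  have hpi := Real.pi_pos
  obtain ⟨m1, m2⟩ := vTrue_margin hH h1 ((i : ℕ) + 1) Φ
  set v := vTrue H ((i : ℕ) + 1) (angle Φ) with hv
  have hP := recordProb_nonneg (K := K) (G := G) hH
  have hbad : ∀ j ∈ Finset.range G, ∑ ω : Record K G, recordProb H ω *
      (if GoodPhase (phaseOf ω i Φ) v j then 0 else 1) ≤ 1 / 16 * (1 / 4) ^ (G - 1 - j) := by
    intro j hj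
    have hj' := Finset.mem_range.1 hj
    calc _ ≤ ∑ ω : Record K G, recordProb H ω * ∑ b : Bool, (tailBound H ω i Φ ⟨j, hj'⟩ b 1 +
          tailBound H ω i Φ ⟨j, hj'⟩ b (-1)) := by
          refine Finset.sum_le_sum fun ω _ => mul_le_mul_of_nonneg_left ?_ (hP ω)
          split_ifs with h
          · exact Finset.sum_nonneg fun b _ =>
              add_nonneg (tailBound_nonneg _ _ _ _ _ _ _) (tailBound_nonneg _ _ _ _ _ _ _)
          · exact indicator_le_tailBound hH h1 ω i Φ ⟨j, hj'⟩ h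
      _ = ∑ b : Bool, (∑ ω : Record K G, recordProb H ω * tailBound H ω i Φ ⟨j, hj'⟩ b 1 +
          ∑ ω : Record K G, recordProb H ω * tailBound H ω i Φ ⟨j, hj'⟩ b (-1)) := by
          simp only [Finset.mul_sum]
          rw [Finset.sum_comm]
          refine Finset.sum_congr rfl fun b _ => ?_
          rw [← Finset.sum_add_distrib]
          exact Finset.sum_congr rfl fun ω _ => mul_add _ _ _
      -- Four tails of weight 1/64 give 1/16. With the geometric sum, the total is 8π(1 + 4/16)/2^G
      -- = 10π/2^G.
      _ ≤ ∑ _b : Bool, (1 / 64 * (1 / 4) ^ (G - 1 - j) + 1 / 64 * (1 / 4) ^ (G - 1 - j)) :=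
          Finset.sum_le_sum fun b _ => add_le_add
            (mean_tailBound_le hH i Φ ⟨j, hj'⟩ b (by norm_num))
            (mean_tailBound_le hH i Φ ⟨j, hj'⟩ b (by norm_num))
      _ = _ := by rw [Fintype.sum_bool]; ring
  calc _ ≤ ∑ ω : Record K G, recordProb H ω * (8 * Real.pi * (1 / 2 ^ G + ∑ j ∈ Finset.range G,
      (1 / 2 ^ j) * if GoodPhase (phaseOf ω i Φ) v j then 0 else 1)) :=
        Finset.sum_le_sum fun ω _ => mul_le_mul_of_nonneg_left (vHat_error_le ω i Φ m1 m2) (hP ω)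
    _ = 8 * Real.pi * (1 / 2 ^ G * ∑ ω : Record K G, recordProb H ω +
        ∑ j ∈ Finset.range G, (1 / 2 ^ j) * ∑ ω : Record K G, recordProb H ω *
          if GoodPhase (phaseOf ω i Φ) v j then 0 else 1) := by
        simp only [Finset.mul_sum]
        rw [Finset.sum_comm, ← Finset.sum_add_distrib, Finset.mul_sum]
        refine Finset.sum_congr rfl fun ω _ => ?_
        rw [mul_add, mul_add, mul_add, Finset.mul_sum, Finset.mul_sum, Finset.mul_sum]
        congr 1
        · ring
        · exact Finset.sum_congr rfl fun j _ => by ring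
    _ ≤ 8 * Real.pi * (1 / 2 ^ G * 1 + ∑ j ∈ Finset.range G,
        (1 / 2 ^ j) * (1 / 16 * (1 / 4) ^ (G - 1 - j))) := by
        rw [sum_recordProb]
        gcongr with j hj
        exact hbad j hj
    _ = 8 * Real.pi * (1 / 2 ^ G + 1 / 16 * ∑ j ∈ Finset.range G,
        (1 / 2 ^ j) * (1 / 4) ^ (G - 1 - j)) := by
        rw [mul_one, Finset.mul_sum]
        congr 2
        exact Finset.sum_congr rfl fun j _ => by ring
    _ ≤ 8 * Real.pi * (1 / 2 ^ G + 1 / 16 * (4 / 2 ^ G)) := by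
        gcongr; exact geometric_sum_le G
    _ = _ := by ring

theorem mean_zHat_error_le {H : Op n} (hH : H.IsHermitian) (h1 : ‖traceless H‖ ≤ 1)
    (i : Fin K) : ∑ ω : Record K G, recordProb H ω * ‖zHat ω i - zTrue H ((i : ℕ) + 1 : ℕ)‖
      ≤ 10 / 2 ^ G := by
  have hpi := Real.pi_pos
  have e : Complex.exp (Complex.I * ((Real.pi / 2 : ℝ) : ℂ)) = Complex.I := by
    push_cast; rw [mul_comm, Complex.exp_pi_div_two_mul_I]
  have key : ∀ ω : Record K G, ‖zHat ω i - zTrue H ((i : ℕ) + 1 : ℕ)‖ ≤ 1 / (2 * Real.pi) *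
      (|vHat ω i false - vTrue H ((i : ℕ) + 1) (angle false)| +
        |vHat ω i true - vTrue H ((i : ℕ) + 1) (angle true)|) := by
    intro ω
    refine (Complex.norm_le_abs_re_add_abs_im _).trans_eq ?_
    have hre : (zHat ω i - zTrue H ((i : ℕ) + 1 : ℕ)).re
        = 1 / (2 * Real.pi) * (vHat ω i false - vTrue H ((i : ℕ) + 1) (angle false)) := by
      simp only [angle, Bool.false_eq_true, if_false, vTrue, Complex.ofReal_zero, mul_zero,
        Complex.exp_zero, one_mul, zHat, Complex.sub_re]
      field_simp
    have him : (zHat ω i - zTrue H ((i : ℕ) + 1 : ℕ)).im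
        = -(1 / (2 * Real.pi) * (vHat ω i true - vTrue H ((i : ℕ) + 1) (angle true))) := by
      simp only [angle, if_true, vTrue, e, Complex.I_mul_re, zHat, Complex.sub_im]
      field_simp
      ring
    rw [hre, him, abs_neg, abs_mul, abs_mul, abs_of_pos (by positivity : 0 < 1 / (2 * Real.pi))]
    ring
  calc _ ≤ ∑ ω : Record K G, recordProb H ω * (1 / (2 * Real.pi) *
      (|vHat ω i false - vTrue H ((i : ℕ) + 1) (angle false)| +
        |vHat ω i true - vTrue H ((i : ℕ) + 1) (angle true)|)) :=
        Finset.sum_le_sum fun ω _ => mul_le_mul_of_nonneg_left (key ω) (recordProb_nonneg hH ω)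
    _ = 1 / (2 * Real.pi) * (∑ ω : Record K G, recordProb H ω *
      |vHat ω i false - vTrue H ((i : ℕ) + 1) (angle false)| + ∑ ω : Record K G, recordProb H ω *
        |vHat ω i true - vTrue H ((i : ℕ) + 1) (angle true)|) := by
        rw [← Finset.sum_add_distrib, Finset.mul_sum]
        exact Finset.sum_congr rfl fun ω _ => by ring
    _ ≤ 1 / (2 * Real.pi) * (10 * Real.pi / 2 ^ G + 10 * Real.pi / 2 ^ G) := by
        gcongr
        · exact mean_vHat_error_le hH h1 i false
        · exact mean_vHat_error_le hH h1 i true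
    _ = _ := by field_simp; norm_num

/-- For k = 0 the estimate is exact; elsewhere the factor |k| ≥ 1 only weakens the bound. It is
inserted to match the sum ∑|c̃_k||k| in `paramError`. -/
theorem mean_zEst_error_le {H : Op n} (hH : H.IsHermitian) (h1 : ‖traceless H‖ ≤ 1) {k : ℤ}
    (hk : k ∈ Finset.Icc (-(K : ℤ)) K) : ∑ ω : Record K G, recordProb H ω * ‖zEst ω k - zTrue H k‖
      ≤ 10 / 2 ^ G * |(k : ℝ)| := by
  have pos : ∀ k : ℤ, 0 < k → k ≤ K → ∑ ω : Record K G, recordProb H ω * ‖zEst ω k - zTrue H k‖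
      ≤ 10 / 2 ^ G * |(k : ℝ)| := by
    intro k hk0 hkK
    obtain ⟨l, rfl⟩ : ∃ l : ℕ, k = ((l + 1 : ℕ) : ℤ) := ⟨(k - 1).toNat, by omega⟩
    have := mean_zHat_error_le (K := K) (G := G) hH h1 ⟨l, by omega⟩
    have hz : ∀ ω : Record K G, zEst ω ((l + 1 : ℕ) : ℤ) = zHat ω ⟨l, by omega⟩ :=
      fun ω => zEst_natCast_succ ω ⟨l, by omega⟩
    simp only [hz]
    refine this.trans ?_
    refine le_mul_of_one_le_right (by positivity) ?_
    rw [Int.cast_natCast, Nat.abs_cast]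
    push_cast
    linarith [(Nat.cast_nonneg l : (0 : ℝ) ≤ l)]
  rw [Finset.mem_Icc] at hk
  rcases lt_trichotomy k 0 with h | rfl | h
  · have := pos (-k) (by omega) (by omega)
    simp only [norm_zEst_sub_zTrue_neg hH] at this
    simpa using this
  · simp [zEst_zero, zTrue_zero]
  · exact pos k h hk.2

/-- The contribution of the estimated parameters to the mean error. -/
theorem mean_param_error_le {H : Op n} (hH : H.IsHermitian) (h1 : ‖traceless H‖ ≤ 1)
    {f : ℝ → ℝ} {t ε : ℝ} (ht : 0 < t) (hε : 0 < ε)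
    (hs : Summable fun k : ℤ => ‖coeff f k‖ * |(k : ℝ)|) :
    ∑ ω : Record K (numGen f t ε), recordProb H ω * (4 * t *
      ∑ k ∈ Finset.Icc (-(K : ℤ)) K, ‖coeff f k‖ * ‖zEst ω k - zTrue H k‖) ≤ ε / 5 := by
  set G := numGen f t ε with hG
  set D := ∑' k : ℤ, ‖coeff f k‖ * |(k : ℝ)| with hD
  have hnn : ∀ k : ℤ, 0 ≤ ‖coeff f k‖ * |(k : ℝ)| := fun k => by positivity
  have hDS : ∑ k ∈ Finset.Icc (-(K : ℤ)) K, ‖coeff f k‖ * |(k : ℝ)| ≤ D :=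
    hs.sum_le_tsum _ fun k _ => hnn k
  have hD0 : 0 ≤ D := tsum_nonneg hnn
  have step : ∑ ω : Record K G, recordProb H ω * (4 * t *
      ∑ k ∈ Finset.Icc (-(K : ℤ)) K, ‖coeff f k‖ * ‖zEst ω k - zTrue H k‖)
      ≤ 40 * t * D / 2 ^ G := by
    calc _ = 4 * t * ∑ k ∈ Finset.Icc (-(K : ℤ)) K, ‖coeff f k‖ *
          ∑ ω : Record K G, recordProb H ω * ‖zEst ω k - zTrue H k‖ := by
          simp only [Finset.mul_sum]
          rw [Finset.sum_comm]
          exact Finset.sum_congr rfl fun k _ => Finset.sum_congr rfl fun ω _ => by ring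
      _ ≤ 4 * t * ∑ k ∈ Finset.Icc (-(K : ℤ)) K, ‖coeff f k‖ * (10 / 2 ^ G * |(k : ℝ)|) := by
          gcongr with k hk
          exact mean_zEst_error_le hH h1 hk
      _ = 40 * t / 2 ^ G * ∑ k ∈ Finset.Icc (-(K : ℤ)) K, ‖coeff f k‖ * |(k : ℝ)| := by
          simp only [Finset.mul_sum]
          exact Finset.sum_congr rfl fun k _ => by ring
      _ ≤ 40 * t / 2 ^ G * D := by gcongr
      _ = _ := by ring
  refine step.trans ?_
  -- If ∑|c̃_k||k| = 0, `paramError` divides by zero and the number of generations carries no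
  -- information, but the error is zero anyway.
  rcases hD0.eq_or_lt with h0 | h0
  · rw [← h0]; simp; positivity
  have hpi := Real.pi_gt_d2
  set s := paramError f ε / (√2 * t) with hs'
  have h3 : (0 : ℝ) < √3 := by positivity
  have hs0 : 0 < s := by
    rw [hs', paramError, ← hD]; positivity
  have h2G : 3 * Real.pi / s ≤ 2 ^ G := by
    have h4 : Real.logb 2 (3 * Real.pi / s) ≤ (G : ℝ) := by
      rw [hG, numGen, generations, ← hs']
      push_cast
      exact (Nat.le_ceil _).trans (le_max_right _ _)
    rw [Real.logb_le_iff_le_rpow (by norm_num) (by positivity), Real.rpow_natCast] at h4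
    exact h4
  have h5 : 40 * t * D / 2 ^ G ≤ 40 * t * D / (3 * Real.pi / s) := by gcongr
  refine h5.trans ?_
  have h6 : 40 * t * D / (3 * Real.pi / s) = (40 * √3 / (36 * √2 * Real.pi ^ 2)) * ε := by
    rw [hs', paramError, ← hD]
    field_simp
    norm_num
  have h7 : √3 ≤ 1.7321 := Real.sqrt_le_iff.2 ⟨by norm_num, by norm_num⟩
  have h8 : (1.4142 : ℝ) ≤ √2 := Real.le_sqrt_of_sq_le (by norm_num)
  -- The left side is about 0.138.
  have h9 : 40 * √3 / (36 * √2 * Real.pi ^ 2) ≤ 1 / 5 := by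
    rw [div_le_iff₀ (by positivity)]
    have : (9.8 : ℝ) ≤ Real.pi ^ 2 := by nlinarith
    nlinarith [mul_le_mul h8 this (by norm_num) (by positivity)]
  rw [h6]
  nlinarith

end Expectation
end UHET

end

noncomputable section

namespace UHET

/-! ### Trace norm and error of the algorithm -/

section TraceNorm

open scoped Matrix.Norms.L2Operator

section General

variable {m : Type} [Fintype m] [DecidableEq m]

theorem trace_cfc {A : Matrix m m ℂ} (hA : A.IsHermitian) (f : ℝ → ℝ) :
    (cfc f A).trace = ((∑ i, f (hA.eigenvalues i) : ℝ) : ℂ) := by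
  rw [hA.cfc_eq, Matrix.IsHermitian.cfc, Unitary.conjStarAlgAut_apply, Matrix.trace_mul_cycle,
    Unitary.coe_star_mul_self, one_mul, Matrix.trace_diagonal]
  push_cast
  rfl

/-- The spectrum is finite, so discontinuous functions such as the sign are admitted in the
functional calculus. -/
theorem continuousOn_real_spectrum (A : Matrix m m ℂ) (f : ℝ → ℝ) :
    ContinuousOn f (spectrum ℝ A) :=
  A.finite_real_spectrum.continuousOn f

/-- The trace norm of a Hermitian matrix is attained in the pairing with its sign. -/
theorem exists_trace_mul_eq_traceNorm {A : Matrix m m ℂ} (hA : A.IsHermitian) :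
    ∃ B : Matrix m m ℂ, IsSelfAdjoint B ∧ ‖B‖ ≤ 1 ∧ (B * A).trace = (traceNorm A : ℂ) := by
  have hA' : IsSelfAdjoint A := hA
  refine ⟨cfc (fun x : ℝ => SignType.sign x : ℝ → ℝ) A, cfc_predicate _ _, ?_, ?_⟩
  · refine norm_cfc_le zero_le_one fun x _ => ?_
    rcases lt_trichotomy x 0 with h | rfl | h
    · simp [sign_neg h]
    · simp
    · simp [sign_pos h]
  · have e1 : cfc (fun x : ℝ => SignType.sign x : ℝ → ℝ) A * A = cfc (fun x : ℝ => |x|) A := by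
      conv_lhs => rw [← cfc_id' ℝ A]
      rw [cfc_id' ℝ A]
      conv_lhs => rhs; rw [← cfc_id' ℝ A]
      rw [← cfc_mul _ _ A (continuousOn_real_spectrum _ _) (continuousOn_real_spectrum _ _)]
      congr 1
      funext x
      rcases lt_trichotomy x 0 with h | rfl | h
      · simp [sign_neg h, abs_of_neg h]
      · simp
      · simp [sign_pos h, abs_of_pos h]
    have e2 : Aᴴ * A = cfc (fun x : ℝ => x ^ 2) A := by
      rw [hA.eq, cfc_pow_id A 2, sq]
    have e3 : cfc Real.sqrt (Aᴴ * A) = cfc (fun x : ℝ => |x|) A := by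
      rw [e2, ← cfc_comp' Real.sqrt (fun x : ℝ => x ^ 2) A
        (Set.Finite.continuousOn (A.finite_real_spectrum.image _) _)
        (continuousOn_real_spectrum _ _)]
      congr 1
      funext x
      exact Real.sqrt_sq_eq_abs x
    rw [e1, ← e3, trace_cfc (Matrix.isHermitian_conjTranspose_mul_self A)]
    rfl

theorem star_dotProduct_mulVec_eq_inner (A : Matrix m m ℂ) (v w : m → ℂ) :
    star v ⬝ᵥ A *ᵥ w = inner ℂ (WithLp.toLp 2 v) (Matrix.toEuclideanCLM (𝕜 := ℂ) A (WithLp.toLp 2 w)) := by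
  rw [EuclideanSpace.inner_eq_star_dotProduct, Matrix.ofLp_toEuclideanCLM, dotProduct_comm]

theorem norm_toLp_sq {m : Type} [Fintype m] (v : m → ℂ) : ‖(WithLp.toLp 2 v : EuclideanSpace ℂ m)‖ ^ 2 = ∑ x, ‖v x‖ ^ 2 := by
  rw [EuclideanSpace.norm_sq_eq]

theorem norm_toLp_eq_one {m : Type} [Fintype m] {v : m → ℂ} (hv : ∑ x, ‖v x‖ ^ 2 = 1) :
    ‖(WithLp.toLp 2 v : EuclideanSpace ℂ m)‖ = 1 := by
  rw [← sq_eq_sq₀ (norm_nonneg _) zero_le_one, norm_toLp_sq, hv, one_pow]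

theorem star_dotProduct_self {m : Type} [Fintype m] (v : m → ℂ) :
    star v ⬝ᵥ v = ((∑ x, ‖v x‖ ^ 2 : ℝ) : ℂ) := by
  rw [Complex.ofReal_sum]
  refine Finset.sum_congr rfl fun x _ => ?_
  rw [Pi.star_apply, Complex.star_def, mul_comm, Complex.mul_conj, Complex.normSq_eq_norm_sq]

theorem norm_star_dotProduct_mulVec_le (A : Matrix m m ℂ) {v : m → ℂ} (hv : ∑ x, ‖v x‖ ^ 2 = 1) :
    ‖star v ⬝ᵥ A *ᵥ v‖ ≤ ‖A‖ := by
  have h1 := norm_toLp_eq_one hv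
  rw [star_dotProduct_mulVec_eq_inner]
  refine (norm_inner_le_norm _ _).trans ?_
  rw [h1, one_mul]
  refine (ContinuousLinearMap.le_opNorm _ _).trans ?_
  rw [h1, mul_one, ← Matrix.cstar_norm_def]

theorem sum_norm_sq_mulVec {U : Matrix m m ℂ} (hU : Uᴴ * U = 1) (v : m → ℂ) :
    ∑ x, ‖(U *ᵥ v) x‖ ^ 2 = ∑ x, ‖v x‖ ^ 2 := by
  have : ((∑ x, ‖(U *ᵥ v) x‖ ^ 2 : ℝ) : ℂ) = ((∑ x, ‖v x‖ ^ 2 : ℝ) : ℂ) := by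
    rw [← star_dotProduct_self, ← star_dotProduct_self, Matrix.star_mulVec, ← Matrix.dotProduct_mulVec, Matrix.mulVec_mulVec, hU,
      Matrix.one_mulVec]
  exact_mod_cast this

/-- Two unit vectors with real inner product `c` differ by at most `2√(1-c²)` in their expectations
of a symmetric contraction. -/
theorem sq_inner_sub_inner_le {E : Type*} [NormedAddCommGroup E] [InnerProductSpace ℂ E]
    (T : E →L[ℂ] E) (hT : ∀ x y, inner ℂ (T x) y = inner ℂ x (T y)) (hT1 : ‖T‖ ≤ 1) {u w : E}
    (hu : ‖u‖ = 1) (hw : ‖w‖ = 1) {c : ℝ} (hc : inner ℂ u w = (c : ℂ)) :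
    ((inner ℂ u (T u) - inner ℂ w (T w) : ℂ).re) ^ 2 ≤ 4 * (1 - c ^ 2) := by
  -- The mixed terms are conjugate by symmetry of T and drop out of the real part. What remains is
  -- bounded by ‖u - w‖‖u + w‖, whose square is (2 - 2c)(2 + 2c).
  have e1 : (inner ℂ u (T u) - inner ℂ w (T w) : ℂ).re = (inner ℂ (u - w) (T (u + w)) : ℂ).re := by
    rw [map_add, inner_sub_left, inner_add_right, inner_add_right]
    have : inner ℂ w (T u) = (starRingEnd ℂ) (inner ℂ u (T w)) := by
      rw [inner_conj_symm, hT]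
    simp only [Complex.sub_re, Complex.add_re, this, Complex.conj_re]
    ring
  have hre : (inner ℂ u w : ℂ).re = c := by rw [hc, Complex.ofReal_re]
  have e2 : ‖u - w‖ ^ 2 = 2 - 2 * c := by
    rw [norm_sub_sq (𝕜 := ℂ), hu, hw]
    change 1 ^ 2 - 2 * (inner ℂ u w : ℂ).re + 1 ^ 2 = _
    rw [hre]; ring
  have e3 : ‖u + w‖ ^ 2 = 2 + 2 * c := by
    rw [norm_add_sq (𝕜 := ℂ), hu, hw]
    change 1 ^ 2 + 2 * (inner ℂ u w : ℂ).re + 1 ^ 2 = _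
    rw [hre]; ring
  have h1 : |(inner ℂ (u - w) (T (u + w)) : ℂ).re| ≤ ‖u - w‖ * ‖u + w‖ := by
    refine (Complex.abs_re_le_norm _).trans ((norm_inner_le_norm _ _).trans ?_)
    gcongr
    exact (T.le_opNorm _).trans (mul_le_of_le_one_left (norm_nonneg _) hT1)
  rw [e1, ← sq_abs]
  calc _ ≤ (‖u - w‖ * ‖u + w‖) ^ 2 := by gcongr
    _ = _ := by rw [mul_pow, e2, e3]; ring

end General

/-! ### Channels on pure states with a reference system. -/

variable {n d : ℕ}

/-- Vectors of the control qubit, the system and the reference system. -/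
abbrev FullVec (n d : ℕ) : Type := (Fin 2 × Qubits n) × Fin d → ℂ

/-- Observables of system and reference system, regarded as observables of everything. -/
def obsHom (n d : ℕ) : Matrix (Qubits n × Fin d) (Qubits n × Fin d) ℂ →⋆ₐ[ℂ]
    Matrix ((Fin 2 × Qubits n) × Fin d) ((Fin 2 × Qubits n) × Fin d) ℂ where
  toFun B := (sysHom (Fin 2) (Qubits n × Fin d) B).submatrix (Equiv.prodAssoc _ _ _)
    (Equiv.prodAssoc _ _ _)
  map_one' := by rw [map_one, Matrix.submatrix_one_equiv]
  map_mul' X Y := by rw [map_mul, Matrix.submatrix_mul_equiv]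
  map_zero' := by rw [map_zero]; rfl
  map_add' X Y := by rw [map_add]; rfl
  commutes' r := by
    rw [AlgHomClass.commutes, Algebra.algebraMap_eq_smul_one, Algebra.algebraMap_eq_smul_one]
    rw [← Matrix.submatrix_one_equiv (Equiv.prodAssoc (Fin 2) (Qubits n) (Fin d))]
    rfl
  map_star' X := by
    rw [map_star]; rfl

/-- The reduced state of system and reference system. -/
def reduced (φ : FullVec n d) : Matrix (Qubits n × Fin d) (Qubits n × Fin d) ℂ :=
  Matrix.of fun p q => ∑ s, φ ((s, p.1), p.2) * star (φ ((s, q.1), q.2))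

/-- `|+⟩ ⊗ ψ`. -/
def inVec (ψ : Qubits n × Fin d → ℂ) : FullVec n d := fun p => ψ (p.1.2, p.2) / (√2 : ℝ)

theorem sqrt_two_mul_sqrt_two : ((√2 : ℝ) : ℂ) * ((√2 : ℝ) : ℂ) = 2 := by
  rw [← Complex.ofReal_mul, Real.mul_self_sqrt (by norm_num)]; norm_num

theorem sum_norm_sq_inVec (ψ : Qubits n × Fin d → ℂ) :
    ∑ p, ‖inVec ψ p‖ ^ 2 = ∑ x, ‖ψ x‖ ^ 2 := by
  have h : ∀ z : ℂ, ‖z / ((√2 : ℝ) : ℂ)‖ ^ 2 = ‖z‖ ^ 2 / 2 := by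
    intro z
    rw [norm_div, div_pow, Complex.norm_real, Real.norm_eq_abs, sq_abs, Real.sq_sqrt (by norm_num)]
  simp only [inVec, h, Fintype.sum_prod_type, Fin.sum_univ_two]
  rw [← Finset.sum_add_distrib]
  refine Finset.sum_congr rfl fun x _ => ?_
  rw [← Finset.sum_add_distrib]
  exact Finset.sum_congr rfl fun a _ => by ring

theorem ampHom_mulVec_apply {m k : Type} [Fintype m] [DecidableEq m] [Fintype k] [DecidableEq k]
    (U : Matrix m m ℂ) (v : m × k → ℂ) (p : m × k) :
    (ampHom m k U *ᵥ v) p = (U *ᵥ fun x => v (x, p.2)) p.1 := by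
  obtain ⟨x, a⟩ := p
  change ((U ⊗ₖ (1 : Matrix k k ℂ)) *ᵥ v) (x, a) = _
  simp only [Matrix.mulVec, dotProduct, Fintype.sum_prod_type, Matrix.kronecker_apply,
    Matrix.one_apply, mul_ite, mul_one, mul_zero, ite_mul, zero_mul, Finset.sum_ite_eq,
    Finset.mem_univ, if_true]

theorem conj_vecMulVec {m : Type} [Fintype m] (U : Matrix m m ℂ) (v w : m → ℂ) :
    U * Matrix.vecMulVec v (star w) * Uᴴ = Matrix.vecMulVec (U *ᵥ v) (star (U *ᵥ w)) := by
  rw [Matrix.mul_vecMulVec, Matrix.vecMulVec_mul, Matrix.star_mulVec]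

/-- With a pure input, running the circuit and discarding the control qubit is the partial trace of
one vector state, so both channels become unitaries acting on |+⟩ ⊗ ψ. -/
theorem ampliate_control (U : OpC n) (ψ : Qubits n × Fin d → ℂ) :
    ampliate (fun ρ => traceControl (U * (plusState ⊗ₖ ρ) * Uᴴ)) (pureState ψ)
      = reduced (ampHom _ (Fin d) U *ᵥ inVec ψ) := by
  ext p q
  have e : plusState ⊗ₖ (Matrix.of fun x y => pureState ψ (x, p.2) (y, q.2))
      = Matrix.vecMulVec (fun z : Fin 2 × Qubits n => inVec ψ (z, p.2))
        (star fun z : Fin 2 × Qubits n => inVec ψ (z, q.2)) := by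
    ext ⟨s, x⟩ ⟨s', y⟩
    have hP : plusState s s' = 1 / 2 := by
      fin_cases s <;> fin_cases s' <;> simp [plusState]
    simp only [Matrix.kronecker_apply, hP, pureState, Matrix.vecMulVec_apply, Matrix.of_apply,
      Pi.star_apply, inVec, star_div₀]
    have : star ((√2 : ℝ) : ℂ) = ((√2 : ℝ) : ℂ) := by simp
    rw [this, div_mul_div_comm, sqrt_two_mul_sqrt_two]
    ring
  simp only [ampliate, Matrix.of_apply]
  rw [e, conj_vecMulVec]
  simp only [traceControl, Matrix.of_apply, Matrix.vecMulVec_apply, Pi.star_apply, reduced,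
    ampHom_mulVec_apply]

theorem ampliate_conj (V : Op n) (ψ : Qubits n × Fin d → ℂ) :
    ampliate (fun ρ => V * ρ * Vᴴ) (pureState ψ) = pureState (ampHom _ (Fin d) V *ᵥ ψ) := by
  ext p q
  have e : (Matrix.of fun x y => pureState ψ (x, p.2) (y, q.2))
      = Matrix.vecMulVec (fun x : Qubits n => ψ (x, p.2)) (star fun x : Qubits n => ψ (x, q.2)) := rfl
  simp only [ampliate, Matrix.of_apply]
  rw [e, conj_vecMulVec]
  simp only [pureState, Matrix.vecMulVec_apply, Pi.star_apply, ampHom_mulVec_apply]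

/-- For self-adjoint F the off-diagonal matrix `od F` is X ⊗ F, and X|+⟩ = |+⟩. The control qubit
stays in |+⟩ and the system evolves under F. -/
theorem idealOp_eq_control (f : ℝ → ℝ) (H : Op n) (t : ℝ) (ρ : Op n) : idealOp f H t ρ =
    traceControl (uexp (od (cfc f (traceless H))) t * (plusState ⊗ₖ ρ) *
      (uexp (od (cfc f (traceless H))) t)ᴴ) := by
  set F := cfc f (traceless H) with hF
  have hFs : Fᴴ = F := (cfc_predicate f (traceless H) : IsSelfAdjoint F)
  set q : OpC n := plusState ⊗ₖ 1 with hq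
  have hPX : ((Matrix.single 0 1 1 + Matrix.single 1 0 1) : Matrix (Fin 2) (Fin 2) ℂ) * plusState
      = plusState := by
    ext i j; fin_cases i <;> fin_cases j <;> simp [plusState, Matrix.mul_apply, Matrix.single]
  have hPP : plusState * plusState = plusState := measured_mul_self true
  have hPh : plusStateᴴ = plusState := measured_isHermitian true
  have hqh : qᴴ = q := by
    rw [hq, Matrix.conjTranspose_kronecker, hPh, Matrix.conjTranspose_one]
  have e1 : od F * q = q * sysHom (Fin 2) (Qubits n) F := by
    change od F * q = q * ((1 : Matrix (Fin 2) (Fin 2) ℂ) ⊗ₖ F)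
    rw [od, hFs, ← Matrix.add_kronecker, hq, ← Matrix.mul_kronecker_mul, ← Matrix.mul_kronecker_mul,
      hPX, mul_one, one_mul, mul_one]
  have e2 := uexp_mul_of_mul_eq e1 t
  rw [← map_uexp] at e2
  have e3 : plusState ⊗ₖ ρ = q * sysHom (Fin 2) (Qubits n) ρ * qᴴ := by
    change _ = q * ((1 : Matrix (Fin 2) (Fin 2) ℂ) ⊗ₖ ρ) * qᴴ
    rw [hqh, hq, ← Matrix.mul_kronecker_mul, ← Matrix.mul_kronecker_mul]
    simp [hPP]
  have e4 : uexp (od F) t * (plusState ⊗ₖ ρ) * (uexp (od F) t)ᴴ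
      = plusState ⊗ₖ (uexp F t * ρ * (uexp F t)ᴴ) := by
    calc _ = (uexp (od F) t * q) * sysHom (Fin 2) (Qubits n) ρ * (uexp (od F) t * q)ᴴ := by
          rw [e3, Matrix.conjTranspose_mul]; noncomm_ring
      _ = plusState ⊗ₖ (uexp F t * ρ * (uexp F t)ᴴ) := by
          rw [e2, Matrix.conjTranspose_mul, hqh]
          change plusState ⊗ₖ 1 * ((1 : Matrix (Fin 2) (Fin 2) ℂ) ⊗ₖ uexp F t) *
            ((1 : Matrix (Fin 2) (Fin 2) ℂ) ⊗ₖ ρ) *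
            (((1 : Matrix (Fin 2) (Fin 2) ℂ) ⊗ₖ uexp F t)ᴴ * plusState ⊗ₖ 1) = _
          rw [Matrix.conjTranspose_kronecker]
          simp only [← Matrix.mul_kronecker_mul, Matrix.conjTranspose_one, one_mul, mul_one, hPP]
  rw [e4]
  ext x y
  simp [traceControl, plusState]
  change (uexp F t * ρ * (uexp F t)ᴴ) x y = _
  ring

theorem trace_mul_reduced (B : Matrix (Qubits n × Fin d) (Qubits n × Fin d) ℂ) (φ : FullVec n d) :
    (B * reduced φ).trace = star φ ⬝ᵥ obsHom n d B *ᵥ φ := by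
  have h : ∀ p q : (Fin 2 × Qubits n) × Fin d, obsHom n d B p q
      = if p.1.1 = q.1.1 then B (p.1.2, p.2) (q.1.2, q.2) else 0 := by
    intro p q
    change ((1 : Matrix (Fin 2) (Fin 2) ℂ) ⊗ₖ B) _ _ = _
    simp [Matrix.one_apply]
  simp only [Matrix.trace, Matrix.diag_apply, Matrix.mul_apply, reduced, Matrix.of_apply, dotProduct,
    Matrix.mulVec, h, Pi.star_apply, Finset.mul_sum, ite_mul, zero_mul, mul_ite, mul_zero]
  simp only [Fintype.sum_prod_type, Fin.sum_univ_two]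
  simp only [Fin.isValue, if_true, zero_ne_one, one_ne_zero, if_false, Finset.sum_const_zero,
    add_zero, zero_add, Finset.sum_add_distrib]
  congr 1 <;>
  · refine Finset.sum_congr rfl fun x _ => Finset.sum_congr rfl fun a _ =>
      Finset.sum_congr rfl fun y _ => Finset.sum_congr rfl fun b _ => by ring

theorem isHermitian_reduced (φ : FullVec n d) : (reduced φ).IsHermitian := by
  ext p q
  simp only [reduced, Matrix.conjTranspose_apply, Matrix.of_apply, star_sum, star_mul', star_star]
  exact Finset.sum_congr rfl fun s _ => mul_comm _ _

theorem isHermitian_pureState {m : Type} (ψ : m → ℂ) : (pureState ψ).IsHermitian := by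
  ext p q
  simp [pureState, Matrix.vecMulVec_apply, mul_comm]

end TraceNorm
end UHET

end

noncomputable section

namespace UHET

/-! ### Error and mean squared error -/

section ErrorBounds

open scoped Matrix.Norms.L2Operator

variable {n d K : ℕ}

theorem mainProb_nonneg {G : ℕ} {f : ℝ → ℝ} {t ε : ℝ} {ω : Record K G} (s : MainIndex n f t ε ω) :
    0 ≤ mainProb s :=
  Finset.prod_nonneg fun m _ => stepProb_nonneg f ω (s m)

theorem sum_mainProb {G : ℕ} (f : ℝ → ℝ) (t ε : ℝ) (ω : Record K G) :
    ∑ s : MainIndex n f t ε ω, mainProb s = 1 := by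
  -- For β = 0 there are no iterations; the empty tuple has weight 1 although the single-step
  -- weights do not sum to 1.
  by_cases hβ : beta f ω = 0
  · have hN : mainN f t ε ω = 0 := by simp [mainN, iterations, hβ]
    have : IsEmpty (Fin (mainN f t ε ω)) := by rw [hN]; infer_instance
    simp [mainProb]
  · exact sum_prod_weights _ (sum_stepProb f ω hβ) _

theorem indexProb_nonneg {H : Op n} (hH : H.IsHermitian) {f : ℝ → ℝ} {t ε : ℝ}
    (j : Index n f t ε K) : 0 ≤ indexProb H j :=
  mul_nonneg (recordProb_nonneg hH _) (mainProb_nonneg _)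

theorem sum_indexProb (H : Op n) (f : ℝ → ℝ) (t ε : ℝ) :
    ∑ j : Index n f t ε K, indexProb H j = 1 := by
  rw [Fintype.sum_sigma]
  simp only [indexProb, ← Finset.mul_sum, sum_mainProb, mul_one, sum_recordProb]

/-- The error of the algorithm in the Heisenberg picture. -/
theorem norm_sum_index_sub_le {A : Type*} [CStarAlgebra A] (ι : OpC n →⋆ₐ[ℂ] A) {f : ℝ → ℝ}
    {t ε : ℝ} (ht : 0 < t) (hε : 0 < ε) {H : Op n} (hH : H.IsHermitian) (h1 : ‖traceless H‖ ≤ 1)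
    (hs : Summable fun k : ℤ => ‖coeff f k‖ * |(k : ℝ)|) (hK : IsCutoff f t ε K) (B : A) :
    ‖∑ j : Index n f t ε K, (indexProb H j : ℂ) • (star (ι (Circuit.matrix H (mainCircuit j.2))) * B *
        ι (Circuit.matrix H (mainCircuit j.2)))
      - star (ι (uexp (od (cfc f (traceless H))) t)) * B * ι (uexp (od (cfc f (traceless H))) t)‖
    ≤ ε * ‖B‖ := by
  set X := star (ι (uexp (od (cfc f (traceless H))) t)) * B * ι (uexp (od (cfc f (traceless H))) t)
  have hsum : (∑ ω : Record K (numGen f t ε), (recordProb H ω : ℂ)) = 1 := by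
    rw [← Complex.ofReal_sum, sum_recordProb, Complex.ofReal_one]
  have e : ∑ j : Index n f t ε K, (indexProb H j : ℂ) •
        (star (ι (Circuit.matrix H (mainCircuit j.2))) * B *
          ι (Circuit.matrix H (mainCircuit j.2))) - X
      = ∑ ω : Record K (numGen f t ε), (recordProb H ω : ℂ) •
        (∑ s : MainIndex n f t ε ω, (mainProb s : ℂ) •
          (star (ι (Circuit.matrix H (mainCircuit s))) * B * ι (Circuit.matrix H (mainCircuit s)))
          - X) := by
    rw [Fintype.sum_sigma]
    simp only [smul_sub, Finset.sum_sub_distrib, ← Finset.sum_smul, hsum, one_smul, Finset.smul_sum,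
      smul_smul]
    simp only [indexProb, Complex.ofReal_mul]
  rw [e]
  calc _ ≤ ∑ ω : Record K (numGen f t ε), recordProb H ω *
        ((ε / 5 + 2 * t * (ε / (6 * t) + 2 * ∑ k ∈ Finset.Icc (-(K : ℤ)) K,
          ‖coeff f k‖ * ‖zEst ω k - zTrue H k‖)) * ‖B‖) := by
        refine norm_sum_le_of_le _ fun ω _ => ?_
        rw [norm_smul, Complex.norm_real, Real.norm_of_nonneg (recordProb_nonneg hH ω)]
        exact mul_le_mul_of_nonneg_left (norm_main_sub_le ι ht hε hH h1 hK ω B)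
          (recordProb_nonneg hH ω)
    _ = (∑ ω : Record K (numGen f t ε), recordProb H ω * (ε / 5 + ε / 3) +
        ∑ ω : Record K (numGen f t ε), recordProb H ω * (4 * t *
          ∑ k ∈ Finset.Icc (-(K : ℤ)) K, ‖coeff f k‖ * ‖zEst ω k - zTrue H k‖)) * ‖B‖ := by
        rw [← Finset.sum_add_distrib, Finset.sum_mul]
        refine Finset.sum_congr rfl fun ω _ => ?_
        field_simp
        ring
    -- Random product, truncation and parameter estimation, together 11ε/15.
    _ ≤ (ε / 5 + ε / 3 + ε / 5) * ‖B‖ := by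
        rw [← Finset.sum_mul, sum_recordProb, one_mul]
        gcongr
        exact mean_param_error_le hH h1 ht hε hs
    _ ≤ ε * ‖B‖ := by gcongr; linarith

theorem trace_mul_reduced_mulVec (B : Matrix (Qubits n × Fin d) (Qubits n × Fin d) ℂ) (U : OpC n)
    (v : FullVec n d) : (B * reduced (ampHom _ (Fin d) U *ᵥ v)).trace
      = star v ⬝ᵥ (star (ampHom _ (Fin d) U) * obsHom n d B * ampHom _ (Fin d) U) *ᵥ v := by
  generalize ampHom _ (Fin d) U = V
  rw [trace_mul_reduced, Matrix.star_mulVec, ← Matrix.dotProduct_mulVec, Matrix.mulVec_mulVec,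
    Matrix.mulVec_mulVec, Matrix.star_eq_conjTranspose]

theorem ampliate_runOp (H : Op n) {f : ℝ → ℝ} {t ε : ℝ} (j : Index n f t ε K)
    (ψ : Qubits n × Fin d → ℂ) : ampliate (runOp H j) (pureState ψ)
      = reduced (ampHom _ (Fin d) (Circuit.matrix H (mainCircuit j.2)) *ᵥ inVec ψ) :=
  ampliate_control _ ψ

theorem ampliate_idealOp (f : ℝ → ℝ) (H : Op n) (t : ℝ) (ψ : Qubits n × Fin d → ℂ) :
    ampliate (idealOp f H t) (pureState ψ)
      = reduced (ampHom _ (Fin d) (uexp (od (cfc f (traceless H))) t) *ᵥ inVec ψ) := by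
  rw [← ampliate_control]
  congr 1
  funext ρ
  exact idealOp_eq_control f H t ρ

/-- The error tested on an arbitrary observable. It is used twice: with the sign of the difference
for the trace norm, and with a reflection for the fidelity. -/
theorem norm_trace_mul_sub_le {f : ℝ → ℝ} {t ε : ℝ} (ht : 0 < t) (hε : 0 < ε) {H : Op n}
    (hH : H.IsHermitian) (h1 : ‖traceless H‖ ≤ 1)
    (hs : Summable fun k : ℤ => ‖coeff f k‖ * |(k : ℝ)|) (hK : IsCutoff f t ε K)
    {ψ : Qubits n × Fin d → ℂ} (hψ : ∑ x, ‖ψ x‖ ^ 2 = 1)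
    (B : Matrix (Qubits n × Fin d) (Qubits n × Fin d) ℂ) :
    ‖(B * (ampliate (idealOp f H t) (pureState ψ) - ∑ j : Index n f t ε K,
        (indexProb H j : ℂ) • ampliate (runOp H j) (pureState ψ))).trace‖ ≤ ε * ‖B‖ := by
  have e : (B * (ampliate (idealOp f H t) (pureState ψ) - ∑ j : Index n f t ε K,
        (indexProb H j : ℂ) • ampliate (runOp H j) (pureState ψ))).trace
      = -(star (inVec ψ) ⬝ᵥ (∑ j : Index n f t ε K, (indexProb H j : ℂ) •
        (star (ampHom _ (Fin d) (Circuit.matrix H (mainCircuit j.2))) * obsHom n d B *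
          ampHom _ (Fin d) (Circuit.matrix H (mainCircuit j.2)))
      - star (ampHom _ (Fin d) (uexp (od (cfc f (traceless H))) t)) * obsHom n d B *
        ampHom _ (Fin d) (uexp (od (cfc f (traceless H))) t)) *ᵥ inVec ψ) := by
    rw [Matrix.sub_mulVec, dotProduct_sub, neg_sub, ampliate_idealOp, mul_sub, Matrix.trace_sub,
      trace_mul_reduced_mulVec, Finset.mul_sum, Matrix.trace_sum, Matrix.sum_mulVec, dotProduct_sum]
    congr 1
    refine Finset.sum_congr rfl fun j _ => ?_
    rw [ampliate_runOp, Matrix.mul_smul, Matrix.trace_smul, trace_mul_reduced_mulVec,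
      Matrix.smul_mulVec, dotProduct_smul]
  rw [e, norm_neg]
  refine (norm_star_dotProduct_mulVec_le _ ((sum_norm_sq_inVec ψ).trans hψ)).trans ?_
  refine (norm_sum_index_sub_le (ampHom _ (Fin d)) ht hε hH h1 hs hK (obsHom n d B)).trans ?_
  gcongr
  exact NonUnitalStarAlgHom.norm_apply_le (obsHom n d) B

theorem traceNorm_sub_le {f : ℝ → ℝ} {t ε : ℝ} (ht : 0 < t) (hε : 0 < ε) {H : Op n}
    (hH : H.IsHermitian) (h1 : ‖traceless H‖ ≤ 1)
    (hs : Summable fun k : ℤ => ‖coeff f k‖ * |(k : ℝ)|) (hK : IsCutoff f t ε K)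
    {ψ : Qubits n × Fin d → ℂ} (hψ : ∑ x, ‖ψ x‖ ^ 2 = 1) :
    traceNorm (ampliate (idealOp f H t) (pureState ψ) - ∑ j : Index n f t ε K,
        (indexProb H j : ℂ) • ampliate (runOp H j) (pureState ψ)) ≤ ε := by
  have hΔ : (ampliate (idealOp f H t) (pureState ψ) - ∑ j : Index n f t ε K,
        (indexProb H j : ℂ) • ampliate (runOp H j) (pureState ψ)).IsHermitian := by
    refine Matrix.IsHermitian.sub ?_ ?_
    · rw [ampliate_idealOp]; exact isHermitian_reduced _
    · unfold Matrix.IsHermitian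
      rw [Matrix.conjTranspose_sum]
      refine Finset.sum_congr rfl fun j _ => ?_
      rw [Matrix.conjTranspose_smul, ampliate_runOp, (isHermitian_reduced _).eq]
      simp
  obtain ⟨B, -, hB, e⟩ := exists_trace_mul_eq_traceNorm hΔ
  have := norm_trace_mul_sub_le ht hε hH h1 hs hK hψ B
  rw [e, Complex.norm_real] at this
  exact (le_abs_self _).trans (this.trans (mul_le_of_le_one_right hε.le hB))

/-! #### Fidelity -/

/-- The unit vector attaining equality in Cauchy–Schwarz is c normalized; if c = 0, any unit vector
serves. -/
theorem exists_unit_phase {s : Type} [Fintype s] [DecidableEq s] [Nonempty s] (c : s → ℂ) :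
    ∃ e : s → ℂ, ∑ i, ‖e i‖ ^ 2 = 1 ∧ ∑ i, star (e i) * c i = (√(∑ i, ‖c i‖ ^ 2) : ℝ) := by
  set F := ∑ i, ‖c i‖ ^ 2 with hF
  have hF0 : 0 ≤ F := Finset.sum_nonneg fun i _ => by positivity
  rcases hF0.eq_or_lt with h | h
  · have hc : ∀ i, c i = 0 := fun i => by
      have := (Finset.sum_eq_zero_iff_of_nonneg (fun i _ => by positivity)).1 (hF.symm.trans h.symm) i
        (Finset.mem_univ i)
      simpa using this
    obtain ⟨i0⟩ := ‹Nonempty s›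
    refine ⟨Pi.single i0 1, ?_, ?_⟩
    · rw [Finset.sum_eq_single i0] <;> simp +contextual
    · simp [hc, ← h]
  · have hs : 0 < √F := Real.sqrt_pos.2 h
    refine ⟨fun i => c i / (√F : ℝ), ?_, ?_⟩
    · simp only [norm_div, div_pow, Complex.norm_real, Real.norm_eq_abs, sq_abs, Real.sq_sqrt hF0]
      rw [← Finset.sum_div, div_self h.ne']
    · have : ∀ i, star (c i / (√F : ℝ)) * c i = ((‖c i‖ ^ 2 / √F : ℝ) : ℂ) := by
        intro i
        rw [star_div₀, div_mul_eq_mul_div, mul_comm, Complex.star_def, Complex.mul_conj,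
          Complex.normSq_eq_norm_sq]
        simp
      simp only [this]
      rw [← Complex.ofReal_sum, ← Finset.sum_div, Real.div_sqrt]

/-- The overlap amplitudes of the state `φ` with the vector `χ`. -/
def overlap (χ : Qubits n × Fin d → ℂ) (φ : FullVec n d) (s : Fin 2) : ℂ :=
  ∑ p, star (χ p) * φ ((s, p.1), p.2)

theorem trace_pureState_mul_reduced (χ : Qubits n × Fin d → ℂ) (φ : FullVec n d) :
    (pureState χ * reduced φ).trace = ((∑ s, ‖overlap χ φ s‖ ^ 2 : ℝ) : ℂ) := by
  have h : reduced φ = ∑ s : Fin 2, Matrix.vecMulVec (fun p : Qubits n × Fin d => φ ((s, p.1), p.2))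
      (star fun p : Qubits n × Fin d => φ ((s, p.1), p.2)) := by
    ext p q
    rw [Matrix.sum_apply]
    rfl
  rw [h, Finset.mul_sum, Matrix.trace_sum, Complex.ofReal_sum]
  refine Finset.sum_congr rfl fun s _ => ?_
  rw [pureState, Matrix.vecMulVec_mul_vecMulVec, Matrix.trace_vecMulVec, dotProduct_smul]
  change (overlap χ φ s) • _ = _
  have : χ ⬝ᵥ (star fun p : Qubits n × Fin d => φ ((s, p.1), p.2)) = star (overlap χ φ s) := by
    simp only [overlap, dotProduct, star_sum, star_mul', star_star]
    rfl
  rw [this, smul_eq_mul, Complex.star_def, Complex.mul_conj, Complex.normSq_eq_norm_sq]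

/-- Trace distance and fidelity of a pure state and a mixed state. -/
theorem traceNorm_pureState_sub_sq_le {χ : Qubits n × Fin d → ℂ} (hχ : ∑ x, ‖χ x‖ ^ 2 = 1)
    {φ : FullVec n d} (hφ : ∑ x, ‖φ x‖ ^ 2 = 1) :
    traceNorm (pureState χ - reduced φ) ^ 2 ≤ 4 * (1 - ∑ s, ‖overlap χ φ s‖ ^ 2) := by
  obtain ⟨e, he1, he2⟩ := exists_unit_phase (overlap χ φ)
  -- This purification of χ has the control qubit aligned with the overlaps, so its inner product
  -- with φ is the real number √F, F being the fidelity. Trace distance and fidelity are then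
  -- compared for two vectors, as in Uhlmann's theorem.
  set u : FullVec n d := fun p => e p.1.1 * χ (p.1.2, p.2) with hu
  have he3 : ∑ s, e s * star (e s) = 1 := by
    simp only [Complex.star_def, Complex.mul_conj, Complex.normSq_eq_norm_sq]
    exact_mod_cast he1
  have hu1 : ∑ x, ‖u x‖ ^ 2 = 1 := by
    calc ∑ x, ‖u x‖ ^ 2 = ∑ s, ‖e s‖ ^ 2 * ∑ p, ‖χ p‖ ^ 2 := by
          simp only [hu, Fintype.sum_prod_type, norm_mul, mul_pow, Finset.mul_sum]
      _ = 1 := by rw [← Finset.sum_mul, he1, hχ, one_mul]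
  have hred : reduced u = pureState χ := by
    ext p q
    calc reduced u p q = (∑ s, e s * star (e s)) * (χ p * star (χ q)) := by
          rw [Finset.sum_mul]
          change ∑ s, u ((s, p.1), p.2) * star (u ((s, q.1), q.2)) = _
          refine Finset.sum_congr rfl fun s _ => ?_
          simp only [hu, star_mul']
          ring
      _ = pureState χ p q := by rw [he3, one_mul]; rfl
  have hin : inner ℂ (WithLp.toLp 2 u : EuclideanSpace ℂ ((Fin 2 × Qubits n) × Fin d)) (WithLp.toLp 2 φ)
      = ((√(∑ s, ‖overlap χ φ s‖ ^ 2) : ℝ) : ℂ) := by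
    rw [← he2, EuclideanSpace.inner_eq_star_dotProduct]
    simp only [dotProduct, overlap, Fintype.sum_prod_type, Finset.mul_sum, Pi.star_apply, hu, star_mul']
    congr! 3
    ring
  obtain ⟨B, hB, hB1, eB⟩ := exists_trace_mul_eq_traceNorm
    ((isHermitian_pureState χ).sub (isHermitian_reduced φ))
  have hB' : (obsHom n d B)ᴴ = obsHom n d B := by
    have := congrArg (obsHom n d) hB.star_eq
    rwa [map_star] at this
  have hT : ∀ x y, inner ℂ (Matrix.toEuclideanCLM (𝕜 := ℂ) (obsHom n d B) x) y
      = inner ℂ x (Matrix.toEuclideanCLM (𝕜 := ℂ) (obsHom n d B) y) := by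
    intro x y
    have h2 : ContinuousLinearMap.adjoint (Matrix.toEuclideanCLM (𝕜 := ℂ) (obsHom n d B))
        = Matrix.toEuclideanCLM (𝕜 := ℂ) (obsHom n d B) := by
      rw [← ContinuousLinearMap.star_eq_adjoint, ← map_star]
      congr 1
    conv_lhs => rw [← h2]
    exact ContinuousLinearMap.adjoint_inner_left _ _ _
  have hnorm : ‖Matrix.toEuclideanCLM (𝕜 := ℂ) (obsHom n d B)‖ ≤ 1 := by
    rw [← Matrix.cstar_norm_def]
    exact (NonUnitalStarAlgHom.norm_apply_le (obsHom n d) B).trans hB1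
  have key := sq_inner_sub_inner_le _ hT hnorm (norm_toLp_eq_one hu1) (norm_toLp_eq_one hφ) hin
  rw [← star_dotProduct_mulVec_eq_inner, ← star_dotProduct_mulVec_eq_inner, ← trace_mul_reduced,
    ← trace_mul_reduced, hred, ← Matrix.trace_sub, ← mul_sub, eB, Complex.ofReal_re,
    Real.sq_sqrt (Finset.sum_nonneg fun i _ => by positivity)] at key
  exact key

theorem trace_reduced {φ : FullVec n d} (hφ : ∑ x, ‖φ x‖ ^ 2 = 1) : (reduced φ).trace = 1 := by
  have := trace_mul_reduced 1 φ
  rw [one_mul, map_one, Matrix.one_mulVec] at this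
  rw [this, star_dotProduct_self, hφ, Complex.ofReal_one]

theorem pureState_mul_self {m : Type} [Fintype m] {χ : m → ℂ} (hχ : ∑ x, ‖χ x‖ ^ 2 = 1) :
    pureState χ * pureState χ = pureState χ := by
  rw [pureState, Matrix.vecMulVec_mul_vecMulVec, star_dotProduct_self, hχ, Complex.ofReal_one,
    one_smul]

theorem trace_pureState {m : Type} [Fintype m] {χ : m → ℂ} (hχ : ∑ x, ‖χ x‖ ^ 2 = 1) :
    (pureState χ).trace = 1 := by
  rw [pureState, Matrix.trace_vecMulVec, dotProduct_comm, star_dotProduct_self, hχ,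
    Complex.ofReal_one]

theorem ampHom_unitary {m k : Type} [Fintype m] [DecidableEq m] [Fintype k] [DecidableEq k]
    {U : Matrix m m ℂ} (hU : Uᴴ * U = 1) : (ampHom m k U)ᴴ * ampHom m k U = 1 := by
  have : star (ampHom m k U) * ampHom m k U = 1 := by
    rw [← map_star, ← map_mul]
    exact (congrArg _ hU).trans (map_one _)
  exact this

/-- Infidelity with a pure state P is linear in the other state, so its mean is tr(PΔ) for the mean
difference Δ. As tr Δ = 0, twice this is tr((2P - 1)Δ), which is at most ε because 2P - 1 is a
contraction. The factor 4 between infidelity and squared trace distance yields 2ε. -/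
theorem sum_traceNorm_sq_le {f : ℝ → ℝ} {t ε : ℝ} (ht : 0 < t) (hε : 0 < ε) {H : Op n}
    (hH : H.IsHermitian) (h1 : ‖traceless H‖ ≤ 1)
    (hs : Summable fun k : ℤ => ‖coeff f k‖ * |(k : ℝ)|) (hK : IsCutoff f t ε K)
    {ψ : Qubits n × Fin d → ℂ} (hψ : ∑ x, ‖ψ x‖ ^ 2 = 1) :
    ∑ j : Index n f t ε K, indexProb H j * traceNorm (ampliate (idealOp f H t) (pureState ψ) -
      ampliate (runOp H j) (pureState ψ)) ^ 2 ≤ 2 * ε := by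
  have hF : IsSelfAdjoint (cfc f (traceless H)) := cfc_predicate f _
  set χ := ampHom _ (Fin d) (evol (cfc f (traceless H)) t) *ᵥ ψ with hχd
  have hχ : ∑ x, ‖χ x‖ ^ 2 = 1 :=
    (sum_norm_sq_mulVec (ampHom_unitary (star_uexp_mul_self hF t)) ψ).trans hψ
  have hP : ampliate (idealOp f H t) (pureState ψ) = pureState χ := ampliate_conj _ ψ
  set φ : Index n f t ε K → FullVec n d := fun j =>
    ampHom _ (Fin d) (Circuit.matrix H (mainCircuit j.2)) *ᵥ inVec ψ with hφd
  have hφ : ∀ j, ∑ x, ‖φ j x‖ ^ 2 = 1 := fun j =>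
    (sum_norm_sq_mulVec (ampHom_unitary (unitary_circuit hH _)) _).trans
      ((sum_norm_sq_inVec ψ).trans hψ)
  have hR : ∀ j, ampliate (runOp H j) (pureState ψ) = reduced (φ j) := fun j => ampliate_runOp H j ψ
  have hpsum : (∑ j : Index n f t ε K, (indexProb H j : ℂ)) = 1 := by
    rw [← Complex.ofReal_sum, sum_indexProb, Complex.ofReal_one]
  set Δ := pureState χ - ∑ j, (indexProb H j : ℂ) • reduced (φ j) with hΔ
  have hΔ0 : Δ.trace = 0 := by
    rw [hΔ, Matrix.trace_sub, Matrix.trace_sum, trace_pureState hχ]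
    simp only [Matrix.trace_smul, trace_reduced (hφ _), smul_eq_mul, mul_one, hpsum, sub_self]
  have hPΔ : (pureState χ * Δ).trace
      = ((∑ j, indexProb H j * (1 - ∑ s, ‖overlap χ (φ j) s‖ ^ 2) : ℝ) : ℂ) := by
    rw [hΔ, mul_sub, Matrix.trace_sub, pureState_mul_self hχ, trace_pureState hχ, Finset.mul_sum,
      Matrix.trace_sum]
    simp only [Matrix.mul_smul, Matrix.trace_smul, trace_pureState_mul_reduced, smul_eq_mul, mul_sub,
      mul_one, Finset.sum_sub_distrib, sum_indexProb]
    push_cast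
    rfl
  have hQ : ‖(2 : ℂ) • pureState χ - 1‖ ≤ 1 := by
    refine norm_le_one_of_star_mul_self ?_
    have : star ((2 : ℂ) • pureState χ - 1) = (2 : ℂ) • pureState χ - 1 := by
      rw [star_sub, star_smul, star_one]
      congr 2
      · simp
      · exact isHermitian_pureState χ
    rw [this]
    simp only [sub_mul, mul_sub, smul_mul_assoc, mul_smul_comm, pureState_mul_self hχ, mul_one, one_mul]
    module
  have hb := norm_trace_mul_sub_le ht hε hH h1 hs hK hψ ((2 : ℂ) • pureState χ - 1)
  simp only [hP, hR] at hb ⊢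
  rw [← hΔ, sub_mul, one_mul, Matrix.smul_mul, Matrix.trace_sub, hΔ0, sub_zero, Matrix.trace_smul, hPΔ,
    smul_eq_mul, norm_mul, Complex.norm_real] at hb
  have hb2 : 2 * (∑ j, indexProb H j * (1 - ∑ s, ‖overlap χ (φ j) s‖ ^ 2)) ≤ ε := by
    refine le_trans ?_ (hb.trans (mul_le_of_le_one_right hε.le hQ))
    rw [Complex.norm_ofNat]
    gcongr
    exact le_abs_self _
  calc _ ≤ ∑ j, indexProb H j * (4 * (1 - ∑ s, ‖overlap χ (φ j) s‖ ^ 2)) := by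
        gcongr with j
        · exact indexProb_nonneg hH j
        · exact traceNorm_pureState_sub_sq_le hχ (hφ j)
    _ = 2 * (2 * (∑ j, indexProb H j * (1 - ∑ s, ‖overlap χ (φ j) s‖ ^ 2))) := by
        rw [Finset.mul_sum, Finset.mul_sum]
        exact Finset.sum_congr rfl fun j _ => by ring
    _ ≤ 2 * ε := by gcongr

end ErrorBounds
end UHET

end

noncomputable section

namespace UHET

/-! ### Fourier coefficients of the periodically smooth modification -/

section Fourier

open MeasureTheory Set

/-! #### Derivatives -/

theorem uniqueDiffOn_Icc_neg_one_one : UniqueDiffOn ℝ (Icc (-1 : ℝ) 1) :=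
  uniqueDiffOn_Icc (by norm_num)

theorem continuousOn_der {f : ℝ → ℝ} (hf : ContDiffOn ℝ 3 f (Icc (-1) 1)) {m : ℕ} (hm : m ≤ 3) :
    ContinuousOn (der m f) (Icc (-1) 1) :=
  hf.continuousOn_iteratedDerivWithin (by exact_mod_cast hm) uniqueDiffOn_Icc_neg_one_one

theorem hasDerivAt_der {f : ℝ → ℝ} (hf : ContDiffOn ℝ 3 f (Icc (-1) 1)) {m : ℕ} (hm : m < 3) {x : ℝ}
    (hx : x ∈ Ioo (-1 : ℝ) 1) : HasDerivAt (der m f) (der (m + 1) f x) x := by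
  have h := (hf.differentiableOn_iteratedDerivWithin (m := m) (by exact_mod_cast hm)
    uniqueDiffOn_Icc_neg_one_one) x (Ioo_subset_Icc_self hx)
  have h2 := h.hasDerivWithinAt
  rw [← iteratedDerivWithin_succ] at h2
  exact h2.hasDerivAt (Icc_mem_nhds hx.1 hx.2)

/-- The `m`-th derivative of `gExt f`. -/
def gExtDer (f : ℝ → ℝ) (m : ℕ) (x : ℝ) : ℝ :=
  ∑ i : Fin 4, (((i : ℕ) + 1 : ℝ) * Real.pi) ^ m *
    (cosCoeff f i * Real.cos (((i : ℕ) + 1 : ℝ) * Real.pi * x + m * (Real.pi / 2)) +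
      sinCoeff f i / ((i : ℕ) + 1 : ℝ) *
        Real.sin (((i : ℕ) + 1 : ℝ) * Real.pi * x + m * (Real.pi / 2)))

theorem gExtDer_zero (f : ℝ → ℝ) : gExtDer f 0 = gExt f := by
  funext x
  simp [gExtDer, gExt]

theorem hasDerivAt_gExtDer (f : ℝ → ℝ) (m : ℕ) (x : ℝ) :
    HasDerivAt (gExtDer f m) (gExtDer f (m + 1) x) x := by
  unfold gExtDer
  refine HasDerivAt.fun_sum fun i _ => ?_
  have h1 : HasDerivAt (fun x : ℝ => ((i : ℕ) + 1 : ℝ) * Real.pi * x + m * (Real.pi / 2))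
      (((i : ℕ) + 1 : ℝ) * Real.pi) x := by
    simpa using ((hasDerivAt_id x).const_mul (((i : ℕ) + 1 : ℝ) * Real.pi)).add_const
      (m * (Real.pi / 2))
  refine HasDerivAt.congr_deriv ((((h1.cos).const_mul (cosCoeff f i)).fun_add
    ((h1.sin).const_mul (sinCoeff f i / ((i : ℕ) + 1 : ℝ)))).const_mul
      ((((i : ℕ) + 1 : ℝ) * Real.pi) ^ m)) ?_
  have e : ((i : ℕ) + 1 : ℝ) * Real.pi * x + ((m + 1 : ℕ) : ℝ) * (Real.pi / 2)
      = (((i : ℕ) + 1 : ℝ) * Real.pi * x + m * (Real.pi / 2)) + Real.pi / 2 := by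
    push_cast; ring
  rw [e, Real.cos_add_pi_div_two, Real.sin_add_pi_div_two]
  ring

theorem cos_three_mul_pi_div_two : Real.cos (3 * (Real.pi / 2)) = 0 := by
  rw [show 3 * (Real.pi / 2) = Real.pi / 2 + Real.pi by ring, Real.cos_add_pi, Real.cos_pi_div_two,
    neg_zero]

theorem sin_three_mul_pi_div_two : Real.sin (3 * (Real.pi / 2)) = -1 := by
  rw [show 3 * (Real.pi / 2) = Real.pi / 2 + Real.pi by ring, Real.sin_add_pi, Real.sin_pi_div_two]

/-- The coefficient matrix solves the interpolation problem at 0 and at -1. Even derivatives see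
only the cosines and odd ones only the sines, and the division by m of the sine coefficients makes
both systems the same. The factor 2^m is the chain rule for x ↦ 2x - 1. -/
theorem gExtDer_at_zero (f : ℝ → ℝ) {m : ℕ} (hm : m ≤ 3) :
    gExtDer f m 0 = 2 ^ m * der m f (-1) := by
  have hpi := Real.pi_ne_zero
  interval_cases m <;>
  · simp [gExtDer, cosCoeff, sinCoeff, coeffMatrix, Fin.sum_univ_four, Matrix.mulVec, dotProduct,
      cos_three_mul_pi_div_two, sin_three_mul_pi_div_two, mul_div_cancel₀, der]
    field_simp
    ring

theorem gExtDer_neg_one (f : ℝ → ℝ) {m : ℕ} (hm : m ≤ 3) :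
    gExtDer f m (-1) = 2 ^ m * der m f 1 := by
  have hpi := Real.pi_ne_zero
  have hc : ∀ (i m : ℕ), Real.cos (((i : ℕ) + 1 : ℝ) * Real.pi * (-1) + m * (Real.pi / 2))
      = (-1) ^ (i + 1) * Real.cos (m * (Real.pi / 2)) := by
    intro i m
    have := Real.cos_add_nat_mul_pi (-(((i + 1 : ℕ) : ℝ) * Real.pi) + m * (Real.pi / 2)) (i + 1)
    rw [show -(((i + 1 : ℕ) : ℝ) * Real.pi) + m * (Real.pi / 2) + ((i + 1 : ℕ) : ℝ) * Real.pi
      = m * (Real.pi / 2) by ring] at this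
    rw [this, ← mul_assoc, ← pow_add, ← two_mul, pow_mul]
    push_cast
    simp
  have hs : ∀ (i m : ℕ), Real.sin (((i : ℕ) + 1 : ℝ) * Real.pi * (-1) + m * (Real.pi / 2))
      = (-1) ^ (i + 1) * Real.sin (m * (Real.pi / 2)) := by
    intro i m
    have := Real.sin_add_nat_mul_pi (-(((i + 1 : ℕ) : ℝ) * Real.pi) + m * (Real.pi / 2)) (i + 1)
    rw [show -(((i + 1 : ℕ) : ℝ) * Real.pi) + m * (Real.pi / 2) + ((i + 1 : ℕ) : ℝ) * Real.pi
      = m * (Real.pi / 2) by ring] at this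
    rw [this, ← mul_assoc, ← pow_add, ← two_mul, pow_mul]
    push_cast
    simp
  unfold gExtDer
  simp only [hc, hs]
  interval_cases m <;>
  · simp [cosCoeff, sinCoeff, coeffMatrix, Fin.sum_univ_four, Matrix.mulVec, dotProduct,
      cos_three_mul_pi_div_two, sin_three_mul_pi_div_two, mul_div_cancel₀, der]
    field_simp
    ring

/-- A function that is `u` on the negative and `v (2x - 1)` on the nonnegative reals. -/
def glue (u v : ℝ → ℝ) (x : ℝ) : ℝ := if x < 0 then u x else v (2 * x - 1)

theorem continuousOn_glue {u v : ℝ → ℝ} (hu : Continuous u) (hv : ContinuousOn v (Icc (-1) 1))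
    (h : u 0 = v (-1)) : ContinuousOn (glue u v) (Icc (-1) 1) := by
  unfold glue
  refine ContinuousOn.if ?_ hu.continuousOn ?_
  · intro a ha
    have : a = 0 := by
      have h2 := ha.2
      rw [show {a : ℝ | a < 0} = Iio 0 from rfl, frontier_Iio] at h2
      exact h2
    subst this
    simpa using h
  · refine hv.comp (by fun_prop) ?_
    rintro x ⟨hx, hx2⟩
    have : (0 : ℝ) ≤ x := by
      have h3 : {a : ℝ | ¬ a < 0} = Ici 0 := by ext; simp
      rw [h3, closure_Ici] at hx2
      exact hx2
    exact ⟨by linarith, by linarith [hx.2]⟩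

theorem hasDerivAt_glue_of_neg {u v : ℝ → ℝ} {u' x : ℝ} (hx : x < 0) (h : HasDerivAt u u' x) :
    HasDerivAt (glue u v) u' x :=
  h.congr_of_eventuallyEq (by filter_upwards [Iio_mem_nhds hx] with y hy; exact if_pos hy)

theorem hasDerivAt_glue_of_pos {u v : ℝ → ℝ} {v' x : ℝ} (hx : 0 < x)
    (h : HasDerivAt v v' (2 * x - 1)) : HasDerivAt (glue u v) (2 * v') x := by
  have h1 : HasDerivAt (fun y : ℝ => 2 * y - 1) 2 x := by
    simpa using ((hasDerivAt_id x).const_mul 2).sub_const 1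
  have h2 := h.comp x h1
  rw [mul_comm] at h2
  exact h2.congr_of_eventuallyEq (by
    filter_upwards [Ioi_mem_nhds hx] with y hy; exact if_neg (not_lt.2 (le_of_lt hy)))

/-- The `m`-th derivative of `fTilde f` for `m ≤ 3`. -/
def tildeDer (f : ℝ → ℝ) (m : ℕ) : ℝ → ℝ := glue (gExtDer f m) fun y => 2 ^ m * der m f y

theorem tildeDer_zero (f : ℝ → ℝ) : tildeDer f 0 = fTilde f := by
  funext x
  simp [tildeDer, glue, fTilde, gExtDer_zero, der]

theorem continuous_gExtDer (f : ℝ → ℝ) (m : ℕ) : Continuous (gExtDer f m) :=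
  continuous_iff_continuousAt.2 fun x => (hasDerivAt_gExtDer f m x).continuousAt

theorem continuousOn_tildeDer {f : ℝ → ℝ} (hf : ContDiffOn ℝ 3 f (Icc (-1) 1)) {m : ℕ}
    (hm : m ≤ 3) : ContinuousOn (tildeDer f m) (Icc (-1) 1) :=
  continuousOn_glue (continuous_gExtDer f m) ((continuousOn_der hf hm).const_mul _)
    (gExtDer_at_zero f hm)

theorem tildeDer_neg_one_eq (f : ℝ → ℝ) {m : ℕ} (hm : m ≤ 3) :
    tildeDer f m (-1) = tildeDer f m 1 := by
  have h1 : tildeDer f m (-1) = gExtDer f m (-1) := if_pos (by norm_num)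
  have h2 : tildeDer f m 1 = 2 ^ m * der m f (2 * 1 - 1) := if_neg (by norm_num)
  rw [h1, h2, gExtDer_neg_one f hm]
  norm_num

theorem hasDerivAt_tildeDer {f : ℝ → ℝ} (hf : ContDiffOn ℝ 3 f (Icc (-1) 1)) {m : ℕ}
    (hm : m < 3) {x : ℝ} (hx : x ∈ Ioo (-1 : ℝ) 1) (h0 : x ≠ 0) :
    HasDerivAt (tildeDer f m) (tildeDer f (m + 1) x) x := by
  rcases lt_or_gt_of_ne h0 with h | h
  · have e : tildeDer f (m + 1) x = gExtDer f (m + 1) x := if_pos h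
    rw [e]
    exact hasDerivAt_glue_of_neg h (hasDerivAt_gExtDer f m x)
  · have e : tildeDer f (m + 1) x = 2 * (2 ^ m * der (m + 1) f (2 * x - 1)) := by
      rw [← mul_assoc, ← pow_succ']
      exact if_neg (not_lt.2 h.le)
    rw [e]
    exact hasDerivAt_glue_of_pos h
      ((hasDerivAt_der hf hm ⟨by linarith, by linarith [hx.2]⟩).const_mul _)

/-! #### Integration by parts -/

theorem cexp_int_mul_pi (k : ℤ) :
    Complex.exp (-(Complex.I * k * Real.pi * (1 : ℝ)))
      = Complex.exp (-(Complex.I * k * Real.pi * ((-1 : ℝ)))) := by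
  rw [Complex.exp_eq_exp_iff_exists_int]
  exact ⟨-k, by push_cast; ring⟩

theorem continuous_cexp_neg (k : ℤ) :
    Continuous fun x : ℝ => Complex.exp (-(Complex.I * k * Real.pi * x)) := by fun_prop

theorem intervalIntegrable_cexp_mul {F : ℝ → ℝ} (hF : IntervalIntegrable F volume (-1) 1) (k : ℤ) :
    IntervalIntegrable (fun x : ℝ => Complex.exp (-(Complex.I * k * Real.pi * x)) * (F x : ℂ))
      volume (-1) 1 :=
  IntervalIntegrable.continuousOn_mul ⟨hF.1.ofReal, hF.2.ofReal⟩ (continuous_cexp_neg k).continuousOn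

/-- The exponential and F take equal values at the two ends, so the boundary terms cancel.
Continuity makes countably many points without derivative harmless. -/
theorem integral_cexp_mul_deriv {F F' : ℝ → ℝ} {T : Set ℝ} (hT : T.Countable)
    (hF : ContinuousOn F (Icc (-1) 1)) (hper : F (-1) = F 1)
    (hd : ∀ x ∈ Ioo (-1 : ℝ) 1 \ T, HasDerivAt F (F' x) x)
    (hF' : IntervalIntegrable F' volume (-1) 1) (k : ℤ) :
    ∫ x in (-1 : ℝ)..1, Complex.exp (-(Complex.I * k * Real.pi * x)) * (F' x : ℂ)
      = Complex.I * k * Real.pi *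
        ∫ x in (-1 : ℝ)..1, Complex.exp (-(Complex.I * k * Real.pi * x)) * (F x : ℂ) := by
  have hFi : IntervalIntegrable F volume (-1) 1 :=
    ContinuousOn.intervalIntegrable_of_Icc (by norm_num) hF
  have key := integral_eq_of_hasDerivAt_off_countable_of_le
    (fun x : ℝ => Complex.exp (-(Complex.I * k * Real.pi * x)) * (F x : ℂ))
    (fun x : ℝ => Complex.exp (-(Complex.I * k * Real.pi * x)) * (F' x : ℂ)
      - Complex.I * k * Real.pi * (Complex.exp (-(Complex.I * k * Real.pi * x)) * (F x : ℂ)))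
    (a := -1) (b := 1) (by norm_num) hT
    ((continuous_cexp_neg k).continuousOn.mul (Complex.continuous_ofReal.comp_continuousOn hF))
    (fun x hx => by
      have h1 : HasDerivAt (fun x : ℝ => -(Complex.I * k * Real.pi * x)) (-(Complex.I * k * Real.pi)) x := by
        have h0 : HasDerivAt (fun x : ℝ => (x : ℂ)) 1 x := Complex.ofRealCLM.hasDerivAt
        have := (h0.const_mul (Complex.I * k * Real.pi)).fun_neg
        rwa [mul_one] at this
      refine HasDerivAt.congr_deriv (h1.cexp.fun_mul (hd x hx).ofReal_comp) ?_
      ring)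
    ((intervalIntegrable_cexp_mul hF' k).sub ((intervalIntegrable_cexp_mul hFi k).const_mul _))
  rw [intervalIntegral.integral_sub (intervalIntegrable_cexp_mul hF' k)
    ((intervalIntegrable_cexp_mul hFi k).const_mul _), intervalIntegral.integral_const_mul, hper,
    cexp_int_mul_pi, sub_self, sub_eq_zero] at key
  exact key

/-! #### Integrability of the fourth derivative -/

/-- A finite one-sided limit gives integrability on a one-sided neighbourhood. Left side, right side
and the point itself give local integrability, and [-1, 1] is compact. -/
theorem PiecewiseC.integrableOn {J : ℕ} {g : ℝ → ℝ} {S : Finset ℝ} (h : PiecewiseC J g S) :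
    IntegrableOn g (Icc (-1) 1) := by
  have hmeas : AEStronglyMeasurable g (volume.restrict (Ioo (-1) 1)) := by
    have h1 : ContinuousOn g (Ioo (-1) 1 \ S) := h.1.continuousOn
    have h2 : AEStronglyMeasurable g (volume.restrict (Ioo (-1) 1 \ S)) :=
      h1.aestronglyMeasurable (measurableSet_Ioo.diff S.measurableSet)
    rwa [Measure.restrict_congr_set
      (sdiff_null_ae_eq_self (S.finite_toSet.measure_zero volume))] at h2
  refine LocallyIntegrableOn.integrableOn_isCompact (fun a ha => ?_) isCompact_Icc
  have hR : IntegrableAtFilter g (𝓝[>] a ⊓ Filter.principal (Icc (-1) 1)) := by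
    rcases ha.2.eq_or_lt with e | hlt
    · refine ⟨∅, ?_, by simp⟩
      rw [nhdsWithin, inf_assoc, Filter.inf_principal]
      have : Ioi a ∩ Icc (-1) 1 = ∅ := by
        ext y; simp only [mem_inter_iff, mem_Ioi, mem_Icc, mem_empty_iff_false, iff_false]
        rintro ⟨h1, -, h2⟩; linarith
      rw [this]; simp
    · obtain ⟨L, hL⟩ := (h.2 0 (Nat.zero_le _)).1 a ⟨ha.1, hlt⟩
      rw [iteratedDeriv_zero] at hL
      have := Filter.Tendsto.integrableAtFilter (μ := volume) (l := 𝓝[>] a)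
        ⟨Ioo (-1) 1, by
          filter_upwards [Ioo_mem_nhdsGT hlt] with y hy
          exact ⟨lt_of_le_of_lt ha.1 hy.1, hy.2⟩, hmeas⟩
        (volume.finiteAt_nhdsWithin a _) hL
      exact this.filter_mono inf_le_left
  have hL : IntegrableAtFilter g (𝓝[<] a ⊓ Filter.principal (Icc (-1) 1)) := by
    rcases ha.1.eq_or_lt with e | hlt
    · refine ⟨∅, ?_, by simp⟩
      rw [nhdsWithin, inf_assoc, Filter.inf_principal]
      have : Iio a ∩ Icc (-1) 1 = ∅ := by
        ext y; simp only [mem_inter_iff, mem_Iio, mem_Icc, mem_empty_iff_false, iff_false]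
        rintro ⟨h1, h2, -⟩; linarith
      rw [this]; simp
    · obtain ⟨L, hL⟩ := (h.2 0 (Nat.zero_le _)).2 a ⟨hlt, ha.2⟩
      rw [iteratedDeriv_zero] at hL
      have := Filter.Tendsto.integrableAtFilter (μ := volume) (l := 𝓝[<] a)
        ⟨Ioo (-1) 1, by
          filter_upwards [Ioo_mem_nhdsLT hlt] with y hy
          exact ⟨hy.1, lt_of_lt_of_le hy.2 ha.2⟩, hmeas⟩
        (volume.finiteAt_nhdsWithin a _) hL
      exact this.filter_mono inf_le_left
  have hP : IntegrableAtFilter g (pure a) :=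
    ⟨{a}, by simp, integrableOn_singleton (hx := by simp)⟩
  have hs := IntegrableAtFilter.sup_iff.2 ⟨IntegrableAtFilter.sup_iff.2 ⟨hL, hR⟩, hP⟩
  refine hs.filter_mono ?_
  have hle : (𝓝 a : Filter ℝ) = (𝓝[<] a ⊔ 𝓝[>] a) ⊔ pure a := by
    rw [← nhdsWithin_union, Iio_union_Ioi, sup_comm, pure_sup_nhdsNE]
  rw [nhdsWithin, hle, ← inf_sup_right, inf_sup_right _ (pure a)]
  gcongr
  exact inf_le_left

theorem exists_deriv_tildeDer {f : ℝ → ℝ} (hf : Admissible f) :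
    ∃ (F : ℝ → ℝ) (T : Set ℝ), T.Countable ∧ IntervalIntegrable F volume (-1) 1 ∧
      ∀ x ∈ Ioo (-1 : ℝ) 1 \ T, HasDerivAt (tildeDer f 3) (F x) x := by
  obtain ⟨h3, g, S, hg, hS⟩ := hf
  -- The factor 8 comes from the third derivative of the rescaled f and the factor 2 from the fourth
  -- differentiation. The exceptional points are the junction 0 and the preimages of S.
  refine ⟨glue (gExtDer f 4) fun y => 2 * (8 * g y),
    insert 0 ((fun y => (y + 1) / 2) '' (S : Set ℝ)), ?_, ?_, ?_⟩
  · exact (S.countable_toSet.image _).insert _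
  · have h1 : IntervalIntegrable (glue (gExtDer f 4) fun y => 2 * (8 * g y)) volume (-1) 0 := by
      refine ((continuous_gExtDer f 4).intervalIntegrable (-1) 0).congr_ae ?_
      rw [uIoc_of_le (by norm_num), ← restrict_Ioo_eq_restrict_Ioc]
      filter_upwards [ae_restrict_mem measurableSet_Ioo] with x hx
      exact (if_pos hx.2).symm
    have h2 : IntervalIntegrable (glue (gExtDer f 4) fun y => 2 * (8 * g y)) volume 0 1 := by
      have hgi : IntervalIntegrable g volume (-1) 1 :=
        (intervalIntegrable_iff_integrableOn_Icc_of_le (by norm_num)).2 hg.integrableOn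
      have h4 : IntervalIntegrable (fun x => 2 * (8 * g (2 * x - 1))) volume 0 1 := by
        have h5 := (hgi.comp_sub_right 1).comp_mul_left (c := 2)
        norm_num at h5
        exact (h5.const_mul 8).const_mul 2
      refine h4.congr ?_
      rw [uIoc_of_le (by norm_num)]
      intro x hx
      exact (if_neg (not_lt.2 hx.1.le)).symm
    exact h1.trans h2
  · rintro x ⟨hx, hxT⟩
    simp only [mem_insert_iff, mem_image, Finset.mem_coe, not_or, not_exists, not_and] at hxT
    rcases lt_or_gt_of_ne hxT.1 with h | h
    · have e : glue (gExtDer f 4) (fun y => 2 * (8 * g y)) x = gExtDer f 4 x := if_pos h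
      rw [e]
      exact hasDerivAt_glue_of_neg h (hasDerivAt_gExtDer f 3 x)
    · have e : glue (gExtDer f 4) (fun y => 2 * (8 * g y)) x = 2 * (8 * g (2 * x - 1)) :=
        if_neg (not_lt.2 h.le)
      rw [e]
      refine hasDerivAt_glue_of_pos h ?_
      have := (hS (2 * x - 1) ⟨⟨by linarith, by linarith [hx.2]⟩, fun hm =>
        hxT.2 _ hm (by ring)⟩).const_mul (2 ^ 3)
      norm_num at this ⊢
      exact this

/-- Four integrations by parts: the derivatives of order 0 to 3 are continuous and periodic, and the
fourth is integrable. The gain π⁴ ≥ 1 is discarded. -/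
theorem exists_coeff_bound {f : ℝ → ℝ} (hf : Admissible f) :
    ∃ B : ℝ, 0 ≤ B ∧ ∀ k : ℤ, ‖coeff f k‖ * (k : ℝ) ^ 4 ≤ B := by
  obtain ⟨F, T, hT, hF, hd⟩ := exists_deriv_tildeDer hf
  have hint : ∀ m ≤ 3, IntervalIntegrable (tildeDer f m) volume (-1) 1 := fun m hm =>
    ContinuousOn.intervalIntegrable_of_Icc (by norm_num) (continuousOn_tildeDer hf.1 hm)
  have step : ∀ m < 3, ∀ k : ℤ,
      ∫ x in (-1 : ℝ)..1, Complex.exp (-(Complex.I * k * Real.pi * x)) * (tildeDer f (m + 1) x : ℂ)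
      = Complex.I * k * Real.pi * ∫ x in (-1 : ℝ)..1,
        Complex.exp (-(Complex.I * k * Real.pi * x)) * (tildeDer f m x : ℂ) := by
    intro m hm k
    exact integral_cexp_mul_deriv (countable_singleton 0) (continuousOn_tildeDer hf.1 hm.le)
      (tildeDer_neg_one_eq f hm.le) (fun x hx => hasDerivAt_tildeDer hf.1 hm hx.1 hx.2)
      (hint _ hm) k
  refine ⟨1 / 2 * ∫ x in (-1 : ℝ)..1, ‖F x‖, mul_nonneg (by norm_num)
    (intervalIntegral.integral_nonneg (by norm_num) fun x _ => norm_nonneg _), fun k => ?_⟩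
  have e : (Complex.I * k * Real.pi) ^ 4 * coeff f k = 1 / 2 * ∫ x in (-1 : ℝ)..1,
      Complex.exp (-(Complex.I * k * Real.pi * x)) * (F x : ℂ) := by
    rw [integral_cexp_mul_deriv hT (continuousOn_tildeDer hf.1 le_rfl)
      (tildeDer_neg_one_eq f le_rfl) hd hF k, step 2 (by norm_num), step 1 (by norm_num),
      step 0 (by norm_num), tildeDer_zero, coeff]
    ring
  have hn := congrArg norm e
  have hb : ‖∫ x in (-1 : ℝ)..1, Complex.exp (-(Complex.I * k * Real.pi * x)) * (F x : ℂ)‖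
      ≤ ∫ x in (-1 : ℝ)..1, ‖F x‖ := by
    refine (intervalIntegral.norm_integral_le_integral_norm (by norm_num)).trans (le_of_eq ?_)
    refine intervalIntegral.integral_congr fun x _ => ?_
    have : -(Complex.I * k * Real.pi * x) = ((-(k * Real.pi * x) : ℝ) : ℂ) * Complex.I := by
      push_cast; ring
    simp only [norm_mul, this, Complex.norm_exp_ofReal_mul_I, one_mul, Complex.norm_real]
  rw [norm_mul, norm_pow, norm_mul, norm_mul, Complex.norm_I, one_mul, Complex.norm_intCast,
    Complex.norm_real, norm_mul, Real.norm_of_nonneg Real.pi_pos.le] at hn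
  have h1 : ‖(1 / 2 : ℂ)‖ = 1 / 2 := by norm_num
  rw [h1] at hn
  have hpi : (1 : ℝ) ≤ Real.pi ^ 4 := one_le_pow₀ (by linarith [Real.pi_gt_three])
  calc ‖coeff f k‖ * (k : ℝ) ^ 4 ≤ ‖coeff f k‖ * (k : ℝ) ^ 4 * Real.pi ^ 4 :=
        le_mul_of_one_le_right (by positivity) hpi
    _ = (|(k : ℝ)| * Real.pi) ^ 4 * ‖coeff f k‖ := by
        rw [mul_pow, Even.pow_abs (by decide)]; ring
    _ ≤ _ := by rw [hn]; gcongr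

end Fourier
end UHET

end

noncomputable section

namespace UHET

/-! ### Fourier series and cutoff numbers -/

section FourierSeries

open MeasureTheory Set

theorem summable_coeff_sq {f : ℝ → ℝ} (hf : Admissible f) :
    Summable fun k : ℤ => ‖coeff f k‖ * (k : ℝ) ^ 2 := by
  obtain ⟨B, hB, h⟩ := exists_coeff_bound hf
  refine Summable.of_nonneg_of_le (fun k => by positivity) (fun k => ?_)
    ((Real.summable_one_div_int_pow (p := 2)).2 (by norm_num) |>.mul_left B)
  rcases eq_or_ne k 0 with rfl | hk
  · simp
  · have hk2 : 0 < (k : ℝ) ^ 2 := by positivity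
    rw [mul_one_div, le_div_iff₀ hk2, mul_assoc, ← pow_add]
    exact h k

theorem abs_le_sq_intCast (k : ℤ) : |(k : ℝ)| ≤ (k : ℝ) ^ 2 := by
  rcases eq_or_ne k 0 with rfl | hk
  · simp
  · have : (1 : ℝ) ≤ |(k : ℝ)| := by exact_mod_cast Int.one_le_abs hk
    rw [← sq_abs]; nlinarith

theorem one_le_sq_intCast {k : ℤ} (hk : k ≠ 0) : (1 : ℝ) ≤ (k : ℝ) ^ 2 := by
  have : (1 : ℝ) ≤ |(k : ℝ)| := by exact_mod_cast Int.one_le_abs hk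
  exact this.trans (abs_le_sq_intCast k)

theorem summable_coeff_abs {f : ℝ → ℝ} (hf : Admissible f) :
    Summable fun k : ℤ => ‖coeff f k‖ * |(k : ℝ)| :=
  Summable.of_nonneg_of_le (fun k => by positivity)
    (fun k => mul_le_mul_of_nonneg_left (abs_le_sq_intCast k) (norm_nonneg _)) (summable_coeff_sq hf)

theorem summable_norm_coeff {f : ℝ → ℝ} (hf : Admissible f) : Summable fun k : ℤ => ‖coeff f k‖ := by
  refine Summable.of_norm_bounded_eventually (summable_coeff_sq hf) ?_
  rw [Filter.eventually_cofinite]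
  refine (finite_singleton (0 : ℤ)).subset fun k hk => ?_
  by_contra h0
  refine hk ?_
  rw [norm_norm]
  exact le_mul_of_one_le_right (norm_nonneg _) (one_le_sq_intCast h0)

theorem continuousOn_fTilde {f : ℝ → ℝ} (hf : Admissible f) :
    ContinuousOn (fTilde f) (Icc (-1) 1) := by
  rw [← tildeDer_zero]; exact continuousOn_tildeDer hf.1 (Nat.zero_le _)

theorem fTilde_neg_one (f : ℝ → ℝ) : fTilde f (-1) = fTilde f 1 := by
  rw [← tildeDer_zero]; exact tildeDer_neg_one_eq f (Nat.zero_le _)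

theorem hasSum_fTilde {f : ℝ → ℝ} (hf : Admissible f) {x : ℝ} (hx : x ∈ Icc (-1 : ℝ) 1) :
    HasSum (fun k : ℤ => coeff f k * Complex.exp (Complex.I * k * Real.pi * x)) (fTilde f x : ℂ) := by
  have : Fact ((0 : ℝ) < 2) := ⟨by norm_num⟩
  have hcont : ContinuousOn (fun x : ℝ => (fTilde f x : ℂ)) (Icc (-1) (-1 + 2)) := by
    norm_num
    exact Complex.continuous_ofReal.comp_continuousOn (continuousOn_fTilde hf)
  have hper : (fTilde f (-1) : ℂ) = fTilde f (-1 + 2) := by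
    norm_num
    exact_mod_cast fTilde_neg_one f
  -- Equality at the end points makes f̃ a continuous function on the circle of length 2. There,
  -- absolute summability of the coefficients gives pointwise convergence.
  set φ : C(AddCircle (2 : ℝ), ℂ) :=
    ⟨AddCircle.liftIco 2 (-1) fun x : ℝ => (fTilde f x : ℂ), AddCircle.liftIco_continuous hper hcont⟩
  have hval : ∀ y ∈ Icc (-1 : ℝ) 1, φ (y : AddCircle (2 : ℝ)) = fTilde f y := by
    intro y hy
    rcases hy.2.eq_or_lt with rfl | h
    · have e : ((1 : ℝ) : AddCircle (2 : ℝ)) = ((-1 : ℝ) : AddCircle (2 : ℝ)) :=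
        (congrArg _ (by norm_num : (1 : ℝ) = -1 + 2)).trans (AddCircle.coe_add_period 2 (-1))
      rw [e, ← fTilde_neg_one]
      exact AddCircle.liftIco_coe_apply (f := fun x : ℝ => (fTilde f x : ℂ)) (p := (2 : ℝ))
        (a := (-1 : ℝ)) ⟨le_rfl, by norm_num⟩
    · exact AddCircle.liftIco_coe_apply (f := fun x : ℝ => (fTilde f x : ℂ)) (p := (2 : ℝ))
        (a := (-1 : ℝ)) ⟨hy.1, by linarith⟩
  have hco : ∀ k : ℤ, fourierCoeff φ k = coeff f k := by
    intro k
    rw [fourierCoeff_eq_intervalIntegral _ k (-1), coeff, Complex.real_smul,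
      show (-1 : ℝ) + 2 = 1 by norm_num, show ((1 / 2 : ℝ) : ℂ) = 1 / 2 by norm_num]
    congr 1
    refine intervalIntegral.integral_congr fun y hy => ?_
    rw [uIcc_of_le (by norm_num)] at hy
    change fourier (-k) (y : AddCircle (2 : ℝ)) * φ (y : AddCircle (2 : ℝ)) = _
    rw [hval y hy, fourier_coe_apply]
    congr 2
    push_cast
    ring
  have hsum : Summable (fourierCoeff φ) := by
    rw [funext hco]
    exact (summable_norm_coeff hf).of_norm
  have := has_pointwise_sum_fourier_series_of_summable hsum (x : AddCircle (2 : ℝ))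
  rw [hval x hx] at this
  convert! this using 2 with k
  rw [hco, smul_eq_mul, fourier_coe_apply]
  congr 2
  push_cast
  ring

theorem norm_cexp_I_mul (k : ℤ) (x : ℝ) : ‖Complex.exp (Complex.I * k * Real.pi * x)‖ = 1 := by
  rw [show Complex.I * k * Real.pi * x = ((k * Real.pi * x : ℝ) : ℂ) * Complex.I by push_cast; ring,
    Complex.norm_exp_ofReal_mul_I]

theorem norm_cexp_neg_I_mul (k : ℤ) (x : ℝ) :
    ‖Complex.exp (-(Complex.I * k * Real.pi * x))‖ = 1 := by
  rw [show -(Complex.I * k * Real.pi * x) = ((-(k * Real.pi * x) : ℝ) : ℂ) * Complex.I by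
    push_cast; ring, Complex.norm_exp_ofReal_mul_I]

theorem sum_Icc_neg_succ {M : Type*} [AddCommMonoid M] (a : ℤ → M) (N : ℕ) :
    ∑ k ∈ Finset.Icc (-((N + 1 : ℕ) : ℤ)) (N + 1 : ℕ), a k
      = a (N + 1 : ℕ) + (a (-((N + 1 : ℕ) : ℤ)) + ∑ k ∈ Finset.Icc (-(N : ℤ)) N, a k) := by
  have e : Finset.Icc (-((N + 1 : ℕ) : ℤ)) (N + 1 : ℕ)
      = insert ((N + 1 : ℕ) : ℤ) (insert (-((N + 1 : ℕ) : ℤ)) (Finset.Icc (-(N : ℤ)) N)) := by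
    ext k
    simp only [Finset.mem_Icc, Finset.mem_insert]
    omega
  rw [e, Finset.sum_insert, Finset.sum_insert]
  all_goals simp only [Finset.mem_insert, Finset.mem_Icc]; omega

/-- The truncation error of a Fourier series whose coefficients are `O(k⁻⁴)`. -/
theorem norm_partial_sub_le {a : ℤ → ℂ} {B : ℝ} (hB : 0 ≤ B) (h : ∀ k : ℤ, ‖a k‖ * (k : ℝ) ^ 4 ≤ B)
    {K : ℕ} (hK : 0 < K) {N : ℕ} (hN : K ≤ N) :
    ‖∑ k ∈ Finset.Icc (-(N : ℤ)) N, a k - ∑ k ∈ Finset.Icc (-(K : ℤ)) K, a k‖ ≤ 2 * B / K ^ 3 := by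
  have hk : ∀ k : ℤ, k ≠ 0 → ‖a k‖ ≤ B / (k : ℝ) ^ 4 := fun k hk0 => by
    rw [le_div_iff₀ (by positivity)]; exact h k
  have h1 : ‖∑ k ∈ Finset.Icc (-(N : ℤ)) N, a k - ∑ k ∈ Finset.Icc (-(K : ℤ)) K, a k‖
      ≤ 2 * B / K ^ 2 * ∑ i ∈ Finset.Ioc K N, ((i : ℝ) ^ 2)⁻¹ := by
    induction N, hN using Nat.le_induction with
    | base => simp
    | succ N hN ih =>
      rw [sum_Icc_neg_succ, ← Finset.insert_Ioc_right_eq_Ioc_add_one hN, Finset.sum_insert (by simp),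
        mul_add, ← add_assoc, add_sub_assoc]
      refine (norm_add_le _ _).trans (add_le_add ((norm_add_le _ _).trans ?_) ih)
      have hpos : (0 : ℝ) < K := by exact_mod_cast hK
      have hKN : (K : ℝ) ≤ ((N + 1 : ℕ) : ℝ) := by exact_mod_cast hN.trans (Nat.le_succ N)
      have b1 := hk ((N + 1 : ℕ) : ℤ) (by positivity)
      have b2 := hk (-((N + 1 : ℕ) : ℤ)) (neg_ne_zero.2 (by positivity))
      have b3 : B / ((N + 1 : ℕ) : ℝ) ^ 4 ≤ B / K ^ 2 * (((N + 1 : ℕ) : ℝ) ^ 2)⁻¹ := by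
        rw [← div_eq_mul_inv, div_div]
        refine div_le_div_of_nonneg_left hB (by positivity) ?_
        calc (K : ℝ) ^ 2 * ((N + 1 : ℕ) : ℝ) ^ 2
            ≤ ((N + 1 : ℕ) : ℝ) ^ 2 * ((N + 1 : ℕ) : ℝ) ^ 2 := by gcongr
          _ = _ := by ring
      rw [Int.cast_natCast] at b1
      rw [Int.cast_neg, Int.cast_natCast, Even.neg_pow (by decide)] at b2
      calc _ ≤ B / K ^ 2 * (((N + 1 : ℕ) : ℝ) ^ 2)⁻¹ + B / K ^ 2 * (((N + 1 : ℕ) : ℝ) ^ 2)⁻¹ :=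
            add_le_add (b1.trans b3) (b2.trans b3)
        _ = _ := by push_cast; ring
  -- Two factors of each k⁻⁴ are bounded by K⁻², and the remaining k⁻² sum to at most K⁻¹. The bound
  -- is uniform in N, so it survives the limit.
  have h2 : ∑ i ∈ Finset.Ioc K N, ((i : ℝ) ^ 2)⁻¹ ≤ (K : ℝ)⁻¹ :=
    (sum_Ioc_inv_sq_le_sub hK.ne' hN).trans (sub_le_self _ (by positivity))
  calc _ ≤ 2 * B / K ^ 2 * (K : ℝ)⁻¹ := h1.trans (by gcongr)
    _ = _ := by rw [← div_eq_mul_inv, div_div, ← pow_succ]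

theorem exists_cutoff_const {f : ℝ → ℝ} (hf : Admissible f) :
    ∃ B : ℝ, 0 ≤ B ∧ ∀ K : ℕ, 0 < K → ∀ x ∈ Icc (-1 : ℝ) 1,
      ‖(fTilde f x : ℂ) - ∑ k ∈ Finset.Icc (-(K : ℤ)) K,
        coeff f k * Complex.exp (Complex.I * k * Real.pi * x)‖ ≤ B / K ^ 3 := by
  obtain ⟨B, hB, h⟩ := exists_coeff_bound hf
  refine ⟨2 * B, by positivity, fun K hK x hx => ?_⟩
  have hlim := (hasSum_fTilde hf hx).comp (Finset.tendsto_Icc_neg (R := ℤ))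
  refine le_of_tendsto ((hlim.sub_const _).norm) ?_
  filter_upwards [Filter.eventually_ge_atTop K] with N hN
  refine norm_partial_sub_le hB (fun k => ?_) hK hN
  rw [norm_mul, norm_cexp_I_mul, mul_one]
  exact h k

/-- With error B/K³ it suffices that K³ > 6Bt/ε. Here M³ ≥ M > 6B supplies the constant strictly,
and the ceiling of the cube root supplies t/ε. -/
theorem exists_cutoff_bound {f : ℝ → ℝ} (hf : Admissible f) :
    ∃ M : ℕ, ∀ t ε : ℝ, 0 < t → 0 < ε → IsCutoff f t ε (M * ⌈(t / ε) ^ (1 / 3 : ℝ)⌉₊) := by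
  obtain ⟨B, hB, h⟩ := exists_cutoff_const hf
  refine ⟨⌈6 * B⌉₊ + 1, fun t ε ht hε => ?_⟩
  set x := (t / ε) ^ (1 / 3 : ℝ) with hx
  have hte : 0 < t / ε := div_pos ht hε
  have hx0 : 0 < x := Real.rpow_pos_of_pos hte _
  have hx3 : x ^ 3 = t / ε := by
    rw [hx, ← Real.rpow_natCast, ← Real.rpow_mul hte.le]; norm_num
  have hc : 0 < ⌈x⌉₊ := Nat.ceil_pos.2 hx0
  refine ⟨by positivity, fun y hy => lt_of_le_of_lt (h _ (by positivity) y hy) ?_⟩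
  have h1 : 6 * B < ((⌈6 * B⌉₊ + 1 : ℕ) : ℝ) := by
    push_cast; linarith [Nat.le_ceil (6 * B)]
  have h1' : (1 : ℝ) ≤ ((⌈6 * B⌉₊ + 1 : ℕ) : ℝ) := by push_cast; linarith [Nat.cast_nonneg (α := ℝ) ⌈6 * B⌉₊]
  have h2 : 6 * B < ((⌈6 * B⌉₊ + 1 : ℕ) : ℝ) ^ 3 := h1.trans_le (le_self_pow₀ h1' (by norm_num))
  have h3 : t / ε ≤ (⌈x⌉₊ : ℝ) ^ 3 := by
    rw [← hx3]; gcongr; exact Nat.le_ceil x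
  rw [Nat.cast_mul, mul_pow, div_lt_div_iff₀ (by positivity) (by positivity)]
  have h4 : t ≤ ε * (⌈x⌉₊ : ℝ) ^ 3 := by rwa [div_le_iff₀' hε] at h3
  calc B * (6 * t) = (6 * B) * t := by ring
    _ < ((⌈6 * B⌉₊ + 1 : ℕ) : ℝ) ^ 3 * t := by gcongr
    _ ≤ ((⌈6 * B⌉₊ + 1 : ℕ) : ℝ) ^ 3 * (ε * (⌈x⌉₊ : ℝ) ^ 3) := by gcongr
    _ = _ := by ring

theorem exists_isLeast_cutoff {f : ℝ → ℝ} (hf : Admissible f) {t ε : ℝ} (ht : 0 < t) (hε : 0 < ε) :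
    ∃ K, IsLeast {K | IsCutoff f t ε K} K := by
  classical
  obtain ⟨M, hM⟩ := exists_cutoff_bound hf
  have hex : ∃ K, IsCutoff f t ε K := ⟨_, hM t ε ht hε⟩
  exact ⟨Nat.find hex, Nat.find_spec hex, fun K hK => Nat.find_min' hex hK⟩

theorem exists_least_cutoff_le {f : ℝ → ℝ} (hf : Admissible f) :
    ∃ B : ℝ, ∀ t ε : ℝ, 0 < ε → ε ≤ t → ∀ K, IsLeast {K | IsCutoff f t ε K} K →
      (K : ℝ) ≤ B * (t / ε) ^ (1 / 3 : ℝ) := by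
  obtain ⟨M, hM⟩ := exists_cutoff_bound hf
  refine ⟨M * 2, fun t ε hε hεt K hK => ?_⟩
  have h1 : (1 : ℝ) ≤ (t / ε) ^ (1 / 3 : ℝ) :=
    Real.one_le_rpow ((one_le_div hε).2 hεt) (by norm_num)
  have h2 : K ≤ M * ⌈(t / ε) ^ (1 / 3 : ℝ)⌉₊ := hK.2 (hM t ε (hε.trans_le hεt) hε)
  calc (K : ℝ) ≤ ((M * ⌈(t / ε) ^ (1 / 3 : ℝ)⌉₊ : ℕ) : ℝ) := by exact_mod_cast h2
    _ = M * (⌈(t / ε) ^ (1 / 3 : ℝ)⌉₊ : ℝ) := by push_cast; rfl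
    _ ≤ M * (2 * (t / ε) ^ (1 / 3 : ℝ)) := by
        gcongr
        linarith [Nat.ceil_lt_add_one (zero_le_one.trans h1)]
    _ = _ := by ring

/-! #### Coefficients beyond a cutoff -/

theorem integral_cexp_orthogonal {j k : ℤ} (hjk : j ≠ k) :
    ∫ x in (-1 : ℝ)..1, Complex.exp (-(Complex.I * k * Real.pi * x)) *
      Complex.exp (Complex.I * j * Real.pi * x) = 0 := by
  have hc : Complex.I * ((j - k : ℤ) : ℂ) * Real.pi ≠ 0 := by
    refine mul_ne_zero (mul_ne_zero Complex.I_ne_zero ?_) (by exact_mod_cast Real.pi_ne_zero)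
    exact_mod_cast sub_ne_zero.2 hjk
  have e : ∀ x : ℝ, Complex.exp (-(Complex.I * k * Real.pi * x)) *
      Complex.exp (Complex.I * j * Real.pi * x)
      = Complex.exp (Complex.I * ((j - k : ℤ) : ℂ) * Real.pi * x) := by
    intro x
    rw [← Complex.exp_add]
    congr 1
    push_cast
    ring
  simp only [e]
  rw [integral_exp_mul_complex hc, div_eq_zero_iff]
  left
  rw [sub_eq_zero, Complex.exp_eq_exp_iff_exists_int]
  exact ⟨j - k, by push_cast; ring⟩

/-- A frequency beyond the cutoff is orthogonal to the partial sum, so its coefficient is a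
coefficient of the uniformly small remainder. This lower-bounds what an arbitrary cutoff must
contain. -/
theorem norm_coeff_le_of_isCutoff {f : ℝ → ℝ} (hf : Admissible f) {t ε : ℝ} {K : ℕ}
    (hK : IsCutoff f t ε K) {k : ℤ} (hk : k ∉ Finset.Icc (-(K : ℤ)) K) :
    ‖coeff f k‖ ≤ ε / (6 * t) := by
  set S : ℝ → ℂ := fun x => ∑ j ∈ Finset.Icc (-(K : ℤ)) K,
    coeff f j * Complex.exp (Complex.I * j * Real.pi * x) with hS
  have hScont : Continuous S := by rw [hS]; fun_prop
  have h0 : ∫ x in (-1 : ℝ)..1, Complex.exp (-(Complex.I * k * Real.pi * x)) * S x = 0 := by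
    have e : ∀ x : ℝ, Complex.exp (-(Complex.I * k * Real.pi * x)) * S x
        = ∑ j ∈ Finset.Icc (-(K : ℤ)) K, coeff f j * (Complex.exp (-(Complex.I * k * Real.pi * x)) *
          Complex.exp (Complex.I * j * Real.pi * x)) := by
      intro x
      rw [hS, Finset.mul_sum]
      exact Finset.sum_congr rfl fun j _ => by ring
    simp only [e]
    rw [intervalIntegral.integral_finsetSum fun j _ => Continuous.intervalIntegrable (by fun_prop) _ _]
    refine Finset.sum_eq_zero fun j hj => ?_
    rw [intervalIntegral.integral_const_mul, integral_cexp_orthogonal (fun h => hk (by rwa [← h])), mul_zero]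
  have hi : IntervalIntegrable (fTilde f) volume (-1) 1 :=
    ContinuousOn.intervalIntegrable_of_Icc (by norm_num) (continuousOn_fTilde hf)
  have e : coeff f k = 1 / 2 * ∫ x in (-1 : ℝ)..1,
      Complex.exp (-(Complex.I * k * Real.pi * x)) * ((fTilde f x : ℂ) - S x) := by
    simp only [mul_sub]
    rw [intervalIntegral.integral_sub (intervalIntegrable_cexp_mul hi k)
      (Continuous.intervalIntegrable (by fun_prop) _ _), h0, sub_zero, coeff]
  have hb : ‖∫ x in (-1 : ℝ)..1, Complex.exp (-(Complex.I * k * Real.pi * x)) *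
      ((fTilde f x : ℂ) - S x)‖ ≤ ε / (6 * t) * |1 - (-1 : ℝ)| := by
    refine intervalIntegral.norm_integral_le_of_norm_le_const fun x hx => ?_
    rw [uIoc_of_le (by norm_num)] at hx
    rw [norm_mul, norm_cexp_neg_I_mul, one_mul]
    exact (hK.2 x (Ioc_subset_Icc_self hx)).le
  rw [e, norm_mul]
  norm_num at hb ⊢
  linarith

/-! #### The mean value -/

/-- Second difference with step `1/8` that annihilates the frequency `ω` with `q = 2 cos (ω/8)`. -/
def secondDiff (q : ℝ) (g : ℝ → ℂ) (x : ℝ) : ℂ := g (x + 1 / 8) + g (x - 1 / 8) - q * g x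

theorem secondDiff_sum {ι : Type*} [Fintype ι] {P : ι → ℝ → ℂ} {q : ι → ℝ}
    (hP : ∀ i x, P i (x + 1 / 8) + P i (x - 1 / 8) = q i * P i x) (a : ι → ℂ) (r : ℝ) :
    secondDiff r (fun x => ∑ i, a i * P i x) = fun x => ∑ i, (a i * (q i - r)) * P i x := by
  funext x
  simp only [secondDiff, Finset.mul_sum]
  rw [← Finset.sum_add_distrib, ← Finset.sum_sub_distrib]
  refine Finset.sum_congr rfl fun i _ => ?_
  linear_combination a i * hP i x

theorem norm_secondDiff_sub_le {g : ℝ → ℂ} {c : ℂ} {Q y r q : ℝ} (hq : |q| ≤ 2)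
    (h : ∀ x, |x - y| ≤ r + 1 / 8 → ‖g x - c‖ ≤ Q) (x : ℝ) (hx : |x - y| ≤ r) :
    ‖secondDiff q g x - (2 - q) * c‖ ≤ 4 * Q := by
  have e : secondDiff q g x - (2 - q) * c
      = (g (x + 1 / 8) - c) + (g (x - 1 / 8) - c) - q * (g x - c) := by
    rw [secondDiff]; ring
  rw [abs_le] at hx
  have h1 := h (x + 1 / 8) (by rw [abs_le]; constructor <;> linarith [hx.1, hx.2])
  have h2 := h (x - 1 / 8) (by rw [abs_le]; constructor <;> linarith [hx.1, hx.2])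
  have h3 := h x (by rw [abs_le]; constructor <;> linarith [hx.1, hx.2])
  have h4 : ‖(q : ℂ) * (g x - c)‖ ≤ 2 * Q := by
    rw [norm_mul, Complex.norm_real]
    exact mul_le_mul hq h3 (norm_nonneg _) zero_le_two
  rw [e]
  calc _ ≤ ‖g (x + 1 / 8) - c‖ + ‖g (x - 1 / 8) - c‖ + ‖(q : ℂ) * (g x - c)‖ :=
        (norm_sub_le _ _).trans (add_le_add_left (norm_add_le _ _) _)
    _ ≤ 4 * Q := by linarith

/-- The constant coefficient is dominated by the others. -/
theorem exists_norm_coeff_zero_le : ∃ A : ℝ, 0 < A ∧ ∀ f : ℝ → ℝ, Admissible f →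
    ‖coeff f 0‖ ≤ A * ∑' k : ℤ, ‖coeff f k‖ * (k : ℝ) ^ 2 := by
  set q : Fin 4 → ℝ := fun i => 2 * Real.cos (((i : ℕ) + 1 : ℝ) * Real.pi * (1 / 8)) with hq
  have hq2 : ∀ i, |q i| ≤ 2 := fun i => by
    rw [hq, abs_mul, abs_two]
    linarith [Real.abs_cos_le_one (((i : ℕ) + 1 : ℝ) * Real.pi * (1 / 8))]
  have hq1 : ∀ i, 0 < 2 - q i := fun i => by
    have hi : ((i : ℕ) : ℝ) ≤ 3 := by exact_mod_cast Nat.lt_succ_iff.1 i.2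
    have h1 : Real.cos (((i : ℕ) + 1 : ℝ) * Real.pi * (1 / 8)) < Real.cos 0 := by
      refine Real.cos_lt_cos_of_nonneg_of_le_pi_div_two le_rfl ?_ (by positivity)
      nlinarith [Real.pi_pos]
    rw [Real.cos_zero] at h1
    simp only [hq]
    linarith
  -- On [-1, 0] the function f̃ has only the frequencies 1 to 4, and f̃ - c̃₀ is bounded by Q. Four
  -- second differences annihilate these frequencies and multiply a constant by W > 0, while each
  -- amplifies the bound Q by at most 4. Hence W|c̃₀| ≤ 256 Q.
  set W : ℝ := (2 - q 3) * ((2 - q 2) * ((2 - q 1) * (2 - q 0))) with hW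
  have hW0 : 0 < W := by have := hq1; simp only [hW]; positivity [hq1 0, hq1 1, hq1 2, hq1 3]
  refine ⟨256 / W, by positivity, fun f hf => ?_⟩
  set Q := ∑' k : ℤ, ‖coeff f k‖ * (k : ℝ) ^ 2 with hQ
  have hclose : ∀ x ∈ Icc (-1 : ℝ) 1, ‖(fTilde f x : ℂ) - coeff f 0‖ ≤ Q := by
    intro x hx
    have h1 := (hasSum_fTilde hf hx).update (0 : ℤ) 0
    simp only [Int.cast_zero, mul_zero, zero_mul, Complex.exp_zero, mul_one] at h1
    have h2 : HasSum (fun k : ℤ => ‖coeff f k‖ * (k : ℝ) ^ 2) Q := (summable_coeff_sq hf).hasSum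
    have h3 := h1.norm_le_of_bounded h2 fun k => by
      rcases eq_or_ne k 0 with rfl | hk
      · simp
      · rw [Function.update_of_ne hk, norm_mul, norm_cexp_I_mul, mul_one]
        exact le_mul_of_one_le_right (norm_nonneg _) (one_le_sq_intCast hk)
    rwa [show (fTilde f x : ℂ) - coeff f 0 = 0 - coeff f 0 + fTilde f x by ring]
  set P : Fin 4 → ℝ → ℂ := fun i x =>
    ((cosCoeff f i * Real.cos (((i : ℕ) + 1 : ℝ) * Real.pi * x) +
      sinCoeff f i / ((i : ℕ) + 1 : ℝ) * Real.sin (((i : ℕ) + 1 : ℝ) * Real.pi * x) : ℝ) : ℂ) with hP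
  have hPq : ∀ i x, P i (x + 1 / 8) + P i (x - 1 / 8) = q i * P i x := by
    intro i x
    simp only [hP, hq]
    rw [← Complex.ofReal_add, ← Complex.ofReal_mul]
    congr 1
    rw [mul_add, mul_sub, Real.cos_add, Real.cos_sub, Real.sin_add, Real.sin_sub]
    ring
  set g : ℝ → ℂ := fun x => ∑ i, 1 * P i x with hg
  have hgext : ∀ x, g x = (gExt f x : ℂ) := by
    intro x
    simp only [hg, hP, gExt, one_mul]
    push_cast
    rfl
  have hg0 : ∀ x, |x - (-1 / 2)| ≤ 3 / 8 + 1 / 8 → ‖g x - coeff f 0‖ ≤ Q := by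
    intro x hx
    rw [abs_le] at hx
    rcases lt_or_ge x 0 with h | h
    · have := hclose x ⟨by linarith, by linarith⟩
      rwa [fTilde, if_pos h, ← hgext] at this
    · have hx0 : x = 0 := by linarith
      have e : fTilde f 0 = gExt f 0 := by
        rw [← gExtDer_zero, gExtDer_at_zero f (Nat.zero_le _), fTilde, if_neg (lt_irrefl _)]
        simp [der]
      have := hclose x ⟨by linarith, by linarith⟩
      rwa [hx0, e, ← hgext, ← hx0] at this
  -- Each difference uses up 1/8 of the radius 1/2 around -1/2, so four of them just fit into [-1,
  -- 0].
  have s1 := norm_secondDiff_sub_le (y := -1 / 2) (r := 3 / 8) (hq2 0) hg0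
  have s2 := norm_secondDiff_sub_le (y := -1 / 2) (r := 2 / 8) (hq2 1) (fun x hx => s1 x (by linarith))
  have s3 := norm_secondDiff_sub_le (y := -1 / 2) (r := 1 / 8) (hq2 2) (fun x hx => s2 x (by linarith))
  have s4 := norm_secondDiff_sub_le (y := -1 / 2) (r := 0) (hq2 3) (fun x hx => s3 x (by linarith)) (-1 / 2)
    (by simp)
  rw [hg, secondDiff_sum hPq, secondDiff_sum hPq, secondDiff_sum hPq, secondDiff_sum hPq] at s4
  simp only [Fin.sum_univ_four, sub_self, mul_zero, zero_mul, add_zero, zero_sub, norm_neg] at s4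
  have e : (2 - (q 3 : ℂ)) * ((2 - (q 2 : ℂ)) * ((2 - (q 1 : ℂ)) * ((2 - (q 0 : ℂ)) * coeff f 0)))
      = (W : ℂ) * coeff f 0 := by
    simp only [hW]; push_cast; ring
  rw [e, norm_mul, Complex.norm_real, Real.norm_of_nonneg hW0.le] at s4
  rw [div_mul_eq_mul_div, le_div_iff₀ hW0]
  linarith

theorem eq_zero_of_tsum_coeff_eq_zero {f : ℝ → ℝ} (hf : Admissible f)
    (h : ∑' k : ℤ, ‖coeff f k‖ * (k : ℝ) ^ 2 = 0) : ∀ x ∈ Icc (-1 : ℝ) 1, f x = 0 := by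
  obtain ⟨A, -, hA⟩ := exists_norm_coeff_zero_le
  have h0 : ‖coeff f 0‖ = 0 := le_antisymm ((hA f hf).trans (by rw [h, mul_zero])) (norm_nonneg _)
  have hall : ∀ k : ℤ, coeff f k = 0 := by
    intro k
    rcases eq_or_ne k 0 with rfl | hk
    · exact norm_eq_zero.1 h0
    · have h1 : ‖coeff f k‖ * (k : ℝ) ^ 2 ≤ 0 := h ▸ (summable_coeff_sq hf).le_tsum k
        (fun j _ => by positivity)
      have h2 : 0 < (k : ℝ) ^ 2 := by positivity
      exact norm_eq_zero.1 (le_antisymm (nonpos_of_mul_nonpos_left h1 h2) (norm_nonneg _))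
  intro x hx
  have hx' : (x + 1) / 2 ∈ Icc (-1 : ℝ) 1 := ⟨by linarith [hx.1], by linarith [hx.2]⟩
  have h1 := hasSum_fTilde hf hx'
  simp only [hall, zero_mul] at h1
  have h2 : fTilde f ((x + 1) / 2) = 0 := by exact_mod_cast h1.unique hasSum_zero
  rw [fTilde, if_neg (by linarith [hx.1])] at h2
  rwa [show 2 * ((x + 1) / 2) - 1 = x by ring] at h2

theorem tsum_coeff_sq_pos {f : ℝ → ℝ} (hf : Admissible f) (h : ∃ x ∈ Icc (-1 : ℝ) 1, f x ≠ 0) :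
    0 < ∑' k : ℤ, ‖coeff f k‖ * (k : ℝ) ^ 2 := by
  refine lt_of_le_of_ne (tsum_nonneg fun k => by positivity) fun h0 => ?_
  obtain ⟨x, hx, hfx⟩ := h
  exact hfx (eq_zero_of_tsum_coeff_eq_zero hf h0.symm x hx)

end FourierSeries
end UHET

end

noncomputable section

namespace UHET

/-! ### Runtime of the pre-processing -/

section PreRuntime

variable {n : ℕ}

theorem length_ctrlPauli (v : Fin n → Fin 4) : (ctrlPauli v).length = n := List.length_ofFn

theorem length_controlization {M : ℕ} (τ : ℝ) (v : Fin M → Fin n → Fin 4) :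
    (controlization τ v).length = M * (2 * n + 1) := by
  have h : ∀ u : Fin n → Fin 4, (ctrlPauli u ++ [Gate.query τ] ++ ctrlPauli u).length = 2 * n + 1 := by
    intro u
    simp only [List.length_append, length_ctrlPauli, List.length_singleton]
    ring
  simp only [controlization, List.length_flatMap, h, List.map_const', List.sum_replicate,
    List.length_ofFn, smul_eq_mul]

theorem length_inv (c : Circuit n) : (Circuit.inv c).length = c.length := by
  simp [Circuit.inv]

theorem length_flatten_map_of_const {ι : Type*} (F : ι → Circuit n) {L : ℕ}
    (h : ∀ i, (F i).length = L) {N : ℕ} (s : Fin N → ι) :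
    (((List.ofFn s).reverse.map F).flatten).length = N * L := by
  simp [List.length_flatten, Function.comp_def, h]

theorem trialRuntime_eq (n l k : ℕ) : trialRuntime n l k
    = prepN k * (2 * (1 + (25 * k + 10) * l ^ 2 * (2 * n + 1)) + 1) + 1 := by
  unfold trialRuntime Circuit.runtime prepCircuit
  rw [length_flatten_map_of_const (L := 2 * (1 + (25 * k + 10) * l ^ 2 * (2 * n + 1)) + 1)]
  intro j
  simp only [prepStep, prepW, List.length_append, length_inv, length_controlization,
    List.length_singleton]
  ring

theorem sq_le_prepN (k : ℕ) : (k : ℝ) ^ 2 ≤ prepN k := by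
  refine le_trans ?_ (Nat.le_ceil _)
  refine le_max_of_le_left ?_
  have h2 : (1 : ℝ) ≤ √2 := Real.one_le_sqrt.2 (by norm_num)
  have h3 : (1 : ℝ) ≤ Real.pi ^ 2 := one_le_pow₀ (by linarith [Real.pi_gt_three])
  rw [div_div_eq_mul_div, div_one, mul_pow]
  have : (1 : ℝ) ≤ 40 * (Real.pi ^ 2 * √2) := by nlinarith [one_le_mul_of_one_le_of_one_le h3 h2]
  calc (k : ℝ) ^ 2 ≤ (k : ℝ) ^ 2 * (40 * (Real.pi ^ 2 * √2)) := le_mul_of_one_le_right (by positivity) this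
    _ = _ := by ring

theorem prepN_le {k : ℕ} (hk : 0 < k) : (prepN k : ℝ) ≤ 601 * (k : ℝ) ^ 2 := by
  have hk1 : (1 : ℝ) ≤ k := by exact_mod_cast hk
  have h2 : √2 ≤ 1.5 := by rw [Real.sqrt_le_left (by norm_num)]; norm_num
  have hmax : max (10 * (1 : ℝ) ^ 2 * (k * Real.pi) ^ 2 / (1 / (4 * √2))) (5 * 1 * (k * Real.pi) / 2)
      ≤ 600 * (k : ℝ) ^ 2 := by
    refine max_le ?_ ?_
    · rw [div_div_eq_mul_div, div_one, mul_pow]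
      have : Real.pi ^ 2 * √2 ≤ 10 * 1.5 := by
        gcongr
        exact pi_sq_le_ten
      nlinarith [sq_nonneg (k : ℝ)]
    · nlinarith [Real.pi_lt_four, Real.pi_pos]
  refine (Nat.ceil_lt_add_one ?_).le.trans ?_
  · exact le_max_of_le_right (by positivity)
  · nlinarith

theorem trialRuntime_le {n l k : ℕ} (hn : 0 < n) (hl : 0 < l) (hk : 0 < k) :
    (trialRuntime n l k : ℝ) ≤ 130000 * ((k : ℝ) ^ 3 * l ^ 2 * n) := by
  have hn1 : (1 : ℝ) ≤ n := by exact_mod_cast hn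
  have hk1 : (1 : ℝ) ≤ k := by exact_mod_cast hk
  have hl1 : (1 : ℝ) ≤ (l : ℝ) ^ 2 := one_le_pow₀ (by exact_mod_cast hl)
  have h1 : (1 : ℝ) ≤ k * l ^ 2 * n := by
    have := one_le_mul_of_one_le_of_one_le (one_le_mul_of_one_le_of_one_le hk1 hl1) hn1
    exact this
  have h3 : (1 : ℝ) ≤ (k : ℝ) ^ 3 * l ^ 2 * n :=
    one_le_mul_of_one_le_of_one_le (one_le_mul_of_one_le_of_one_le (one_le_pow₀ hk1) hl1) hn1
  have hN := prepN_le hk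
  rw [trialRuntime_eq]
  push_cast
  have h2 : (25 * k + 10 : ℝ) * l ^ 2 * (2 * n + 1) ≤ 105 * (k * l ^ 2 * n) := by
    calc (25 * k + 10 : ℝ) * l ^ 2 * (2 * n + 1) ≤ (35 * k) * l ^ 2 * (3 * n) := by
          gcongr <;> linarith
      _ = _ := by ring
  calc (prepN k : ℝ) * (2 * (1 + (25 * k + 10) * l ^ 2 * (2 * n + 1)) + 1) + 1
      ≤ (601 * (k : ℝ) ^ 2) * (213 * (k * l ^ 2 * n)) + (k : ℝ) ^ 3 * l ^ 2 * n := by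
        gcongr
        linarith
    _ = 128014 * ((k : ℝ) ^ 3 * l ^ 2 * n) := by ring
    _ ≤ _ := by gcongr; norm_num

theorem le_trialRuntime (n l k : ℕ) : (k : ℝ) ^ 3 * l ^ 2 * n ≤ trialRuntime n l k := by
  rw [trialRuntime_eq]
  push_cast
  have h2 : (k * l ^ 2 * n : ℝ) ≤ 2 * (1 + (25 * k + 10) * l ^ 2 * (2 * n + 1)) + 1 := by
    have h : (0 : ℝ) ≤ k * l ^ 2 * n := by positivity
    have h' : (0 : ℝ) ≤ k * l ^ 2 := by positivity
    have h'' : (0 : ℝ) ≤ l ^ 2 * n := by positivity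
    have h4 : (0 : ℝ) ≤ (l : ℝ) ^ 2 := by positivity
    nlinarith
  calc (k : ℝ) ^ 3 * (l : ℝ) ^ 2 * (n : ℝ) = (k : ℝ) ^ 2 * (k * l ^ 2 * n) := by ring
    _ ≤ (prepN k : ℝ) * (2 * (1 + (25 * k + 10) * l ^ 2 * (2 * n + 1)) + 1) := by
        gcongr
        exact sq_le_prepN k
    _ ≤ _ := by linarith

theorem preRuntime_eq (n : ℕ) (f : ℝ → ℝ) (t ε : ℝ) (K : ℕ) (T : ℝ) : preRuntime n f t ε K T
    = T + ∑ i : Fin K, ∑ j : Fin (numGen f t ε),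
      (4 * ((reps _ j : ℝ) * trialRuntime n ((i : ℕ) + 1) (2 ^ (j : ℕ))) + 2) := by
  unfold preRuntime
  congr 1
  refine Finset.sum_congr rfl fun i _ => ?_
  simp only [Fintype.sum_bool, ← Finset.sum_add_distrib]
  exact Finset.sum_congr rfl fun j _ => by ring

theorem three_mul_add_one_le_four_pow (i : ℕ) : 3 * i + 1 ≤ 4 ^ i := by
  induction i with
  | zero => simp
  | succ i ih => rw [pow_succ]; omega

/-- The repetitions grow only linearly towards early generations and are bounded by 4^{G-1-j}. The
cost 8^j of one trial dominates, so the sum is of the order of its last term. -/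
theorem sum_reps_mul_le (G : ℕ) :
    ∑ j : Fin G, (reps G j : ℝ) * 8 ^ (j : ℕ) ≤ rpeConst * 8 ^ G := by
  have h1 : ∀ j : Fin G, (reps G j : ℝ) * 8 ^ (j : ℕ)
      ≤ rpeConst * (8 ^ (j : ℕ) * 4 ^ (G - 1 - (j : ℕ))) := by
    intro j
    have : ((3 * (G - 1 - (j : ℕ)) + 1 : ℕ) : ℝ) ≤ ((4 ^ (G - 1 - (j : ℕ)) : ℕ) : ℝ) := by
      exact_mod_cast three_mul_add_one_le_four_pow _
    calc (reps G j : ℝ) * 8 ^ (j : ℕ)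
        = rpeConst * ((3 * (G - 1 - (j : ℕ)) + 1 : ℕ) : ℝ) * 8 ^ (j : ℕ) := by
          rw [reps, Nat.cast_mul]
      _ ≤ rpeConst * ((4 ^ (G - 1 - (j : ℕ)) : ℕ) : ℝ) * 8 ^ (j : ℕ) := by gcongr
      _ = _ := by push_cast; ring
  refine (Finset.sum_le_sum fun j _ => h1 j).trans ?_
  rw [← Finset.mul_sum, Fin.sum_univ_eq_sum_range fun j => (8 : ℝ) ^ j * 4 ^ (G - 1 - j)]
  gcongr
  have := geom_sum₂_mul (8 : ℝ) 4 G
  have h4 : (0 : ℝ) ≤ 4 ^ G := by positivity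
  have h8 : (0 : ℝ) ≤ 8 ^ G := by positivity
  linarith

theorem sum_sq_le (K : ℕ) : ∑ i : Fin K, (((i : ℕ) + 1 : ℕ) : ℝ) ^ 2 ≤ (K : ℝ) ^ 3 := by
  calc ∑ i : Fin K, (((i : ℕ) + 1 : ℕ) : ℝ) ^ 2 ≤ ∑ _i : Fin K, (K : ℝ) ^ 2 := by
        refine Finset.sum_le_sum fun i _ => ?_
        have : (((i : ℕ) + 1 : ℕ) : ℝ) ≤ K := by exact_mod_cast i.2
        gcongr
    _ = _ := by rw [Finset.sum_const, Finset.card_univ, Fintype.card_fin, nsmul_eq_mul]; ring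

theorem le_sum_sq (K : ℕ) : (K : ℝ) ^ 3 / 3 ≤ ∑ i : Fin K, (((i : ℕ) + 1 : ℕ) : ℝ) ^ 2 := by
  induction K with
  | zero => simp
  | succ K ih =>
    rw [Fin.sum_univ_castSucc]
    simp only [Fin.val_castSucc, Fin.val_last]
    refine le_trans ?_ (add_le_add_left ih _)
    push_cast
    nlinarith [(Nat.cast_nonneg K : (0 : ℝ) ≤ K)]

theorem one_le_reps {G : ℕ} (j : Fin G) : (1 : ℝ) ≤ reps G j := by
  have h : 1 ≤ rpeConst := by have := two_thousand_le_rpeConst; omega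
  have : 1 ≤ reps G j := Nat.mul_pos h (Nat.succ_pos _)
  exact_mod_cast this

theorem preRuntime_le {n : ℕ} (hn : 0 < n) (f : ℝ → ℝ) (t ε : ℝ) (K : ℕ) (T : ℝ) :
    preRuntime n f t ε K T ≤ 780000 * rpeConst * ((K : ℝ) ^ 3 * n * 8 ^ numGen f t ε) + T := by
  rw [preRuntime_eq, add_comm T]
  gcongr
  calc _ ≤ ∑ i : Fin K, ∑ j : Fin (numGen f t ε),
        780000 * n * ((((i : ℕ) + 1 : ℕ) : ℝ) ^ 2 * ((reps _ j : ℝ) * 8 ^ (j : ℕ))) := by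
        refine Finset.sum_le_sum fun i _ => Finset.sum_le_sum fun j _ => ?_
        have h1 := trialRuntime_le hn (Nat.succ_pos (i : ℕ)) (pow_pos (by norm_num : 0 < 2) (j : ℕ))
        have h2 : (1 : ℝ) ≤ trialRuntime n ((i : ℕ) + 1) (2 ^ (j : ℕ)) := by
          rw [trialRuntime_eq]; push_cast; exact le_add_of_nonneg_left (by positivity)
        have h3 := one_le_reps j
        have h4 : (1 : ℝ) ≤ (reps _ j : ℝ) * trialRuntime n ((i : ℕ) + 1) (2 ^ (j : ℕ)) :=
          one_le_mul_of_one_le_of_one_le h3 h2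
        have e : ((2 ^ (j : ℕ) : ℕ) : ℝ) ^ 3 = 8 ^ (j : ℕ) := by
          push_cast; rw [← pow_mul, mul_comm, pow_mul]; norm_num
        rw [e] at h1
        -- The four families of measurements (two angles, two bases), with the two updates absorbed
        -- since the product is at least 1.
        calc _ ≤ 6 * ((reps _ j : ℝ) * trialRuntime n ((i : ℕ) + 1) (2 ^ (j : ℕ))) := by linarith
          _ ≤ 6 * ((reps _ j : ℝ) * (130000 * (8 ^ (j : ℕ) * (((i : ℕ) + 1 : ℕ) : ℝ) ^ 2 * n))) := by
              gcongr
          _ = _ := by ring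
    _ = 780000 * n * ((∑ i : Fin K, (((i : ℕ) + 1 : ℕ) : ℝ) ^ 2) *
          ∑ j : Fin (numGen f t ε), (reps _ j : ℝ) * 8 ^ (j : ℕ)) := by
        rw [Finset.sum_mul_sum]
        simp only [Finset.mul_sum]
    _ ≤ 780000 * n * ((K : ℝ) ^ 3 * (rpeConst * 8 ^ numGen f t ε)) := by
        gcongr
        · exact sum_sq_le K
        · exact sum_reps_mul_le _
    _ = _ := by ring

theorem numGen_pos (f : ℝ → ℝ) (t ε : ℝ) : 0 < numGen f t ε :=
  lt_of_lt_of_le Nat.one_pos (le_max_left _ _)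

theorem le_preRuntime (n : ℕ) (f : ℝ → ℝ) (t ε : ℝ) (K : ℕ) (T : ℝ) :
    1 / 6 * ((K : ℝ) ^ 3 * n * 8 ^ numGen f t ε) + T ≤ preRuntime n f t ε K T := by
  rw [preRuntime_eq, add_comm T]
  gcongr
  have hG := numGen_pos f t ε
  set G := numGen f t ε
  have e8 : (8 : ℝ) ^ G = 8 * 8 ^ (G - 1) := by
    rw [← pow_succ', Nat.sub_add_cancel hG]
  calc 1 / 6 * ((K : ℝ) ^ 3 * n * 8 ^ G) = 4 * ((K : ℝ) ^ 3 / 3 * (8 ^ (G - 1) * n)) := by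
        rw [e8]; ring
    _ ≤ 4 * ((∑ i : Fin K, (((i : ℕ) + 1 : ℕ) : ℝ) ^ 2) * (8 ^ (G - 1) * n)) := by
        gcongr
        exact le_sum_sq K
    _ = ∑ i : Fin K, 4 * (8 ^ (G - 1) * (((i : ℕ) + 1 : ℕ) : ℝ) ^ 2 * n) := by
        rw [Finset.sum_mul, Finset.mul_sum]
        exact Finset.sum_congr rfl fun i _ => by ring
    _ ≤ _ := by
        refine Finset.sum_le_sum fun i _ => ?_
        -- The last generation alone provides the lower bound, with 8^{G-1} = 8^G / 8.
        refine le_trans ?_ (Finset.single_le_sum (fun j _ => by positivity)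
          (Finset.mem_univ (⟨G - 1, Nat.sub_lt hG Nat.one_pos⟩ : Fin G)))
        have h1 := le_trialRuntime n ((i : ℕ) + 1) (2 ^ (G - 1))
        have h3 := one_le_reps (⟨G - 1, Nat.sub_lt hG Nat.one_pos⟩ : Fin G)
        have e : ((2 ^ (G - 1) : ℕ) : ℝ) ^ 3 = 8 ^ (G - 1) := by
          push_cast; rw [← pow_mul, mul_comm, pow_mul]; norm_num
        rw [e] at h1
        have h5 : (trialRuntime n ((i : ℕ) + 1) (2 ^ (G - 1)) : ℝ)
          ≤ (reps G ⟨G - 1, Nat.sub_lt hG Nat.one_pos⟩ : ℝ) *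
            trialRuntime n ((i : ℕ) + 1) (2 ^ (G - 1)) :=
          le_mul_of_one_le_left (Nat.cast_nonneg _) h3
        dsimp only
        linarith

/-! ### The number of generations in terms of t/ε, and the resulting bounds. -/

theorem le_two_pow_generations {s : ℝ} (hs : 0 < s) : 3 * Real.pi / s ≤ 2 ^ generations s := by
  have hy : 0 < 3 * Real.pi / s := by positivity
  rw [← Real.rpow_natCast, ← Real.logb_le_iff_le_rpow (by norm_num) hy]
  refine (Nat.le_ceil _).trans ?_
  exact_mod_cast le_max_right 1 _

theorem two_pow_generations_le {s : ℝ} (hs : 0 < s) :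
    (2 : ℝ) ^ generations s ≤ 2 + 2 * (3 * Real.pi / s) := by
  have hy : 0 < 3 * Real.pi / s := by positivity
  rcases le_total ⌈Real.logb 2 (3 * Real.pi / s)⌉₊ 1 with h | h
  · rw [generations, max_eq_left h]; linarith
  · rw [generations, max_eq_right h]
    have h0 : 0 ≤ Real.logb 2 (3 * Real.pi / s) := by
      by_contra hneg
      rw [Nat.ceil_eq_zero.2 (not_le.1 hneg).le] at h
      omega
    have h1 := (Nat.ceil_lt_add_one h0).le
    have h2 : (2 : ℝ) ^ (Real.logb 2 (3 * Real.pi / s) + 1) = 3 * Real.pi / s * 2 := by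
      rw [Real.rpow_add (by norm_num), Real.rpow_logb (by norm_num) (by norm_num) hy, Real.rpow_one]
    rw [← Real.rpow_natCast]
    refine (Real.rpow_le_rpow_of_exponent_le (by norm_num) h1).trans ?_
    rw [h2]; linarith

theorem tsum_coeff_abs_pos {f : ℝ → ℝ} (hf : Admissible f)
    (h : ∃ x ∈ Set.Icc (-1 : ℝ) 1, f x ≠ 0) : 0 < ∑' k : ℤ, ‖coeff f k‖ * |(k : ℝ)| := by
  have h2 := tsum_coeff_sq_pos hf h
  refine lt_of_le_of_ne (tsum_nonneg fun k => by positivity) fun h0 => h2.ne' ?_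
  have h1 := (summable_coeff_abs hf).hasSum
  rw [← h0, hasSum_zero_iff_of_nonneg (fun k => by positivity)] at h1
  refine (tsum_congr fun k => ?_).trans tsum_zero
  rw [← sq_abs, sq, ← mul_assoc]
  exact mul_eq_zero_of_left (congrFun h1 k) _

theorem tsum_norm_coeff_pos {f : ℝ → ℝ} (hf : Admissible f)
    (h : ∃ x ∈ Set.Icc (-1 : ℝ) 1, f x ≠ 0) : 0 < ∑' k : ℤ, ‖coeff f k‖ := by
  have h2 := tsum_coeff_sq_pos hf h
  refine lt_of_le_of_ne (tsum_nonneg fun k => by positivity) fun h0 => h2.ne' ?_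
  have h1 := (summable_norm_coeff hf).hasSum
  rw [← h0, hasSum_zero_iff_of_nonneg (fun k => by positivity)] at h1
  refine (tsum_congr fun k => ?_).trans tsum_zero
  exact mul_eq_zero_of_left (congrFun h1 k) _

theorem runConst_pos {f : ℝ → ℝ} (hf : Admissible f) (h : ∃ x ∈ Set.Icc (-1 : ℝ) 1, f x ≠ 0) :
    0 < runConst f :=
  mul_pos (tsum_norm_coeff_pos hf h) (tsum_coeff_sq_pos hf h)

theorem exists_preRuntime_bounds {f : ℝ → ℝ} (hf : Admissible f)
    (h : ∃ x ∈ Set.Icc (-1 : ℝ) 1, f x ≠ 0) : ∃ a A : ℝ, 0 < a ∧ 0 < A ∧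
      ∀ (n : ℕ) (t ε : ℝ) (K : ℕ) (T : ℝ), 0 < n → 0 < ε → ε ≤ t →
        a * ((K : ℝ) ^ 3 * t ^ 3 * n / ε ^ 3) + T ≤ preRuntime n f t ε K T ∧
        preRuntime n f t ε K T ≤ A * ((K : ℝ) ^ 3 * t ^ 3 * n / ε ^ 3) + T := by
  have hS := tsum_coeff_abs_pos hf h
  set S := ∑' k : ℤ, ‖coeff f k‖ * |(k : ℝ)| with hSd
  -- D is chosen so that the argument of the logarithm in `numGen` is D t/ε. Then 2^G is comparable
  -- to t/ε when ε ≤ t, and the cost 8^G to (t/ε)³.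
  set D := 36 * Real.pi ^ 2 * √2 * S / √3 with hD
  have hD0 : 0 < D := by positivity
  have hR : (0 : ℝ) < rpeConst := by
    have := two_thousand_le_rpeConst
    exact_mod_cast (by omega : 0 < rpeConst)
  refine ⟨1 / 6 * D ^ 3, 780000 * rpeConst * (2 + 2 * D) ^ 3, by positivity, by positivity,
    fun n t ε K T hn hε hεt => ?_⟩
  have ht : 0 < t := hε.trans_le hεt
  have hs : 0 < paramError f ε / (√2 * t) := by
    rw [paramError, ← hSd]; positivity
  have e : 3 * Real.pi / (paramError f ε / (√2 * t)) = D * (t / ε) := by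
    rw [paramError, ← hSd, hD]
    field_simp
    ring
  have h1 := le_two_pow_generations hs
  have h2 := two_pow_generations_le hs
  rw [e] at h1 h2
  change D * (t / ε) ≤ 2 ^ numGen f t ε at h1
  change 2 ^ numGen f t ε ≤ 2 + 2 * (D * (t / ε)) at h2
  have e8 : (8 : ℝ) ^ numGen f t ε = (2 ^ numGen f t ε) ^ 3 := by
    rw [← pow_mul, mul_comm, pow_mul]; norm_num
  have hte : 1 ≤ t / ε := (one_le_div hε).2 hεt
  constructor
  · refine le_trans ?_ (le_preRuntime n f t ε K T)
    refine add_le_add ?_ le_rfl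
    rw [e8]
    calc 1 / 6 * D ^ 3 * ((K : ℝ) ^ 3 * t ^ 3 * n / ε ^ 3)
        = 1 / 6 * ((K : ℝ) ^ 3 * n * (D * (t / ε)) ^ 3) := by field_simp
      _ ≤ _ := by gcongr
  · refine (preRuntime_le hn f t ε K T).trans ?_
    refine add_le_add ?_ le_rfl
    rw [e8]
    calc 780000 * (rpeConst : ℝ) * ((K : ℝ) ^ 3 * n * (2 ^ numGen f t ε) ^ 3)
        ≤ 780000 * rpeConst * ((K : ℝ) ^ 3 * n * ((2 + 2 * D) * (t / ε)) ^ 3) := by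
          gcongr
          linarith
      _ = _ := by field_simp

end PreRuntime
end UHET

end

noncomputable section

namespace UHET

/-! ### Runtime of the main process -/

section MainRuntime

variable {n K G : ℕ}

/-- The mean of a sum of functions of independent random variables. -/
theorem sum_prod_weights_mul_sum {ι : Type*} [Fintype ι] (p : ι → ℝ) (hp : ∑ i, p i = 1)
    (g : ι → ℝ) (N : ℕ) :
    ∑ s : Fin N → ι, (∏ m, p (s m)) * ∑ m, g (s m) = N * ∑ i, p i * g i := by
  induction N with
  | zero => simp
  | succ N ih =>
    rw [sum_fin_succ_pi]
    simp only [Fin.prod_univ_succ, Fin.sum_univ_succ, Fin.cons_zero, Fin.cons_succ]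
    have h : ∀ (i : ι) (s : Fin N → ι), p i * (∏ m, p (s m)) * (g i + ∑ m, g (s m))
        = p i * g i * (∏ m, p (s m)) + p i * ((∏ m, p (s m)) * ∑ m, g (s m)) := by
      intro i s; ring
    simp only [h, Finset.sum_add_distrib, ← Finset.mul_sum, ← Finset.sum_mul, ih,
      sum_prod_weights p hp, hp]
    push_cast
    ring

/-- Two controlizations with 10k² blocks of 2n + 1 gates, two Z rotations on each side and the
central rotation. -/
theorem length_mainStep (f : ℝ → ℝ) (t ε : ℝ) (ω : Record K G) (s : StepIndex n K) :
    ((mainStep f t ε ω s).length : ℝ) = 20 * (2 * n + 1) * ((s.1 : ℤ) : ℝ) ^ 2 + 5 := by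
  have h : ((((s.1 : ℤ).natAbs : ℕ) : ℝ)) ^ 2 = ((s.1 : ℤ) : ℝ) ^ 2 := by
    rw [Nat.cast_natAbs, Int.cast_abs, sq_abs]
  simp only [mainStep, wHat, wCircuit, List.length_append, length_inv, length_controlization,
    List.length_singleton]
  push_cast
  rw [h]
  ring

theorem length_mainCircuit {f : ℝ → ℝ} {t ε : ℝ} {ω : Record K G} (s : MainIndex n f t ε ω) :
    ((mainCircuit s).length : ℝ) = ∑ m, ((mainStep f t ε ω (s m)).length : ℝ) := by
  rw [mainCircuit, List.length_flatten, List.map_map, List.map_reverse, List.sum_reverse,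
    List.map_ofFn, List.sum_ofFn]
  push_cast
  rfl

theorem mainRuntime_eq (f : ℝ → ℝ) (t ε : ℝ) (ω : Record K G) (hβ : beta f ω ≠ 0) :
    mainRuntime n f t ε ω = mainN f t ε ω / beta f ω * (20 * (2 * n + 1) *
      ∑ k ∈ Finset.Icc (-(K : ℤ)) K, ‖coeff f k‖ / aHat ω k * (k : ℝ) ^ 2 + 5 * beta f ω) := by
  unfold mainRuntime Circuit.runtime
  simp only [length_mainCircuit, mainProb]
  refine (sum_prod_weights_mul_sum _ (sum_stepProb f ω hβ)
    (fun s => ((mainStep f t ε ω s).length : ℝ)) _).trans ?_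
  simp only [length_mainStep]
  rw [sum_stepProb_mul f ω fun k => 20 * (2 * n + 1) * (k : ℝ) ^ 2 + 5, mul_div_assoc', mul_comm_div,
    ← mul_div_assoc, mul_comm (mainN f t ε ω : ℝ), mul_comm (mainN f t ε ω : ℝ)]
  congr 2
  simp only [mul_add, Finset.sum_add_distrib, ← Finset.sum_mul]
  rw [Finset.mul_sum, mul_comm 5, beta]
  congr 1
  exact Finset.sum_congr rfl fun k _ => by ring

/-- The chosen representatives bound the real part by 3/2 and the imaginary part by 1/2. With the
lower bound 1/2 this makes the runtime comparable for all outcomes, good or bad. -/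
theorem aHat_le (ω : Record K G) (k : ℤ) : aHat ω k ≤ 2 := by
  unfold aHat
  split_ifs with h
  · have hpi := Real.pi_pos
    set i : Fin K := ⟨k.natAbs - 1, by omega⟩
    have h0 := toIocMod_mem_Ioc Real.two_pi_pos Real.pi (refine (phaseOf ω i false) (G - 1))
    have h1 := toIocMod_mem_Ioc Real.two_pi_pos (-Real.pi) (refine (phaseOf ω i true) (G - 1))
    have e0 : vHat ω i false
        = toIocMod Real.two_pi_pos Real.pi (refine (phaseOf ω i false) (G - 1)) := by simp [vHat]
    have e1 : vHat ω i true
        = toIocMod Real.two_pi_pos (-Real.pi) (refine (phaseOf ω i true) (G - 1)) := by simp [vHat]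
    rw [← e0] at h0
    rw [← e1] at h1
    have b0 : |vHat ω i false / (2 * Real.pi)| ≤ 3 / 2 := by
      rw [abs_div, abs_of_pos (by positivity : 0 < 2 * Real.pi), div_le_iff₀ (by positivity), abs_le]
      constructor <;> linarith [h0.1, h0.2]
    have b1 : |-(vHat ω i true / (2 * Real.pi))| ≤ 1 / 2 := by
      rw [abs_neg, abs_div, abs_of_pos (by positivity : 0 < 2 * Real.pi),
        div_le_iff₀ (by positivity), abs_le]
      constructor <;> linarith [h1.1, h1.2]
    refine (Complex.norm_le_abs_re_add_abs_im _).trans ?_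
    change |vHat ω i false / (2 * Real.pi)| + |-(vHat ω i true / (2 * Real.pi))| ≤ 2
    linarith
  · norm_num

theorem sum_div_aHat_le (ω : Record K G) (s : Finset ℤ) {a : ℤ → ℝ} (ha : ∀ k, 0 ≤ a k) :
    ∑ k ∈ s, a k / aHat ω k ≤ 2 * ∑ k ∈ s, a k := by
  rw [Finset.mul_sum]
  refine Finset.sum_le_sum fun k _ => ?_
  have h := aHat_pos ω k
  rw [div_le_iff₀ (by linarith)]
  nlinarith [ha k]

theorem le_sum_div_aHat (ω : Record K G) (s : Finset ℤ) {a : ℤ → ℝ} (ha : ∀ k, 0 ≤ a k) :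
    (∑ k ∈ s, a k) / 2 ≤ ∑ k ∈ s, a k / aHat ω k := by
  rw [Finset.sum_div]
  refine Finset.sum_le_sum fun k _ => ?_
  exact div_le_div_of_nonneg_left (ha k) (by linarith [aHat_pos ω k]) (aHat_le ω k)

/-- For large `t / ε` a cutoff captures half of the sums that determine the runtime. -/
theorem exists_half_le_cutoff_sum {f : ℝ → ℝ} (hf : Admissible f)
    (h : ∃ x ∈ Set.Icc (-1 : ℝ) 1, f x ≠ 0) : ∃ r : ℝ, 0 ≤ r ∧ ∀ (t ε : ℝ) (K : ℕ), 0 < t → 0 < ε →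
      r ≤ t / ε → IsCutoff f t ε K →
      (∑' k : ℤ, ‖coeff f k‖) / 2 ≤ ∑ k ∈ Finset.Icc (-(K : ℤ)) K, ‖coeff f k‖ ∧
      (∑' k : ℤ, ‖coeff f k‖ * (k : ℝ) ^ 2) / 2
        ≤ ∑ k ∈ Finset.Icc (-(K : ℤ)) K, ‖coeff f k‖ * (k : ℝ) ^ 2 := by
  have h1 := (summable_norm_coeff hf).hasSum.eventually
    (eventually_ge_nhds (half_lt_self (tsum_norm_coeff_pos hf h)))
  have h2 := (summable_coeff_sq hf).hasSum.eventually
    (eventually_ge_nhds (half_lt_self (tsum_coeff_sq_pos hf h)))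
  obtain ⟨J, hJ1, hJ2⟩ := (h1.and h2).exists
  -- The threshold dominates every inverse on J. A nonzero coefficient of J beyond the cutoff would
  -- be both at least ε/t and at most ε/(6t), so the cutoff loses nothing of J. Vanishing
  -- coefficients enter harmlessly with inverse 0.
  refine ⟨∑ k ∈ J, ‖coeff f k‖⁻¹, Finset.sum_nonneg fun k _ => by positivity,
    fun t ε K ht hε hr hK => ?_⟩
  have hmem : ∀ k ∈ J, k ∉ Finset.Icc (-(K : ℤ)) K → coeff f k = 0 := by
    intro k hk hkK
    by_contra hne
    have hpos : 0 < ‖coeff f k‖ := norm_pos_iff.2 hne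
    have hle := norm_coeff_le_of_isCutoff hf hK hkK
    have h3 : ‖coeff f k‖⁻¹ ≤ t / ε :=
      (Finset.single_le_sum (f := fun k => ‖coeff f k‖⁻¹) (fun j _ => by positivity) hk).trans hr
    rw [inv_le_iff_one_le_mul₀ hpos, div_mul_eq_mul_div, le_div_iff₀ hε, one_mul] at h3
    rw [le_div_iff₀ (by positivity)] at hle
    nlinarith
  have hsub : ∀ a : ℤ → ℝ, (∀ k, 0 ≤ a k) → ∑ k ∈ J, ‖coeff f k‖ * a k
      ≤ ∑ k ∈ Finset.Icc (-(K : ℤ)) K, ‖coeff f k‖ * a k := by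
    intro a ha
    refine (Finset.sum_le_sum_of_subset_of_nonneg
      (Finset.subset_union_left (s₂ := Finset.Icc (-(K : ℤ)) K))
      fun k _ _ => mul_nonneg (norm_nonneg _) (ha k)).trans
      (Finset.sum_subset Finset.subset_union_right fun k hk hkK => ?_).ge
    rw [hmem k ((Finset.mem_union.1 hk).resolve_right hkK) hkK, norm_zero, zero_mul]
  have e := hsub (fun _ => 1) fun _ => zero_le_one
  simp only [mul_one] at e
  exact ⟨hJ1.trans e, hJ2.trans (hsub _ fun k => sq_nonneg _)⟩

/-- The five rotations per iteration contribute 5β, which has no factor Q; S ≤ (A + 1)Q absorbs it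
and keeps the constants independent of f. -/
theorem runtime_bounds_of_iterations {A S Q β R N n t ε : ℝ} (hA : 0 < A) (hS : 0 < S) (hQ : 0 < Q) (hn1 : 1 ≤ n)
    (hε : 0 < ε) (hβ1 : S / 4 ≤ β) (hβ2 : β ≤ 2 * S) (hR1 : Q / 4 ≤ R) (hR2 : R ≤ 2 * Q)
    (hSQ : S ≤ (A + 1) * Q) (hN1 : 30 * (β ^ 2 * t ^ 2 / ε) ≤ N)
    (hN2 : N ≤ 32 * (β ^ 2 * t ^ 2 / ε)) :
    75 * (S * Q * t ^ 2 * n / ε) ≤ N / β * (20 * (2 * n + 1) * R + 5 * β) ∧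
    N / β * (20 * (2 * n + 1) * R + 5 * β) ≤ 64 * (130 + 10 * A) * (S * Q * t ^ 2 * n / ε) := by
  have hβ0 : 0 < β := by linarith
  have hR0 : 0 < R := by linarith
  set x := β ^ 2 * t ^ 2 / ε with hx
  have ex : x / β = β * (t ^ 2 / ε) := by rw [hx]; field_simp
  have hte : 0 ≤ t ^ 2 / ε := by positivity
  constructor
  · calc 75 * (S * Q * t ^ 2 * n / ε) = 30 * (S / 4 * (t ^ 2 / ε)) * (20 * (2 * n) * (Q / 4)) := by
          field_simp; ring
      _ ≤ 30 * (β * (t ^ 2 / ε)) * (20 * (2 * n + 1) * R + 5 * β) := by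
          have : 20 * (2 * n) * (Q / 4) ≤ 20 * (2 * n + 1) * R := by
            gcongr; linarith
          gcongr
          linarith
      _ = 30 * x / β * (20 * (2 * n + 1) * R + 5 * β) := by rw [← ex]; ring
      _ ≤ _ := by gcongr
  · calc _ ≤ 32 * x / β * (20 * (2 * n + 1) * R + 5 * β) := by gcongr
      _ = 32 * (β * (t ^ 2 / ε)) * (20 * (2 * n + 1) * R + 5 * β) := by rw [← ex]; ring
      _ ≤ 32 * (2 * S * (t ^ 2 / ε)) * ((130 + 10 * A) * (n * Q)) := by
          have b1 : 20 * (2 * n + 1) * R ≤ 20 * (3 * n) * (2 * Q) := by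
            gcongr; linarith
          have b2 : Q ≤ n * Q := le_mul_of_one_le_left hQ.le hn1
          have b3 : 5 * β ≤ 10 * ((A + 1) * (n * Q)) := by
            have : (A + 1) * Q ≤ (A + 1) * (n * Q) := by gcongr
            linarith
          gcongr
          linarith
      _ = _ := by ring

theorem exists_mainRuntime_bounds : ∃ c C : ℝ, 0 < c ∧ 0 < C ∧ ∀ f : ℝ → ℝ, Admissible f →
    (∃ x ∈ Set.Icc (-1 : ℝ) 1, f x ≠ 0) →
    ∃ r : ℝ, ∀ (n : ℕ) (t ε : ℝ) (K : ℕ), 0 < n → 0 < t → 0 < ε → r ≤ t / ε →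
      r ≤ t ^ 2 / ε → IsCutoff f t ε K → ∀ ω : Record K (numGen f t ε),
      c * (runConst f * t ^ 2 * n / ε) ≤ mainRuntime n f t ε ω ∧
      mainRuntime n f t ε ω ≤ C * (runConst f * t ^ 2 * n / ε) := by
  obtain ⟨A, hA, hA0⟩ := exists_norm_coeff_zero_le
  refine ⟨75, 64 * (130 + 10 * A), by norm_num, by positivity, fun f hf hne => ?_⟩
  obtain ⟨r, hr0, hr⟩ := exists_half_le_cutoff_sum hf hne
  have hS := tsum_norm_coeff_pos hf hne
  have hQ := tsum_coeff_sq_pos hf hne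
  set S := ∑' k : ℤ, ‖coeff f k‖ with hSd
  set Q := ∑' k : ℤ, ‖coeff f k‖ * (k : ℝ) ^ 2 with hQd
  -- Nonzero frequencies have k² ≥ 1, so only the mean value needs an argument.
  have hSQ : S ≤ (A + 1) * Q := by
    have h1 : HasSum (fun k : ℤ => (if k = 0 then ‖coeff f 0‖ else 0) + ‖coeff f k‖ * (k : ℝ) ^ 2)
        (‖coeff f 0‖ + Q) := (hasSum_ite_eq 0 _).add (summable_coeff_sq hf).hasSum
    refine (hasSum_le (fun k => ?_) (summable_norm_coeff hf).hasSum h1).trans ?_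
    · rcases eq_or_ne k 0 with rfl | hk
      · simp
      · rw [if_neg hk, zero_add]
        exact le_mul_of_one_le_right (norm_nonneg _) (one_le_sq_intCast hk)
    · linarith [hA0 f hf]
  -- The term 10/S makes the quadratic entry of the maximum in `iterations` the larger one. The term
  -- 16/S² makes x ≥ 1, so that rounding up 30x stays below 32x.
  refine ⟨r + 10 / S + 16 / S ^ 2, fun n t ε K hn ht hε h1 h2 hK ω => ?_⟩
  have hq1 : 0 < 10 / S := by positivity
  have hq2 : 0 < 16 / S ^ 2 := by positivity
  obtain ⟨hSK, hQK⟩ := hr t ε K ht hε (by linarith) hK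
  have hSK' : ∑ k ∈ Finset.Icc (-(K : ℤ)) K, ‖coeff f k‖ ≤ S :=
    (summable_norm_coeff hf).sum_le_tsum _ fun k _ => norm_nonneg _
  have hQK' : ∑ k ∈ Finset.Icc (-(K : ℤ)) K, ‖coeff f k‖ * (k : ℝ) ^ 2 ≤ Q :=
    (summable_coeff_sq hf).sum_le_tsum _ fun k _ => by positivity
  have hβ1 : S / 4 ≤ beta f ω := by
    have := le_sum_div_aHat ω (Finset.Icc (-(K : ℤ)) K) (a := fun k => ‖coeff f k‖)
      fun k => norm_nonneg _
    change _ ≤ beta f ω at this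
    linarith
  have hβ2 : beta f ω ≤ 2 * S := by
    have := sum_div_aHat_le ω (Finset.Icc (-(K : ℤ)) K) (a := fun k => ‖coeff f k‖)
      fun k => norm_nonneg _
    change beta f ω ≤ _ at this
    linarith
  have hrt := mainRuntime_eq (n := n) f t ε ω (by linarith : 0 < beta f ω).ne'
  set R := ∑ k ∈ Finset.Icc (-(K : ℤ)) K, ‖coeff f k‖ / aHat ω k * (k : ℝ) ^ 2 with hR
  have eR : R = ∑ k ∈ Finset.Icc (-(K : ℤ)) K, ‖coeff f k‖ * (k : ℝ) ^ 2 / aHat ω k :=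
    Finset.sum_congr rfl fun k _ => by ring
  have hR1 : Q / 4 ≤ R := by
    have := le_sum_div_aHat ω (Finset.Icc (-(K : ℤ)) K) (a := fun k => ‖coeff f k‖ * (k : ℝ) ^ 2)
      fun k => by positivity
    rw [eR]; linarith
  have hR2 : R ≤ 2 * Q := by
    have := sum_div_aHat_le ω (Finset.Icc (-(K : ℤ)) K) (a := fun k => ‖coeff f k‖ * (k : ℝ) ^ 2)
      fun k => by positivity
    rw [eR]; linarith
  rw [hrt]
  change 75 * (S * Q * t ^ 2 * n / ε) ≤ _ ∧ _ ≤ 64 * (130 + 10 * A) * (S * Q * t ^ 2 * n / ε)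
  set β := beta f ω with hβ
  have hβ0 : 0 < β := by linarith
  have hR0 : 0 < R := by linarith
  have hn1 : (1 : ℝ) ≤ n := by exact_mod_cast hn
  set x := β ^ 2 * t ^ 2 / ε with hx
  have hmax : max (10 * β ^ 2 * t ^ 2 / (ε / 3)) (5 * β * t / 2) = 30 * x := by
    rw [max_eq_left]
    · rw [hx]; field_simp; norm_num
    · have h3 : 10 / S ≤ t / ε := by linarith
      rw [div_le_div_iff₀ hS hε] at h3
      rw [le_div_iff₀ (by positivity)]
      have h4 : 5 * ε ≤ 2 * (β * t) := by nlinarith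
      nlinarith [mul_pos hβ0 ht]
  have hN1 : 30 * x ≤ mainN f t ε ω := by
    rw [← hmax]; exact Nat.le_ceil _
  have hx1 : 1 ≤ x := by
    have h3 : 16 / S ^ 2 ≤ t ^ 2 / ε := by linarith
    have h4 : (S / 4) ^ 2 ≤ β ^ 2 := by gcongr
    rw [div_le_iff₀ (by positivity)] at h3
    rw [hx, mul_div_assoc]
    have h5 : 0 ≤ t ^ 2 / ε := by positivity
    nlinarith
  have hN2 : (mainN f t ε ω : ℝ) ≤ 32 * x := by
    have := Nat.ceil_lt_add_one (by positivity : 0 ≤ 30 * x)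
    rw [← hmax] at this
    change (mainN f t ε ω : ℝ) < _ at this
    linarith
  exact runtime_bounds_of_iterations hA hS hQ hn1 hε hβ1 hβ2 hR1 hR2 hSQ hN1 hN2

end MainRuntime
end UHET

end

/-! ### The theorem. -/

theorem mainTheorem1 :
    ∃ c C : ℝ, 0 < c ∧ 0 < C ∧ ∀ f : ℝ → ℝ, Admissible f →
      -- error and mean squared error
      (∀ (n : ℕ) (H : Op n) (t ε : ℝ) (K : ℕ), 0 < n → H.IsHermitian →
        ‖Matrix.toEuclideanCLM (𝕜 := ℂ) (traceless H)‖ ≤ 1 → 0 < t → 0 < ε → IsCutoff f t ε K →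
        (∀ j : Index n f t ε K, 0 ≤ indexProb H j) ∧ ∑ j : Index n f t ε K, indexProb H j = 1 ∧
        ∀ (d : ℕ) (ψ : Qubits n × Fin d → ℂ), ∑ x, ‖ψ x‖ ^ 2 = 1 →
          traceNorm (ampliate (idealOp f H t) (pureState ψ) -
            ∑ j : Index n f t ε K,
              (indexProb H j : ℂ) • ampliate (runOp H j) (pureState ψ)) ≤ ε ∧
          ∑ j : Index n f t ε K, indexProb H j *
            traceNorm (ampliate (idealOp f H t) (pureState ψ) -
              ampliate (runOp H j) (pureState ψ)) ^ 2 ≤ 2 * ε) ∧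
      -- cutoff number
      (∀ t ε : ℝ, 0 < t → 0 < ε → ∃ K, IsLeast {K | IsCutoff f t ε K} K) ∧
      (∃ B : ℝ, ∀ t ε : ℝ, 0 < ε → ε ≤ t → ∀ K, IsLeast {K | IsCutoff f t ε K} K →
        (K : ℝ) ≤ B * (t / ε) ^ (1 / 3 : ℝ)) ∧
      -- runtime
      Summable (fun k : ℤ => ‖coeff f k‖ * (k : ℝ) ^ 2) ∧
      ((∃ x ∈ Set.Icc (-1 : ℝ) 1, f x ≠ 0) →
        (∃ a A : ℝ, 0 < a ∧ 0 < A ∧ ∀ (n : ℕ) (t ε : ℝ) (K : ℕ) (T : ℝ), 0 < n → 0 < ε → ε ≤ t →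
          IsCutoff f t ε K → 0 ≤ T →
          a * ((K : ℝ) ^ 3 * t ^ 3 * n / ε ^ 3) + T ≤ preRuntime n f t ε K T ∧
          preRuntime n f t ε K T ≤ A * ((K : ℝ) ^ 3 * t ^ 3 * n / ε ^ 3) + T) ∧
        0 < runConst f ∧
        ∃ r : ℝ, ∀ (n : ℕ) (t ε : ℝ) (K : ℕ), 0 < n → 0 < t → 0 < ε → r ≤ t / ε →
          r ≤ t ^ 2 / ε → IsCutoff f t ε K → ∀ ω : Record K (numGen f t ε),
          c * (runConst f * t ^ 2 * n / ε) ≤ mainRuntime n f t ε ω ∧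
          mainRuntime n f t ε ω ≤ C * (runConst f * t ^ 2 * n / ε)) := by
  obtain ⟨c, C, hc, hC, hmain⟩ := exists_mainRuntime_bounds
  refine ⟨c, C, hc, hC, fun f hf => ⟨fun n H t ε K _ hH h1 ht hε hK => ?_,
    fun t ε ht hε => exists_isLeast_cutoff hf ht hε, exists_least_cutoff_le hf,
    summable_coeff_sq hf, fun hne => ⟨?_, runConst_pos hf hne, hmain f hf hne⟩⟩⟩
  · have hs := summable_coeff_abs hf
    exact ⟨indexProb_nonneg hH, sum_indexProb H f t ε, fun d ψ hψ =>
      ⟨traceNorm_sub_le ht hε hH h1 hs hK hψ, sum_traceNorm_sq_le ht hε hH h1 hs hK hψ⟩⟩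
  · obtain ⟨a, A, ha, hA, h⟩ := exists_preRuntime_bounds hf hne
    exact ⟨a, A, ha, hA, fun n t ε K T hn hε hεt _ _ => h n t ε K T hn hε hεt⟩
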